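/- Let $A$ be a finite alphabet and $\xi$ a primitive substitution on $A$ that is proper (all words $\xi(b)$, $b\in A$, begin with one common letter, and all end with one common letter). Let $M$ be its incidence matrix ($M_{i,j}$ is the number of occurrences of $i$ in $\xi(j)$), $\Omega_\xi\subset A^{\mathbb Z}$ its subshift (the sequences all of whose factors occur in some $\xi^n(b)$), $S$ the shift and $\mu$ the shift-invariant probability measure on $\Omega_\xi$. Let $E^0$ be the generalized eigenspace of $M^t$ for the eigenvalue $0$, and $E^s\subset\mathbb R^A$ the sum of the generalized eigenspaces of $M^t$ for the eigenvalues $z$ with $0<|z|<1$. Assume Hypotheses P: (i) the characteristic polynomial of $M$ has exactly one complex root of modulus greater than $1$; (ii) $\dim E^s=d-1$ and there are real numbers $\alpha_1,\dots,\alpha_{d-1}$ such that $1,\alpha_1,\dots,\alpha_{d-1}$ are linearly independent over $\mathbb Q$ and each $e^{2i\pi\alpha_i}$ is an eigenvalue of $(\Omega_\xi,S,\mu)$, with an eigenfunction in $L^2(\mu)$; (iii) the Perron number $\beta$ of $\xi$ satisfies $\beta\,|\det(M^t|_{E^s})|=1$. For $j\ge 0$ and $x\in\Omega_\xi$ let $\rho_j(x)=\min\{k\ge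 0: S^kx\in\xi^j(\Omega_\xi)\}$, and let $\sigma_j(x)\in\mathbb Z^A$ be the vector with entries $\sigma_j(x)_a=\#\{k:\rho_j(x)\le k<\rho_{j+1}(x),\ S^kx\in\xi^j([a])\}$, where $[a]=\{y\in\Omega_\xi:y_0=a\}$. For $v=(v(1),\dots,v(d-1))\in(\mathbb R^A)^{d-1}$ put $$F_v(x)=\Big(\sum_{j\ge 0}\langle \sigma_j(x),(M^t)^j v(i)\rangle\Big)_{1\le i\le d-1}\in\mathbb R^{d-1}.$$ Let $\pi:\mathbb R^{d-1}\to\mathbb T^{d-1}=\mathbb R^{d-1}/\mathbb Z^{d-1}$ be the projection and $\lambda$ the Lebesgue measure on $\mathbb R^{d-1}$. Then there are vectors $v(i)\in\mathbb R^A$, $w(i)\in\mathbb Z^A$ ($1\le i\le d-1$) with $$\alpha_i(1,\dots,1)^t=v(i)+w(i)\quad\text{and}\quad (M^t)^k v(i)\to 0\ \ (k\to\infty),\qquad (*)$$ and they can be chosen with all $v(i)\in E^s$ if $(1,\dots,1)^t$ has no component in $E^0$. For all $v,w$ that satisfy $(*)$, the series defining $F_v$ converge, $F_v$ is continuous on $\Omega_\xi$,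 and $\pi\circ F_v$ is a factor map from $(\Omega_\xi,S)$ onto $\mathbb T^{d-1}$ with the translation by $-\pi(\alpha_1,\dots,\alpha_{d-1})$. There is an integer $Z$ such that $$\#\{y\in\Omega_\xi:\pi(F_v(y))=\pi(F_v(x))\}=Z\quad\text{for }\mu\text{-a.e. }x.$$ If all $v(i)$ are in $E^s$, then, with $F=F_v$, $$\lambda(F(\Omega_\xi))=Z.$$ In general $\lambda(F_u(\Omega_\xi))=Z$ where $u(i)\in E^s$ is the component of $v(i)$ in $E^s$, that is, the unique $u(i)\in E^s$ with $v(i)-u(i)\in E^0$ (the series defining $F_u$ converge as well). -/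

import Mathlib

open Filter Topology MeasureTheory

noncomputable section

namespace Subst

variable {A : Type*}

/-- The word `ξⁿ(b)`, for the morphism of the free monoid that sends the letter `a` to `ξ a`. -/
def iter (ξ : A → List A) : ℕ → A → List A
  | 0, b => [b]
  | n + 1, b => (iter ξ n b).flatMap ξ

/-- `ξ` is a substitution: some `ξ a` begins with `a`, and all the lengths `|ξⁿ(b)|` tend to
infinity. -/
def IsSubstitution (ξ : A → List A) : Prop :=
  (∃ a, (ξ a).head? = some a) ∧ ∀ b, Tendsto (fun n => (iter ξ n b).length) atTop atTop

/-- All the words `ξ b` begin with one letter, and all of them end with one letter. -/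
def IsProper (ξ : A → List A) : Prop :=
  (∃ a, ∀ b, (ξ b).head? = some a) ∧ (∃ a, ∀ b, (ξ b).getLast? = some a)

/-- The language of `ξ`: the words that occur in some `ξⁿ(b)`. -/
def language (ξ : A → List A) : Set (List A) :=
  {u | ∃ n b, u <:+: iter ξ n b}

/-- The shift `S` on two-sided sequences. -/
def shift (x : ℤ → A) : ℤ → A := fun k => x (k + 1)

/-- The set `Ω_ξ` of the two-sided sequences all of whose factors are in the language of `ξ`. -/
def Omega (ξ : A → List A) : Set (ℤ → A) :=
  {x | ∀ (i : ℤ) (m : ℕ), (List.range m).map (fun j : ℕ => x (i + j)) ∈ language ξ}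

/-- The map `… x₋₁ . x₀ x₁ … ↦ … ξ(x₋₁) . ξ(x₀) ξ(x₁) …` on two-sided sequences, for a morphism
without empty images: the letter of index `k ≥ 0` is the one of index `k` in `ξ(x₀) ⋯ ξ(x_k)`, and
that of index `-1 - k` is read from right to left in `ξ(x_{-1-k}) ⋯ ξ(x₋₁)`. The default value
`x 0` is used only if some image is empty. -/
def extend (ξ : A → List A) (x : ℤ → A) : ℤ → A
  | Int.ofNat k => ((List.range (k + 1)).flatMap fun i => ξ (x (Int.ofNat i))).getD k (x 0)
  | Int.negSucc k =>
      ((List.range (k + 1)).flatMap fun i => (ξ (x (Int.negSucc i))).reverse).getD k (x 0)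

/-- The cylinder `[a]` of the subshift. -/
def cylinder (ξ : A → List A) (a : A) : Set (ℤ → A) := {x ∈ Omega ξ | x 0 = a}

/-- The first time `k ≥ 0` at which `Sᵏ x` lies in the base `ξʲ(Ω_ξ)`. -/
def entrance (ξ : A → List A) (j : ℕ) (x : ℤ → A) : ℕ :=
  sInf {k | shift^[k] x ∈ (extend ξ)^[j] '' Omega ξ}

/-- The number of times at which the orbit of `x` is in `ξʲ([a])`, from its entrance in `ξʲ(Ω_ξ)`
(included) to its entrance in `ξʲ⁺¹(Ω_ξ)` (excluded). -/
def visits (ξ : A → List A) (j : ℕ) (x : ℤ → A) (a : A) : ℕ :=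
  {k | entrance ξ j x ≤ k ∧ k < entrance ξ (j + 1) x ∧
    shift^[k] x ∈ (extend ξ)^[j] '' cylinder ξ a}.ncard

/-- `lam` is an eigenvalue of the shift for the measure `μ` (eigenfunction in `L²`). -/
def IsEigenvalue [MeasurableSpace A] (μ : Measure (ℤ → A)) (lam : ℂ) : Prop :=
  ∃ f : (ℤ → A) → ℂ, MemLp f 2 μ ∧ ¬ (f =ᵐ[μ] 0) ∧
    (fun x => f (shift x)) =ᵐ[μ] fun x => lam * f x

/-- `μ` is a shift-invariant probability measure carried by `Ω_ξ`. -/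
structure IsInvariantProbability [MeasurableSpace A] (ξ : A → List A) (μ : Measure (ℤ → A)) :
    Prop where
  prob : IsProbabilityMeasure μ
  carried : ∀ᵐ x ∂μ, x ∈ Omega ξ
  invariant : MeasurePreserving shift μ μ

variable [Fintype A] [DecidableEq A]

/-- The incidence matrix: its entry `(i, j)` is the number of occurrences of `i` in `ξ j`. -/
def incidence (ξ : A → List A) : Matrix A A ℝ := Matrix.of fun i j => ((ξ j).count i : ℝ)

/-- The complex roots of the characteristic polynomial of the incidence matrix. -/
def charRoots (ξ : A → List A) : Set ℂ := {z | Polynomial.aeval z (incidence ξ).charpoly = 0}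

/-- The linear map given by the transpose of the incidence matrix. -/
def transposeMap (ξ : A → List A) : (A → ℝ) →ₗ[ℝ] (A → ℝ) := (incidence ξ).transpose.mulVecLin

/-- The generalized eigenspace `E⁰` of the transposed incidence matrix for the eigenvalue `0` (it is
the kernel once `ξ` is replaced by a power). -/
def nilspace (ξ : A → List A) : Submodule ℝ (A → ℝ) := Module.End.maxGenEigenspace (transposeMap ξ) 0

/-- The vectors without component in `E⁰`, that is, the sum of the other generalized eigenspaces:
the (stationary) intersection of the ranges of the powers of the transposed incidence matrix. -/
def eventualRange (ξ : A → List A) : Submodule ℝ (A → ℝ) :=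
  ⨅ n : ℕ, LinearMap.range (transposeMap ξ ^ n)

/-- The space `Eˢ`, the sum of the generalized eigenspaces of the transposed incidence matrix for
the eigenvalues `z` with `0 < |z| < 1`: the vectors whose iterates tend to `0`, without component
in `E⁰`. -/
def stable (ξ : A → List A) : Submodule ℝ (A → ℝ) where
  carrier := {v | v ∈ eventualRange ξ ∧ Tendsto (fun n : ℕ => (transposeMap ξ ^ n) v) atTop (𝓝 0)}
  zero_mem' := ⟨zero_mem _, by simp⟩
  add_mem' := by
    rintro v w ⟨hv, hv'⟩ ⟨hw, hw'⟩
    exact ⟨add_mem hv hw, by simpa using hv'.add hw'⟩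
  smul_mem' := by
    rintro c v ⟨hv, hv'⟩
    exact ⟨Submodule.smul_mem _ c hv, by simpa using hv'.const_smul c⟩

theorem stable_invariant (ξ : A → List A) : ∀ v ∈ stable ξ, transposeMap ξ v ∈ stable ξ := by
  rintro v ⟨hv, hv'⟩
  have h : ∀ (n : ℕ) (v : A → ℝ),
      (transposeMap ξ ^ n) (transposeMap ξ v) = (transposeMap ξ ^ (n + 1)) v :=
    fun n v => by rw [pow_succ, Module.End.mul_apply]
  refine ⟨?_, ?_⟩
  · rw [eventualRange, Submodule.mem_iInf] at hv ⊢
    intro n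
    obtain ⟨u, hu⟩ := hv n
    refine ⟨transposeMap ξ u, ?_⟩
    rw [h, pow_succ', Module.End.mul_apply, hu]
  · simp only [h]
    exact hv'.comp (tendsto_add_atTop_nat 1)

/-- The Perron number: a positive root of the characteristic polynomial that is larger than the
modulus of every other root. -/
def IsPerronNumber (ξ : A → List A) (β : ℝ) : Prop :=
  0 < β ∧ (β : ℂ) ∈ charRoots ξ ∧ ∀ z ∈ charRoots ξ, z ≠ (β : ℂ) → ‖z‖ < β

/-- The standing hypotheses on a substitution `ξ`, its invariant measure `μ` and the real numbers
`α₁, …, αₙ`, where `n = d - 1`. -/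
structure HypothesesP [MeasurableSpace A] (ξ : A → List A) (μ : Measure (ℤ → A)) {n : ℕ}
    (α : Fin n → ℝ) : Prop where
  substitution : IsSubstitution ξ
  primitive : (incidence ξ).IsPrimitive
  proper : IsProper ξ
  measure : IsInvariantProbability ξ μ
  unique_root : ∃! z : ℂ, z ∈ charRoots ξ ∧ 1 < ‖z‖
  dim_stable : Module.finrank ℝ (stable ξ) = n
  eigenvalue : ∀ i, IsEigenvalue μ (Complex.exp (2 * Real.pi * Complex.I * α i))
  independent : LinearIndependent ℚ (Fin.cons 1 α : Fin (n + 1) → ℝ)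
  det_stable : ∀ β, IsPerronNumber ξ β →
    β * |LinearMap.det ((transposeMap ξ).restrict (stable_invariant ξ))| = 1

/-- `αᵢ (1, …, 1) = v(i) + w(i)`, where `w(i)` is an integer vector and the iterates of `v(i)` under
the transposed incidence matrix tend to `0`. -/
def IsDecomposition (ξ : A → List A) {n : ℕ} (α : Fin n → ℝ) (v : Fin n → A → ℝ)
    (w : Fin n → A → ℤ) : Prop :=
  ∀ i, (∀ a, α i = v i a + w i a) ∧
    Tendsto (fun k : ℕ => (transposeMap ξ ^ k) (v i)) atTop (𝓝 0)

/-- `u(i)` is the component of `v(i)` in `Eˢ`: `u(i)` is in `Eˢ` and `v(i) - u(i)` is in `E⁰`. -/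
def IsStablePart (ξ : A → List A) {n : ℕ} (v u : Fin n → A → ℝ) : Prop :=
  ∀ i, u i ∈ stable ξ ∧ v i - u i ∈ nilspace ξ

/-- The terms of the series whose sum is the `i`-th coordinate of `F x`. -/
def term (ξ : A → List A) {n : ℕ} (v : Fin n → A → ℝ) (x : ℤ → A) (i : Fin n) (j : ℕ) : ℝ :=
  ∑ a, (visits ξ j x a : ℝ) * (transposeMap ξ ^ j) (v i) a

/-- The map `F` from `Ω_ξ` to `ℝⁿ` that is defined by the vectors `v(1), …, v(n)`. -/
def F (ξ : A → List A) {n : ℕ} (v : Fin n → A → ℝ) (x : ℤ → A) : Fin n → ℝ :=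
  fun i => ∑' j, term ξ v x i j

end Subst

/-- The canonical projection from `ℝⁿ` onto the torus `ℝⁿ / ℤⁿ`. -/
def torusProj {n : ℕ} (y : Fin n → ℝ) : Fin n → UnitAddCircle := fun i => (y i : UnitAddCircle)

end

/-! Write `T` for the transposed incidence matrix. The proof rests on recognizability: up to a shift
of the indices, a point `x` of Ω_ξ is cut in exactly one way into words ξ(y_i) with `y` in Ω_ξ.
Choosing the indices so that the coordinate `-1` lies in ξ(y_{-1}) gives a continuous desubstitution
`x ↦ y`. The vector σ_j(x) counts the letters of the j-th desubstitution of `x` that precede its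
first cut, so F_v(x) is a finite sum of values of `v` plus F_{Tv}(y). Decay of the iterates of `v`
in finite dimension is geometric, whence convergence, continuity and the cocycle equation F_v(Sx) =
F_v(x) - v(x_0). Since α_i - v(i)_a is an integer, π ∘ F_v is equivariant. The image of μ is
invariant under an irrational translation, so it is Lebesgue measure, and the compact image is the
whole torus.

For the existence of `v` and `w`, properness and an approximation of eigenfunctions by continuous
functions show that λ^{|ξⁿ(a)|} → 1 for each eigenvalue λ = e^{2iπα} (`tendsto_eigenvalue_pow`),
that is, Tⁿ(α,…,α) approaches the integer vectors. By (iii) the product of the nonzero eigenvalues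
is ±1, so `T` is invertible over the integers on the image of a power. The approximating integer
vectors eventually form a `T`-orbit, which can be pulled back to time `0`; this gives `w`.

For the count, let `u` be the stable part of `v`. If the u(i) were dependent, F_v(Ω_ξ) would lie in
finitely many parallel hyperplanes and could not cover the torus. They therefore form a basis of
E^s, and `T` acts on it by a matrix `N` with β|det N| = 1. The sets F_u({x_{-1} = b}) are covered by
affine images of one another under `N`. Weighted by the positive eigenvector of `T`, the volumes of
the pieces add up exactly to those of the sets, so overlaps are null
(`volume_affineImage_inter_eq_zero`). Off a null set, F_u(x) thus determines the position of the
origin at every level, and by properness these positions determine `x`. As F_v - F_u takes finitely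
many values, the mean number of points in a fibre of π ∘ F_v is λ(F_u(Ω_ξ)). The number is invariant
under an ergodic translation, hence almost everywhere constant. -/

open scoped Matrix

set_option linter.unusedSectionVars false

/-! ### Words read in two-sided sequences -/

namespace Subst

/-- The sequence `z` reads the word `w` from the position `t` on. -/
def Reads {A : Type*} (z : ℤ → A) : ℤ → List A → Prop
  | _, [] => True
  | t, a :: w => z t = a ∧ Reads z (t + 1) w

section Reads

variable {A : Type*}

theorem reads_append {z : ℤ → A} {t : ℤ} {u w : List A} :
    Reads z t (u ++ w) ↔ Reads z t u ∧ Reads z (t + u.length) w := by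
  induction u generalizing t with
  | nil => simp [Reads]
  | cons a u ih =>
    simp only [List.cons_append, Reads, ih, List.length_cons, Nat.cast_add, Nat.cast_one, and_assoc]
    rw [show t + 1 + (u.length : ℤ) = t + (u.length + 1) by ring]

theorem Reads.getElem {z : ℤ → A} {t : ℤ} {w : List A} (h : Reads z t w) {k : ℕ}
    (hk : k < w.length) : z (t + k) = w[k] := by
  induction w generalizing t k with
  | nil => simp at hk
  | cons a w ih =>
    cases k with
    | zero => simpa using h.1
    | succ k =>
      have := ih h.2 (k := k) (by simpa using hk)
      rw [List.getElem_cons_succ, ← this]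
      congr 1; push_cast; ring

theorem Reads.of_getElem {z : ℤ → A} {t : ℤ} {w : List A}
    (h : ∀ (k : ℕ) (hk : k < w.length), z (t + k) = w[k]) : Reads z t w := by
  induction w generalizing t with
  | nil => trivial
  | cons a w ih =>
    refine ⟨?_, ih fun k hk => ?_⟩
    · have := h 0 (by simp)
      rwa [List.getElem_cons_zero, Nat.cast_zero, add_zero] at this
    have := h (k + 1) (by simpa using hk)
    rw [List.getElem_cons_succ] at this
    rw [← this]
    congr 1; push_cast; ring

theorem Reads.eq_of_reads {z z' : ℤ → A} {t t' : ℤ} {w : List A} (h : Reads z t w)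
    (h' : Reads z' t' w) {k : ℤ} (h0 : 0 ≤ k) (hk : k < w.length) : z (t + k) = z' (t' + k) := by
  lift k to ℕ using h0
  rw [h.getElem (by exact_mod_cast hk), h'.getElem (by exact_mod_cast hk)]

theorem reads_map_range (z : ℤ → A) (t : ℤ) (m : ℕ) :
    Reads z t ((List.range m).map fun j : ℕ => z (t + j)) :=
  .of_getElem fun k hk => by simp

theorem Reads.eq_map_range {z : ℤ → A} {t : ℤ} {w : List A} (h : Reads z t w) :
    w = (List.range w.length).map fun j : ℕ => z (t + j) :=
  List.ext_getElem (by simp) fun k hk _ => by simp [h.getElem hk]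

theorem Reads.comp_add {z : ℤ → A} {t : ℤ} {w : List A} (k : ℤ) :
    Reads (fun s => z (s + k)) t w ↔ Reads z (t + k) w := by
  induction w generalizing t with
  | nil => simp [Reads]
  | cons a w ih => simp only [Reads, ih]; rw [show t + 1 + k = t + k + 1 by ring]

theorem Reads.exists_of_infix {z : ℤ → A} {t : ℤ} {u w : List A} (h : Reads z t w)
    (hu : u <:+: w) : ∃ s, t ≤ s ∧ s + u.length ≤ t + w.length ∧ Reads z s u := by
  obtain ⟨p, q, rfl⟩ := hu
  rw [reads_append, reads_append] at h
  exact ⟨t + p.length, by omega, by simp; omega, h.1.2⟩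

theorem mem_Omega_iff {ξ : A → List A} {x : ℤ → A} :
    x ∈ Omega ξ ↔ ∀ t w, Reads x t w → w ∈ language ξ := by
  constructor
  · intro h t w hw
    rw [hw.eq_map_range]
    exact h t w.length
  · exact fun h i m => h i _ (reads_map_range x i m)

theorem language_of_infix {ξ : A → List A} {u w : List A} (hw : w ∈ language ξ) (hu : u <:+: w) :
    u ∈ language ξ := by
  obtain ⟨n, b, h⟩ := hw
  exact ⟨n, b, hu.trans h⟩

theorem shift_iterate (x : ℤ → A) (k : ℕ) : shift^[k] x = fun t => x (t + k) := by
  induction k generalizing x with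
  | zero => simp
  | succ k ih =>
    rw [Function.iterate_succ_apply, ih]
    funext t
    simp only [shift]
    congr 1; push_cast; ring

theorem comp_add_mem_Omega {ξ : A → List A} {x : ℤ → A} (hx : x ∈ Omega ξ) (k : ℤ) :
    (fun t => x (t + k)) ∈ Omega ξ := by
  rw [mem_Omega_iff] at hx ⊢
  exact fun t w h => hx _ _ ((Reads.comp_add k).1 h)

end Reads

/-! ### Iterates of a substitution -/

section Iter

variable {A : Type*} {ξ : A → List A}

theorem iter_one (ξ : A → List A) : iter ξ 1 = ξ := by
  funext b; simp [iter]

theorem iter_add (ξ : A → List A) (n m : ℕ) (b : A) :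
    iter ξ (n + m) b = (iter ξ n b).flatMap (iter ξ m) := by
  induction m with
  | zero => simp [iter, List.flatMap_singleton']
  | succ m ih =>
    rw [← add_assoc, iter, ih, List.flatMap_assoc]
    rfl

theorem flatMap_mem_language {u : List A} (hu : u ∈ language ξ) (n : ℕ) :
    u.flatMap (iter ξ n) ∈ language ξ := by
  obtain ⟨m, b, p, q, h⟩ := hu
  refine ⟨m + n, b, p.flatMap (iter ξ n), q.flatMap (iter ξ n), ?_⟩
  rw [iter_add, ← h, List.flatMap_append, List.flatMap_append]

theorem iter_ne_nil (hne : ∀ b, ξ b ≠ []) (n : ℕ) (b : A) : iter ξ n b ≠ [] := by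
  induction n with
  | zero => simp [iter]
  | succ n ih =>
    obtain ⟨a, w, h⟩ := List.exists_cons_of_ne_nil ih
    simp [iter, h, hne]

theorem length_iter_pos (hne : ∀ b, ξ b ≠ []) (n : ℕ) (b : A) : 0 < (iter ξ n b).length :=
  List.length_pos_iff.2 (iter_ne_nil hne n b)

end Iter

/-- The sequence `z` is the concatenation of the words `ξⁿ(y i)`, which begin at the positions
`c i`. -/
structure Str {A : Type*} (ξ : A → List A) (n : ℕ) (z : ℤ → A) (c : ℤ → ℤ) (y : ℤ → A) : Prop where
  step : ∀ i, c (i + 1) = c i + (iter ξ n (y i)).length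
  reads : ∀ i, Reads z (c i) (iter ξ n (y i))

/-! ### Decompositions of a sequence into words ξⁿ(y_i) -/

namespace Str

variable {A : Type*} {ξ : A → List A} {n m : ℕ} {x y z : ℤ → A} {c d : ℤ → ℤ}

theorem reads_flatMap (h : Str ξ n z c y) {i : ℤ} {w : List A} (hw : Reads y i w) :
    c (i + w.length) = c i + (w.flatMap (iter ξ n)).length ∧
      Reads z (c i) (w.flatMap (iter ξ n)) := by
  induction w generalizing i with
  | nil => simp [Reads]
  | cons a w ih =>
    obtain ⟨h1, h2⟩ := ih hw.2
    have h3 := h.step i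
    rw [hw.1] at h3
    rw [List.flatMap_cons, reads_append]
    refine ⟨?_, ?_, ?_⟩
    · rw [show i + ((a :: w).length : ℤ) = i + 1 + w.length by push_cast [List.length_cons]; ring,
        h1, h3]
      simp; ring
    · rw [← hw.1]; exact h.reads i
    · rw [← h3]; exact h2

theorem comp (h : Str ξ n z c y) (h' : Str ξ m y d x) : Str ξ (m + n) z (fun i => c (d i)) x where
  step i := by
    have := (h.reads_flatMap (h'.reads i)).1
    rw [← h'.step] at this
    rw [this, iter_add]
  reads i := by
    rw [iter_add]
    exact (h.reads_flatMap (h'.reads i)).2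

theorem comp_add (h : Str ξ n z c y) (k : ℤ) : Str ξ n (fun t => z (t + k)) (fun i => c i - k) y where
  step i := by have := h.step i; omega
  reads i := by
    rw [Reads.comp_add, sub_add_cancel]
    exact h.reads i

theorem reindex (h : Str ξ n z c y) (k : ℤ) : Str ξ n z (fun i => c (i + k)) (fun i => y (i + k)) where
  step i := by
    have := h.step (i + k)
    rw [← this]
    congr 1; ring
  reads i := h.reads (i + k)

theorem zero (x : ℤ → A) : Str ξ 0 x (fun i => i) x where
  step i := by simp [iter]
  reads i := by simp [iter, Reads]

theorem strictMono (hne : ∀ b, ξ b ≠ []) (h : Str ξ n z c y) : StrictMono c :=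
  strictMono_int_of_lt_succ fun i => by
    have := h.step i
    have := length_iter_pos hne n (y i)
    omega

theorem exists_cell (hne : ∀ b, ξ b ≠ []) (h : Str ξ n z c y) (t : ℤ) :
    ∃ i, c i ≤ t ∧ t < c (i + 1) := by
  have hm := h.strictMono hne
  have hle : ∀ k : ℕ, c 0 + k ≤ c k ∧ c (-k) ≤ c 0 - k := by
    intro k
    induction k with
    | zero => simp
    | succ k ih =>
      have h1 : c k < c (k + 1) := hm (by omega)
      have h2 : c (-((k : ℤ) + 1)) < c (-k) := hm (by omega)
      push_cast
      omega
  obtain ⟨i, hi, hmax⟩ := Int.exists_greatest_of_bdd (P := fun i => c i ≤ t)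
    ⟨(t - c 0).natAbs, fun i hi => by
      by_contra hlt
      have := hm.monotone (not_le.1 hlt).le
      have := hm (not_le.1 hlt)
      have := (hle (t - c 0).natAbs).1
      omega⟩
    ⟨-(t - c 0).natAbs, by have := (hle (t - c 0).natAbs).2; omega⟩
  refine ⟨i, hi, ?_⟩
  by_contra hlt
  have := hmax (i + 1) (not_lt.1 hlt)
  omega

theorem cell_unique (hne : ∀ b, ξ b ≠ []) (h : Str ξ n z c y) {t i j : ℤ} (hi : c i ≤ t)
    (hi' : t < c (i + 1)) (hj : c j ≤ t) (hj' : t < c (j + 1)) : i = j := by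
  have hm := h.strictMono hne
  have h1 : i < j + 1 := hm.lt_iff_lt.1 (by omega)
  have h2 : j < i + 1 := hm.lt_iff_lt.1 (by omega)
  omega

theorem cut_sub_eq {z' : ℤ → A} {c' : ℤ → ℤ} (h : Str ξ n z c y) (h' : Str ξ n z' c' y) (i : ℤ) :
    c i - c 0 = c' i - c' 0 := by
  induction i using Int.induction_on with
  | zero => simp
  | succ i ih => have := h.step i; have := h'.step i; omega
  | pred i ih =>
    have h1 := h.step (-i - 1)
    have h2 := h'.step (-i - 1)
    rw [sub_add_cancel] at h1 h2
    omega

/-- Relative to `c 0`, both the cuts and the words between them depend on `y` alone. -/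
theorem eq_of_str (hne : ∀ b, ξ b ≠ []) {z' : ℤ → A} {c' : ℤ → ℤ} (h : Str ξ n z c y)
    (h' : Str ξ n z' c' y) (t : ℤ) : z (t + c 0) = z' (t + c' 0) := by
  obtain ⟨i, hi, hi'⟩ := h.exists_cell hne (t + c 0)
  have h1 := h.cut_sub_eq h' i
  have h2 := h.step i
  have := (h.reads i).eq_of_reads (h'.reads i) (k := t + c 0 - c i) (by omega) (by omega)
  rw [show t + c 0 = c i + (t + c 0 - c i) by ring, this]
  congr 1; omega

theorem le_cut (h : Str ξ n z c y) {l : ℕ} (hl : ∀ a, l ≤ (iter ξ n a).length) (i : ℤ) (k : ℕ) :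
    c i + k * l ≤ c (i + k) := by
  induction k with
  | zero => simp
  | succ k ih =>
    have := h.step (i + k)
    have := hl (y (i + k))
    push_cast
    rw [← add_assoc]
    nlinarith

theorem cut_le (h : Str ξ n z c y) {l : ℕ} (hl : ∀ a, (iter ξ n a).length ≤ l) (i : ℤ) (k : ℕ) :
    c (i + k) ≤ c i + k * l := by
  induction k with
  | zero => simp
  | succ k ih =>
    have := h.step (i + k)
    have := hl (y (i + k))
    push_cast
    rw [← add_assoc]
    nlinarith

end Str

/-! ### The action of ξ on two-sided sequences -/

section Extend

variable {A : Type*} {ξ : A → List A}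

theorem _root_.List.IsPrefix.getD_eq {p q : List A} (h : p <+: q) {k : ℕ} (hk : k < p.length) (d : A) :
    q.getD k d = p[k] := by
  rw [List.getD_eq_getElem _ _ (hk.trans_le h.length_le), h.getElem]

theorem flatMap_range_prefix (f : ℕ → List A) {m m' : ℕ} (h : m ≤ m') :
    (List.range m).flatMap f <+: (List.range m').flatMap f := by
  obtain ⟨k, rfl⟩ := Nat.exists_eq_add_of_le h
  rw [List.range_add, List.flatMap_append]
  exact List.prefix_append _ _

theorem le_length_flatMap_range (f : ℕ → List A) (hf : ∀ i, f i ≠ []) (m : ℕ) :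
    m ≤ ((List.range m).flatMap f).length := by
  induction m with
  | zero => simp
  | succ m ih =>
    have := List.length_pos_iff.2 (hf m)
    rw [List.range_succ, List.flatMap_append, List.length_append]
    simp only [List.flatMap_cons, List.flatMap_nil, List.append_nil]
    omega

/-- Replaces the letterwise definition of `extend` by cuts. To the left of the origin a cut is minus
the total length of the words read from right to left. -/
theorem str_extend (hne : ∀ b, ξ b ≠ []) (x : ℤ → A) :
    ∃ c, c 0 = 0 ∧ Str ξ 1 (extend ξ x) c x := by
  set f : ℕ → List A := fun i => ξ (x (Int.ofNat i)) with hf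
  set g : ℕ → List A := fun i => (ξ (x (Int.negSucc i))).reverse with hg
  let c : ℤ → ℤ := fun i => match i with
    | Int.ofNat m => (((List.range m).flatMap f).length : ℤ)
    | Int.negSucc m => -(((List.range (m + 1)).flatMap g).length : ℤ)
  have hfs : ∀ m, (List.range (m + 1)).flatMap f = (List.range m).flatMap f ++ f m := fun m => by
    rw [List.range_succ, List.flatMap_append]; simp
  have hgs : ∀ m, (List.range (m + 1)).flatMap g = (List.range m).flatMap g ++ g m := fun m => by
    rw [List.range_succ, List.flatMap_append]; simp
  have hgl : ∀ m, (g m).length = (ξ (x (Int.negSucc m))).length := fun m => by simp [hg]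
  have hc : ∀ m : ℕ, c (Int.ofNat m) = (((List.range m).flatMap f).length : ℤ) := fun _ => rfl
  have hc' : ∀ m : ℕ, c (Int.negSucc m) = -(((List.range (m + 1)).flatMap g).length : ℤ) :=
    fun _ => rfl
  refine ⟨c, by simpa using hc 0, ⟨?_, ?_⟩⟩
  · rintro (m | m)
    · rw [show Int.ofNat m + 1 = Int.ofNat (m + 1) from rfl, hc, hc, hfs, iter_one]
      simp [hf]
    · cases m with
      | zero =>
        rw [show Int.negSucc 0 + 1 = Int.ofNat 0 from rfl, hc, hc', hgs, iter_one]
        simp [hg]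
      | succ m =>
        rw [show Int.negSucc (m + 1) + 1 = Int.negSucc m from rfl, hc', hc', hgs (m + 1), iter_one,
          List.length_append, hgl]
        push_cast; ring
  · rintro (m | m)
    · rw [hc, iter_one]
      refine .of_getElem fun k hk => ?_
      rw [← Nat.cast_add]
      change List.getD _ _ _ = _
      have hlen := le_length_flatMap_range f (fun i => hne _) m
      have hk' : ((List.range m).flatMap f).length + k < ((List.range (m + 1)).flatMap f).length := by
        rw [hfs, List.length_append]; simp only [hf] at *; omega
      rw [(flatMap_range_prefix f (m := m + 1)
        (m' := ((List.range m).flatMap f).length + k + 1) (by omega)).getD_eq hk']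
      simp only [hfs]
      rw [List.getElem_append_right (by omega)]
      simp [hf]
    · rw [hc', iter_one]
      refine .of_getElem fun k hk => ?_
      have hlen := le_length_flatMap_range g (fun i => by simp [hg, hne]) m
      have hl : ((List.range (m + 1)).flatMap g).length =
        ((List.range m).flatMap g).length + (ξ (x (Int.negSucc m))).length := by
        rw [hgs, List.length_append, hgl]
      set q := ((List.range m).flatMap g).length + ((ξ (x (Int.negSucc m))).length - 1 - k) with hq
      have e : (-(((List.range (m + 1)).flatMap g).length : ℤ) + k) = Int.negSucc q := by
        rw [Int.negSucc_eq]; omega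
      rw [e]
      change List.getD _ _ _ = _
      have hk' : q < ((List.range (m + 1)).flatMap g).length := by omega
      rw [(flatMap_range_prefix g (m := m + 1) (m' := q + 1) (by omega)).getD_eq hk']
      simp only [hgs]
      rw [List.getElem_append_right (by omega)]
      have e' : q - ((List.range m).flatMap g).length = (ξ (x (Int.negSucc m))).length - 1 - k := by
        omega
      have e'' : (ξ (x (Int.negSucc m))).length - 1 -
          ((ξ (x (Int.negSucc m))).length - 1 - k) = k := by omega
      simp only [e']
      simp only [hg, List.getElem_reverse, e'']

theorem str_extend_iterate (hne : ∀ b, ξ b ≠ []) (n : ℕ) (x : ℤ → A) :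
    ∃ c, c 0 = 0 ∧ Str ξ n ((extend ξ)^[n] x) c x := by
  induction n generalizing x with
  | zero => exact ⟨_, rfl, Str.zero x⟩
  | succ n ih =>
    obtain ⟨c, hc0, hc⟩ := ih (extend ξ x)
    obtain ⟨d, hd0, hd⟩ := str_extend hne x
    refine ⟨fun i => c (d i), by simp [hd0, hc0], ?_⟩
    rw [Function.iterate_succ_apply, add_comm]
    exact hc.comp hd

/-- A sequence with a decomposition into the words `ξ (y i)` is a translate of `extend ξ y`. -/
theorem Str.eq_extend (hne : ∀ b, ξ b ≠ []) {z y : ℤ → A} {c : ℤ → ℤ} (h : Str ξ 1 z c y) :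
    (fun t => z (t + c 0)) = extend ξ y := by
  obtain ⟨d, hd0, hd⟩ := str_extend hne y
  funext t
  rw [h.eq_of_str hne hd t, hd0, add_zero]

/-- Words ξⁿ(a) are nonempty, so a factor of length `m` of `z` fits in the image of `m + 1`
consecutive letters of `y`. -/
theorem Str.mem_Omega (hne : ∀ b, ξ b ≠ []) {n : ℕ} {z y : ℤ → A} {c : ℤ → ℤ}
    (h : Str ξ n z c y) (hy : y ∈ Omega ξ) : z ∈ Omega ξ := by
  rw [mem_Omega_iff] at hy ⊢
  intro t w hw
  obtain ⟨i, hi, hi'⟩ := h.exists_cell hne t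
  have h1 := (h.reads_flatMap (reads_map_range y i (w.length + 1))).2
  have h2 := h.le_cut (l := 1) (fun a => length_iter_pos hne n a) (i + 1) w.length
  have h3 := (h.reads_flatMap (reads_map_range y i (w.length + 1))).1
  simp only [List.length_map, List.length_range] at h3
  refine language_of_infix (flatMap_mem_language (hy _ _ (reads_map_range y i (w.length + 1))) n) ?_
  set W := ((List.range (w.length + 1)).map fun j : ℕ => y (i + j)).flatMap (iter ξ n) with hW
  have hle : (t - c i).toNat + w.length ≤ W.length := by
    push_cast at h3
    rw [show i + ((w.length : ℤ) + 1) = i + 1 + w.length by ring] at h3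
    omega
  have : w = (W.drop (t - c i).toNat).take w.length := by
    refine List.ext_getElem (by simp; omega) fun k hk hk' => ?_
    rw [List.getElem_take, List.getElem_drop, ← hw.getElem hk, ← h1.getElem (by omega)]
    congr 1; push_cast; omega
  rw [this]
  exact (List.take_prefix _ _).isInfix.trans (List.drop_suffix _ _).isInfix

end Extend

end Subst

namespace Subst

theorem exists_length_le {A : Type*} [Finite A] (ξ : A → List A) (n : ℕ) : ∃ l, ∀ a, (iter ξ n a).length ≤ l := by
  obtain ⟨l, hl⟩ := (Set.finite_range fun a => (iter ξ n a).length).bddAbove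
  exact ⟨l, fun a => hl ⟨a, rfl⟩⟩

/-! ### Compactness of Ω_ξ and existence of desubstitutions -/

section Topology

variable {A : Type*} [TopologicalSpace A] [DiscreteTopology A]

theorem eventually_agree (x : ℤ → A) (m : ℕ) :
    ∀ᶠ x' in 𝓝 x, ∀ t : ℤ, |t| ≤ m → x' t = x t := by
  have h : ∀ t ∈ Set.Icc (-(m : ℤ)) m, ∀ᶠ x' in 𝓝 x, x' t = x t := fun t _ =>
    by
    have := (continuous_apply (A := fun _ : ℤ => A) t).tendsto x
    rw [nhds_discrete A] at this
    exact this.eventually (p := fun a => a = x t) (Filter.eventually_pure.2 rfl)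
  filter_upwards [(Set.finite_Icc (-(m : ℤ)) m).eventually_all.2 h] with x' hx' t ht
  exact hx' t (abs_le.1 ht)

theorem continuous_of_agree {B : Type*} [TopologicalSpace B] {f : (ℤ → A) → B} (m : ℕ)
    (h : ∀ x x' : ℤ → A, (∀ t : ℤ, |t| ≤ m → x' t = x t) → f x' = f x) : Continuous f := by
  refine continuous_iff_continuousAt.2 fun x => ?_
  refine ContinuousAt.congr (f := fun _ => f x) continuousAt_const ?_
  filter_upwards [eventually_agree x m] with x' hx'
  exact (h x x' hx').symm

theorem extend_agree {ξ : A → List A} {x x' : ℤ → A} {t : ℤ}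
    (h : ∀ s : ℤ, |s| ≤ |t| → x' s = x s) : extend ξ x' t = extend ξ x t := by
  have h0 : x' 0 = x 0 := h 0 (by simp)
  rcases t with k | k
  · have : ∀ i ∈ List.range (k + 1), ξ (x' (Int.ofNat i)) = ξ (x (Int.ofNat i)) := fun i hi => by
      rw [h]
      simp at hi ⊢; omega
    simp only [extend, List.flatMap_congr this, h0]
  · have : ∀ i ∈ List.range (k + 1), (ξ (x' (Int.negSucc i))).reverse =
        (ξ (x (Int.negSucc i))).reverse := fun i hi => by
      rw [h]
      simp [Int.negSucc_eq, abs_le] at hi ⊢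
      rw [abs_of_nonpos (by omega)]
      omega
    simp only [extend, List.flatMap_congr this, h0]

theorem continuous_extend (ξ : A → List A) : Continuous (extend ξ) :=
  continuous_pi fun t => continuous_of_agree t.natAbs fun x x' h =>
    extend_agree fun s hs => h s (by simpa using hs)

theorem continuous_translate (k : ℤ) : Continuous fun (x : ℤ → A) (t : ℤ) => x (t + k) :=
  continuous_pi fun t => continuous_apply (t + k)

theorem isClosed_Omega (ξ : A → List A) : IsClosed (Omega ξ) := by
  have : Omega ξ = ⋂ (i : ℤ) (m : ℕ),
      (fun x : ℤ → A => (List.range m).map (fun j : ℕ => x (i + j)) ∈ language ξ) ⁻¹' {True} := by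
    ext x; simp [Omega]
  rw [this]
  refine isClosed_iInter fun i => isClosed_iInter fun m => ?_
  let _ : TopologicalSpace Prop := ⊥
  have _ : DiscreteTopology Prop := ⟨rfl⟩
  refine (isClosed_discrete _).preimage (continuous_of_agree (i.natAbs + m) fun x x' h => ?_)
  have : (List.range m).map (fun j : ℕ => x' (i + j)) = (List.range m).map fun j : ℕ => x (i + j) :=
    List.map_congr_left fun j hj => h _ (by
      simp only [List.mem_range] at hj
      rw [abs_le]; omega)
  rw [this]

variable [Finite A]

/-- A compactness argument: each central window of `x` lies in some ξ(ξᴺ(b)), which desubstitutes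
it, and a limit of these finite solutions desubstitutes `x`. -/
theorem exists_desubstitution_one {ξ : A → List A} (hne : ∀ b, ξ b ≠ []) {x : ℤ → A}
    (hx : x ∈ Omega ξ) : ∃ y ∈ Omega ξ, ∃ c, Str ξ 1 x c y := by
  obtain ⟨l, hl⟩ := exists_length_le ξ 1
  -- The offset `o` is the place of the origin in its word. The approximant is arbitrary far away,
  -- so its factors are controlled only at distances `k` for which `k + 1` words, of length at most
  -- `l`, fit in half the window.
  have key : ∀ m : ℕ, ∃ (y : ℤ → A) (o : Fin (l + 1)),
      (∀ t : ℤ, |t| ≤ (m + 1 : ℕ) → extend ξ y (t + o) = x t) ∧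
      ∀ k : ℕ, (k + 1) * l ≤ m + 1 → ∀ w, Reads y (-k) w → w.length ≤ 2 * k → w ∈ language ξ := by
    intro m
    obtain ⟨N, b, hN⟩ := mem_Omega_iff.1 hx _ _ (reads_map_range x (-(m + 1 : ℕ)) (2 * (m + 1) + 1))
    set W := (List.range (2 * (m + 1) + 1)).map fun j : ℕ => x (-(m + 1 : ℕ) + j) with hW
    have hWl : W.length = 2 * (m + 1) + 1 := by simp [hW]
    -- The window has at least three letters, so it is no factor of the single letter ξ⁰(b).
    rcases N with _ | N
    · have := hN.length_le
      simp [iter] at this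
      omega
    set u := iter ξ N b with hu
    have hN' : W <:+: u.flatMap (iter ξ 1) := by rw [iter_one]; exact hN
    -- The word `u`, padded on both sides by values that play no role.
    let Y : ℤ → A := fun k => u.getD k.toNat b
    obtain ⟨c, hc0, hc⟩ := str_extend hne Y
    have hYu : Reads Y 0 u := .of_getElem fun k hk => by
      simp [Y, List.getElem?_eq_getElem hk]
    obtain ⟨h1, h2⟩ := hc.reads_flatMap hYu
    obtain ⟨s, hs, hs', hsW⟩ := h2.exists_of_infix hN'
    rw [← h1, hWl] at hs'
    obtain ⟨i, hi, hi'⟩ := hc.exists_cell hne (s + (m + 1))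
    have hst := hc.step i
    have hli := hl (Y i)
    have hre := hc.reindex i
    obtain ⟨d, hd0, hd⟩ := str_extend hne fun j => Y (j + i)
    refine ⟨fun j => Y (j + i), ⟨(s + (m + 1) - c i).toNat, by omega⟩, ?_, ?_⟩
    · intro t ht
      rw [abs_le] at ht
      have h3 := hd.eq_of_str hne hre (t + (s + (m + 1) - c i).toNat)
      rw [hd0, add_zero] at h3
      rw [h3]
      have h4 := hsW.eq_of_reads (reads_map_range x (-(m + 1 : ℕ)) (2 * (m + 1) + 1))
        (k := t + (m + 1)) (by omega) (by rw [hWl]; omega)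
      rw [show t + (((s + (m + 1) - c i).toNat : ℕ) : ℤ) + c (0 + i) = s + (t + (m + 1)) by
        rw [zero_add]; omega, h4]
      congr 1; push_cast; ring
    · intro k hk w hw hwk
      have hm := hc.strictMono hne
      have h5 := hc.cut_le hl (i - k) k
      have h6 := hc.cut_le hl i k
      rw [sub_add_cancel] at h5
      have hk' : ((k : ℤ) + 1) * l ≤ m + 1 := by exact_mod_cast hk
      have h7 : 0 ≤ i - k := by
        rw [← hm.le_iff_le, hc0]
        nlinarith
      have h8 : i + k ≤ u.length := by
        rw [← hm.le_iff_le, ← zero_add (u.length : ℤ)]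
        push_cast at hs'
        nlinarith
      rw [Reads.comp_add] at hw
      have h9 : w = (u.drop (i - k).toNat).take w.length := by
        refine List.ext_getElem (by simp; omega) fun j hj hj' => ?_
        rw [List.getElem_take, List.getElem_drop, ← hw.getElem hj, ← hYu.getElem]
        congr 1; push_cast; omega
      rw [h9]
      exact ⟨N, b, (List.take_prefix _ _).isInfix.trans (List.drop_suffix _ _).isInfix⟩
  choose Y o hY hlang using key
  obtain ⟨⟨y, o'⟩, φ, hφ, hlim⟩ := CompactSpace.tendsto_subseq fun m => (Y m, o m)
  have hlimY : Tendsto (fun m => Y (φ m)) atTop (𝓝 y) := (continuous_fst.tendsto _).comp hlim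
  have hlimo : ∀ᶠ m in atTop, o (φ m) = o' := by
    have : Tendsto (fun m => o (φ m)) atTop (𝓝 o') := (continuous_snd.tendsto _).comp hlim
    simpa [nhds_discrete] using this
  have hyΩ : y ∈ Omega ξ := by
    rw [mem_Omega_iff]
    intro t w hw
    set k := t.natAbs + w.length with hk
    obtain ⟨m, hm, hm'⟩ := ((hlimY.eventually (eventually_agree y k)).and
      (eventually_ge_atTop ((k + 1) * l))).exists
    have h1 := reads_map_range (Y (φ m)) (-k) (2 * k)
    have h2 := hlang (φ m) k (hm'.trans ((hφ.id_le m).trans (Nat.le_succ _))) _ h1 (by simp)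
    refine language_of_infix h2 ?_
    have h3 : w = (((List.range (2 * k)).map fun j : ℕ => Y (φ m) (-k + j)).drop
        (t + k).toNat).take w.length := by
      refine List.ext_getElem (by simp; omega) fun j hj hj' => ?_
      rw [List.getElem_take, List.getElem_drop, ← hw.getElem hj, ← h1.getElem, hm]
      · congr 1; omega
      · rw [abs_le]; omega
    rw [h3]
    exact (List.take_prefix _ _).isInfix.trans (List.drop_suffix _ _).isInfix
  have hxy : ∀ t, extend ξ y (t + o') = x t := by
    intro t
    obtain ⟨m, hm, hm', hm''⟩ := ((hlimY.eventually
      ((continuous_extend ξ).continuousAt.eventually (eventually_agree _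
        (t.natAbs + l + 1)))).and (hlimo.and (eventually_ge_atTop t.natAbs))).exists
    have h1 := hm (t + o') (by have := o'.2; rw [abs_le]; omega)
    rw [← h1, ← hm']
    exact hY (φ m) t (by have := hφ.id_le m; simp only [id] at this; rw [abs_le]; omega)
  refine ⟨y, hyΩ, ?_⟩
  obtain ⟨c, -, hc⟩ := str_extend hne y
  exact ⟨_, by simpa [funext hxy] using hc.comp_add o'⟩

theorem exists_desubstitution {ξ : A → List A} (hne : ∀ b, ξ b ≠ []) (n : ℕ) {x : ℤ → A}
    (hx : x ∈ Omega ξ) : ∃ y ∈ Omega ξ, ∃ c, Str ξ n x c y := by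
  induction n with
  | zero => exact ⟨x, hx, _, Str.zero x⟩
  | succ n ih =>
    obtain ⟨y, hy, c, hc⟩ := ih
    obtain ⟨y', hy', c', hc'⟩ := exists_desubstitution_one hne hy
    exact ⟨y', hy', _, add_comm n 1 ▸ hc.comp hc'⟩

end Topology

/-! ### Comparable lengths and bounded gaps -/

/-- The standing combinatorial properties of a primitive proper substitution. -/
structure IsRegular {A : Type*} (ξ : A → List A) : Prop where
  ne_nil : ∀ b, ξ b ≠ []
  growing : ∀ b, Tendsto (fun n => (iter ξ n b).length) atTop atTop
  mixing : ∃ p, ∀ a b, a ∈ iter ξ p b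
  proper : IsProper ξ

section Regular

variable {A : Type*} [Finite A] {ξ : A → List A}

theorem length_flatMap_le {f : A → List A} {l : ℕ} (hf : ∀ a, (f a).length ≤ l) (w : List A) :
    (w.flatMap f).length ≤ w.length * l := by
  induction w with
  | nil => simp
  | cons a w ih =>
    have := hf a
    simp only [List.flatMap_cons, List.length_append, List.length_cons]
    nlinarith

theorem infix_flatMap {f : A → List A} {w : List A} {a : A} (ha : a ∈ w) : f a <:+: w.flatMap f := by
  obtain ⟨s, t, rfl⟩ := List.append_of_mem ha
  exact ⟨s.flatMap f, t.flatMap f, by simp⟩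

theorem IsRegular.length_mono (h : IsRegular ξ) (a : A) : Monotone fun n => (iter ξ n a).length := by
  refine monotone_nat_of_le_succ fun n => ?_
  have : ∀ w : List A, w.length ≤ (w.flatMap ξ).length := fun w => by
    induction w with
    | nil => simp
    | cons b w ih =>
      have := List.length_pos_iff.2 (h.ne_nil b)
      simp only [List.flatMap_cons, List.length_append, List.length_cons]
      omega
  exact this _

/-- Every letter `c` occurs in ξᵖ(b), so |ξᵐ(c)| ≤ |ξ^{p+m}(b)|, and ξ^{p+m}(a) consists of at most
max |ξᵖ| words ξᵐ(c). -/
theorem IsRegular.exists_length_le_mul (h : IsRegular ξ) :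
    ∃ C : ℕ, 0 < C ∧ ∀ n a b, (iter ξ n a).length ≤ C * (iter ξ n b).length := by
  obtain ⟨p, hp⟩ := h.mixing
  obtain ⟨l, hl⟩ := exists_length_le ξ p
  refine ⟨l + 1, by omega, fun n a b => ?_⟩
  have hpos := length_iter_pos h.ne_nil n b
  rcases le_total n p with hn | hn
  · have := h.length_mono a hn
    have := hl a
    dsimp only at *
    nlinarith
  · obtain ⟨m, rfl⟩ := Nat.exists_eq_add_of_le hn
    have h1 : ∀ c, (iter ξ m c).length ≤ (iter ξ (p + m) b).length := fun c => by
      rw [iter_add]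
      exact (infix_flatMap (hp c b)).length_le
    have h2 := length_flatMap_le h1 (iter ξ p a)
    rw [← iter_add] at h2
    have := hl a
    nlinarith

theorem IsRegular.eventually_le_length (h : IsRegular ξ) (K : ℕ) :
    ∀ᶠ n in atTop, ∀ a, K ≤ (iter ξ n a).length :=
  eventually_all.2 fun a => (h.growing a).eventually_ge_atTop K

/-- If `u` occurs in ξ^q(b), it occurs in ξ^{p+q}(a) for every letter `a`, and a point of Ω_ξ is a
concatenation of such words. -/
theorem IsRegular.exists_reads (h : IsRegular ξ) {u : List A} (hu : u ∈ language ξ) :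
    ∃ D : ℕ, ∀ y ∈ Omega ξ, ∀ i : ℤ, ∃ i', i ≤ i' ∧ i' < i + D ∧ Reads y i' u := by
  let _ : TopologicalSpace A := ⊥
  have _ : DiscreteTopology A := ⟨rfl⟩
  obtain ⟨p, hp⟩ := h.mixing
  obtain ⟨q, b, hq⟩ := hu
  obtain ⟨l, hl⟩ := exists_length_le ξ (p + q)
  refine ⟨2 * l + 1, fun y hy i => ?_⟩
  obtain ⟨Y, -, c, hc⟩ := exists_desubstitution h.ne_nil (p + q) hy
  obtain ⟨j, hj, hj'⟩ := hc.exists_cell h.ne_nil i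
  have h1 := hc.step j
  have h2 := hl (Y j)
  have h3 := hl (Y (j + 1))
  have hr := hc.reads (j + 1)
  have : u <:+: iter ξ (p + q) (Y (j + 1)) := by
    rw [iter_add]
    exact hq.trans (infix_flatMap (hp b _))
  obtain ⟨s, hs, hs', hsr⟩ := hr.exists_of_infix this
  exact ⟨s, by omega, by push_cast; omega, hsr⟩

/-- Finitely many words of the language occur in all windows of one length. -/
theorem IsRegular.exists_reads_forall (h : IsRegular ξ) {s : Set (List A)} (hs : s.Finite) :
    ∃ D : ℕ, ∀ u ∈ s, u ∈ language ξ → ∀ y ∈ Omega ξ, ∀ i : ℤ,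
      ∃ i', i ≤ i' ∧ i' < i + D ∧ Reads y i' u := by
  have h' : ∀ u ∈ s, ∃ D : ℕ, u ∈ language ξ → ∀ y ∈ Omega ξ, ∀ i : ℤ,
      ∃ i', i ≤ i' ∧ i' < i + D ∧ Reads y i' u := fun u _ => by
    by_cases hu : u ∈ language ξ
    · obtain ⟨D, hD⟩ := h.exists_reads hu
      exact ⟨D, fun _ => hD⟩
    · exact ⟨0, fun hu' => absurd hu' hu⟩
  choose! D hD using h'
  obtain ⟨E, hE⟩ := (hs.image D).bddAbove
  refine ⟨E, fun u hu hl y hy i => ?_⟩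
  obtain ⟨i', h1, h2, h3⟩ := hD u hu hl y hy i
  have := hE ⟨u, hu, rfl⟩
  exact ⟨i', h1, by omega, h3⟩

end Regular

end Subst

namespace Subst

/-! ### Recognizability -/

section Recognizability

variable {A : Type*} [Finite A] {ξ : A → List A}

/-- Without a common period, no sequence of `Ω_ξ` has a period `m` on a window of length `K m`. -/
theorem IsRegular.exists_powerFree (h : IsRegular ξ)
    (hap : ∀ m : ℕ, 0 < m → ∃ x ∈ Omega ξ, ∃ t : ℤ, x (t + m) ≠ x t) :
    ∃ K : ℕ, 0 < K ∧ ∀ x ∈ Omega ξ, ∀ m : ℕ, 0 < m → ∀ t : ℤ,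
      ∃ s, t ≤ s ∧ s < t + K * m ∧ x (s + m) ≠ x s := by
  let _ : TopologicalSpace A := ⊥
  have _ : DiscreteTopology A := ⟨rfl⟩
  obtain ⟨C, hC0, hC⟩ := h.exists_length_le_mul
  obtain ⟨l, hl⟩ := exists_length_le ξ 1
  obtain ⟨D, hD⟩ := h.exists_reads_forall (List.finite_length_eq A 2)
  -- Words of length at most `l * C * m` are used: `D + 1` of them lead from the window's start to a
  -- recurrence, one covers an offset inside a word, and the rest is slack.
  refine ⟨(D + 3) * (l * C) + 1, by omega, fun x hx m hm t => ?_⟩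
  by_contra! hper
  have hex : ∃ n, ∀ a, m + 1 ≤ (iter ξ n a).length := (h.eventually_le_length (m + 1)).exists
  classical
  -- By minimality some |ξⁿ⁻¹(a)| is at most `m`, so all |ξⁿ(b)| lie between `m + 1` and `l * C *
  -- m`.
  set n := Nat.find hex with hn
  have hnm := Nat.find_spec hex
  rw [← hn] at hnm
  obtain ⟨N, hN⟩ : ∃ N, n = 1 + N := by
    rcases hn' : n with _ | N
    · have := hnm (x 0)
      rw [hn'] at this
      simp [iter] at this
      omega
    · exact ⟨N, by omega⟩
  have hNm : ∃ a, (iter ξ N a).length ≤ m := by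
    have := Nat.find_min hex (m := N) (by omega)
    push Not at this
    obtain ⟨a, ha⟩ := this
    exact ⟨a, by omega⟩
  obtain ⟨a, ha⟩ := hNm
  have hH : ∀ b, (iter ξ n b).length ≤ l * C * m := fun b => by
    rw [hN, iter_add]
    refine (length_flatMap_le (l := C * m) (fun c => ?_) _).trans ?_
    · exact (hC N c a).trans (Nat.mul_le_mul_left _ ha)
    · rw [mul_assoc]
      exact Nat.mul_le_mul_right _ (hl b)
  obtain ⟨x', hx', t', ht'⟩ := hap m hm
  obtain ⟨y, hy, c, hc⟩ := exists_desubstitution h.ne_nil n hx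
  obtain ⟨y', hy', c', hc'⟩ := exists_desubstitution h.ne_nil n hx'
  obtain ⟨j, hj, hj'⟩ := hc.exists_cell h.ne_nil t
  obtain ⟨k, hk, hk'⟩ := hc'.exists_cell h.ne_nil t'
  have hw := reads_map_range y' k 2
  set w := (List.range 2).map fun i : ℕ => y' (k + i) with hwdef
  have hwl : w.length = 2 := by simp [w]
  -- The image of the two-letter word `w` contains both `t'` and `t' + m`, since ξⁿ of its second
  -- letter is longer than `m`. Its recurrence carries the failure of the period `m` into the window
  -- of `x`.
  obtain ⟨i, hi, hi', hiw⟩ := hD w hwl (mem_Omega_iff.1 hy' _ _ hw) y hy (j + 1)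
  obtain ⟨h1, h2⟩ := hc.reads_flatMap hiw
  obtain ⟨h3, h4⟩ := hc'.reads_flatMap hw
  have hm2 := hc.strictMono h.ne_nil
  have h5 := hc'.step k
  have h6 := hc'.step (k + 1)
  have h7 := hnm (y' (k + 1))
  rw [hwl] at h3
  have h8 : c' (k + 1 + 1) = c' (k + (2 : ℕ)) := by congr 1; push_cast; omega
  have e1 := h2.eq_of_reads h4 (k := t' - c' k) (by omega) (by omega)
  have e2 := h2.eq_of_reads h4 (k := t' + m - c' k) (by omega) (by omega)
  rw [show c' k + (t' - c' k) = t' by ring] at e1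
  rw [show c' k + (t' + m - c' k) = t' + m by ring] at e2
  have h9 := hc.cut_le hH j (D + 1)
  have h10 : c (j + 1) ≤ c i := hm2.monotone hi
  have h11 : c i ≤ c (j + (D + 1 : ℕ)) := hm2.monotone (by push_cast; omega)
  have h12 : c' (k + 1) - c' k ≤ (l * C * m : ℕ) := by have := hH (y' k); omega
  refine ht' ?_
  rw [← e1, ← e2, show c i + (t' + m - c' k) = c i + (t' - c' k) + m by ring]
  refine hper _ (by omega) ?_
  push_cast at h9 h11 h12 ⊢
  have h13 : (0 : ℤ) ≤ l * C * m := by positivity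
  have h14 : (((D : ℤ) + 3) * (l * C) + 1) * m = (D + 1) * (l * C * m) + 2 * (l * C * m) + m := by
    ring
  rw [h14]
  linarith

/-- Equal letters have equal images ξᵃ, hence equal finer subdivisions: relative cuts and letters
inside the two words agree. -/
theorem Str.subcell_eq {a b : ℕ} {x z Y x' z' Y' : ℤ → A} {e g e' g' : ℤ → ℤ}
    (he : Str ξ a x e Y) (hg : Str ξ b z g x) (he' : Str ξ a x' e' Y') (hg' : Str ξ b z' g' x')
    {I I' : ℤ} (hI : Y I = Y' I') {k : ℤ} (hk : 0 ≤ k) (hk' : k < (iter ξ a (Y I)).length) :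
    g (e I + k) - g (e I) = g' (e' I' + k) - g' (e' I') ∧ x (e I + k) = x' (e' I' + k) := by
  have h1 := he.reads I
  have h2 := he'.reads I'
  rw [← hI] at h2
  refine ⟨?_, h1.eq_of_reads h2 hk hk'⟩
  lift k to ℕ using hk
  have hl : ((iter ξ a (Y I)).take k).length = k := by
    rw [List.length_take]; omega
  have htake : ∀ {z : ℤ → A} {t : ℤ}, Reads z t (iter ξ a (Y I)) →
      Reads z t ((iter ξ a (Y I)).take k) := fun {z t} hr => by
    rw [← List.take_append_drop k (iter ξ a (Y I)), reads_append] at hr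
    exact hr.1
  have h3 := (hg.reads_flatMap (htake h1)).1
  have h4 := (hg'.reads_flatMap (htake h2)).1
  rw [hl] at h3 h4
  omega

/-- Two decompositions of one sequence into words `ξ (y i)`, for sequences `y` of `Ω_ξ`, have the
same cells. -/
theorem IsRegular.cells_eq (h : IsRegular ξ)
    (hap : ∀ m : ℕ, 0 < m → ∃ x ∈ Omega ξ, ∃ t : ℤ, x (t + m) ≠ x t)
    {z y y' : ℤ → A} {c c' : ℤ → ℤ} (hy : y ∈ Omega ξ) (hy' : y' ∈ Omega ξ)
    (hc : Str ξ 1 z c y) (hc' : Str ξ 1 z c' y') {t i i' : ℤ} (hi : c i ≤ t) (hi1 : t < c (i + 1))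
    (hi' : c' i' ≤ t) (hi1' : t < c' (i' + 1)) : y i = y' i' ∧ c i = c' i' := by
  let _ : TopologicalSpace A := ⊥
  have _ : DiscreteTopology A := ⟨rfl⟩
  have hne := h.ne_nil
  obtain ⟨K, hK0, hK⟩ := h.exists_powerFree hap
  obtain ⟨C, hC0, hC⟩ := h.exists_length_le_mul
  have hz : z ∈ Omega ξ := hc.mem_Omega hne hy
  set Q : ℕ := 2 * C * C * K + 1 with hQ
  -- The number of local configurations of two superposed decompositions. It does not depend on `P`,
  -- so two of the levels `0, …, P` show the same one.
  set N := Nat.card (((A × A) × (A × A)) × Set.Icc (-(Q : ℤ)) Q) with hN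
  obtain ⟨P, hPN, hPl⟩ : ∃ P, N ≤ P ∧ ∀ a, C * K ≤ (iter ξ (P + 1) a).length := by
    obtain ⟨P, hP⟩ := ((h.eventually_le_length (C * K)).and (eventually_ge_atTop (N + 1))).exists
    refine ⟨P - 1, by omega, ?_⟩
    rw [Nat.sub_add_cancel (by omega)]
    exact hP.1
  set M₀ := (iter ξ (P + 1) (z 0)).length with hM₀
  -- `R` bounds the lengths |ξ^{P+1}(a)| from below. With `B = R / K`, no shift by at most `B` is a
  -- period on a window of length `R`, while all these lengths are at most `2 * C * C * K * B`,
  -- which bounds the offsets in units of `B`.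
  set R := M₀ / C with hR
  have hRlen : ∀ a, R ≤ (iter ξ (P + 1) a).length := fun a =>
    Nat.div_le_of_le_mul (hC _ _ _)
  have hRlt : M₀ < C * (R + 1) := by
    have := Nat.div_add_mod M₀ C
    have := Nat.mod_lt M₀ hC0
    rw [← hR] at *
    nlinarith
  have hRK : K ≤ R := (Nat.le_div_iff_mul_le hC0).2 (by rw [mul_comm]; exact hPl _)
  set B := R / K with hB
  have hB0 : 0 < B := Nat.div_pos hRK hK0
  have hBR : K * B ≤ R := Nat.mul_div_le _ _
  have hBlt : R + 1 ≤ 2 * K * B := by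
    have := Nat.div_add_mod R K
    have := Nat.mod_lt R hK0
    rw [← hB] at *
    nlinarith
  have hHlen : ∀ a, (iter ξ (P + 1) a).length ≤ 2 * C * C * K * B := fun a => by
    have h1 := hC (P + 1) a (z 0)
    have h2 : C * (R + 1) ≤ C * (2 * K * B) := Nat.mul_le_mul_left _ hBlt
    calc _ ≤ C * M₀ := h1
      _ ≤ C * (C * (2 * K * B)) := Nat.mul_le_mul_left _ (by omega)
      _ = _ := by ring
  -- Applying ξᵖ to `z` and desubstituting `y`, `y'` a further `P - p` times, both decompositions
  -- become decompositions of ξᵖ(z) into words of the same level `P + 1`, for every `p ≤ P`.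
  choose d hd0 hd using fun p => str_extend_iterate hne p z
  choose Y _ e he using fun p => exists_desubstitution hne (P - p) hy
  choose Y' _ e' he' using fun p => exists_desubstitution hne (P - p) hy'
  choose I hI hI1 using fun p => (he p).exists_cell hne i
  choose I' hI' hI1' using fun p => (he' p).exists_cell hne i'
  have hS : ∀ p ≤ P, Str ξ (P + 1) ((extend ξ)^[p] z) (fun j => d p (c (e p j))) (Y p) :=
    fun p hp => by
      have := ((hd p).comp hc).comp (he p)
      rwa [show P - p + (1 + p) = P + 1 by omega] at this
  have hS' : ∀ p ≤ P, Str ξ (P + 1) ((extend ξ)^[p] z) (fun j => d p (c' (e' p j))) (Y' p) :=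
    fun p hp => by
      have := ((hd p).comp hc').comp (he' p)
      rwa [show P - p + (1 + p) = P + 1 by omega] at this
  have hpos : ∀ p ≤ P, d p (c (e p (I p))) ≤ d p t ∧ d p t < d p (c (e p (I p + 1))) := fun p hp => by
    have m1 := (hd p).strictMono hne
    have m2 := hc.strictMono hne
    exact ⟨m1.monotone ((m2.monotone (hI p)).trans hi),
      m1 (hi1.trans_le (m2.monotone (by have := hI1 p; omega)))⟩
  have hpos' : ∀ p ≤ P, d p (c' (e' p (I' p))) ≤ d p t ∧ d p t < d p (c' (e' p (I' p + 1))) :=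
    fun p hp => by
      have m1 := (hd p).strictMono hne
      have m2 := hc'.strictMono hne
      exact ⟨m1.monotone ((m2.monotone (hI' p)).trans hi'),
        m1 (hi1'.trans_le (m2.monotone (by have := hI1' p; omega)))⟩
  let o : ℕ → ℤ := fun p => d p (c' (e' p (I' p))) - d p (c (e p (I p)))
  have ho : ∀ p ≤ P, o p / B ∈ Set.Icc (-(Q : ℤ)) Q := fun p hp => by
    have h1 := hpos p hp
    have h2 := hpos' p hp
    have h3 := (hS p hp).step (I p)
    have h4 := (hS' p hp).step (I' p)
    have h5 : ((iter ξ (P + 1) (Y p (I p))).length : ℤ) ≤ 2 * C * C * K * B := by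
      exact_mod_cast hHlen _
    have h6 : ((iter ξ (P + 1) (Y' p (I' p))).length : ℤ) ≤ 2 * C * C * K * B := by
      exact_mod_cast hHlen _
    have hB0' : (0 : ℤ) < B := by exact_mod_cast hB0
    constructor
    · rw [Int.le_ediv_iff_mul_le hB0', hQ]
      push_cast
      simp only [o]
      nlinarith
    · refine Int.ediv_le_of_le_mul hB0' ?_
      rw [hQ]
      push_cast
      simp only [o]
      nlinarith
  let data : Fin (P + 1) → ((A × A) × (A × A)) × Set.Icc (-(Q : ℤ)) Q := fun p =>
    (((Y p (I p), Y p (I p + 1)), (Y' p (I' p), Y' p (I' p + 1))),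
      ⟨o p / B, ho p (by omega)⟩)
  have key : ∀ p q : Fin (P + 1), p < q → data p = data q → y i = y' i' ∧ c i = c' i' := by
    rintro ⟨p, hp⟩ ⟨q, hq⟩ hpq hdata
    simp only [Fin.mk_lt_mk] at hpq
    have hp' : p ≤ P := by omega
    have hq' : q ≤ P := by omega
    simp only [data, Prod.mk.injEq, Subtype.mk.injEq] at hdata
    obtain ⟨⟨⟨a1, a2⟩, a3, a4⟩, a5⟩ := hdata
    -- The offsets agree up to less than `B`. If they differed, comparing the two pairs of equal
    -- words would give ξᵖ(z) a period less than `B` on a window of length `R`.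
    have hoeq : o p = o q := by
      by_contra hne'
      have hR1 : ∀ s : ℤ, 0 ≤ s → s < (iter ξ (P + 1) (Y q (I q))).length + R →
          (extend ξ)^[p] z (d p (c (e p (I p))) + s) =
            (extend ξ)^[q] z (d q (c (e q (I q))) + s) := fun s hs hs' => by
        have hw : Reads (Y p) (I p) [Y q (I q), Y q (I q + 1)] := ⟨a1, a2, trivial⟩
        have hw' : Reads (Y q) (I q) [Y q (I q), Y q (I q + 1)] := ⟨rfl, rfl, trivial⟩
        refine ((hS p hp').reads_flatMap hw).2.eq_of_reads ((hS q hq').reads_flatMap hw').2 hs ?_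
        have := hRlen (Y q (I q + 1))
        simp only [List.flatMap_cons, List.flatMap_nil, List.append_nil, List.length_append]
        push_cast
        omega
      have hR2 : ∀ s : ℤ, 0 ≤ s → s < (iter ξ (P + 1) (Y' q (I' q))).length + R →
          (extend ξ)^[p] z (d p (c' (e' p (I' p))) + s) =
            (extend ξ)^[q] z (d q (c' (e' q (I' q))) + s) := fun s hs hs' => by
        have hw : Reads (Y' p) (I' p) [Y' q (I' q), Y' q (I' q + 1)] := ⟨a3, a4, trivial⟩
        have hw' : Reads (Y' q) (I' q) [Y' q (I' q), Y' q (I' q + 1)] := ⟨rfl, rfl, trivial⟩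
        refine ((hS' p hp').reads_flatMap hw).2.eq_of_reads ((hS' q hq').reads_flatMap hw').2 hs ?_
        have := hRlen (Y' q (I' q + 1))
        simp only [List.flatMap_cons, List.flatMap_nil, List.append_nil, List.length_append]
        push_cast
        omega
      have h1 := hpos q hq'
      have h2 := hpos' q hq'
      have h3 := (hS q hq').step (I q)
      have h4 := (hS' q hq').step (I' q)
      set σ := d q t - d q (c' (e' q (I' q))) with hσ
      have hcmp : ∀ s, σ ≤ s → s < σ + R →
          (extend ξ)^[p] z (d p (c (e p (I p))) + o p + s) =
            (extend ξ)^[p] z (d p (c (e p (I p))) + o q + s) := fun s hs hs' => by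
        have e1 := hR2 s (by omega) (by omega)
        have e2 := hR1 (o q + s) (by simp only [o]; omega) (by simp only [o]; omega)
        rw [show d p (c (e p (I p))) + o p + s = d p (c' (e' p (I' p))) + s by simp only [o]; ring,
          e1, add_assoc (d p (c (e p (I p)))), e2]
        exact congrArg _ (by simp only [o]; ring)
      have hzp : (extend ξ)^[p] z ∈ Omega ξ := (hd p).mem_Omega hne hz
      have hB0' : (0 : ℤ) < B := by exact_mod_cast hB0
      have b1 := Int.emod_add_mul_ediv (o p) B
      have b2 := Int.emod_add_mul_ediv (o q) B
      have b3 := Int.emod_nonneg (o p) hB0'.ne'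
      have b4 := Int.emod_nonneg (o q) hB0'.ne'
      have b5 := Int.emod_lt_of_pos (o p) hB0'
      have b6 := Int.emod_lt_of_pos (o q) hB0'
      rw [a5] at b1
      have hKB : ((K * (o p - o q).natAbs : ℕ) : ℤ) ≤ R := by
        have : (o p - o q).natAbs ≤ B := by omega
        exact_mod_cast (Nat.mul_le_mul_left K this).trans hBR
      push_cast at hKB
      rcases lt_or_gt_of_ne hne' with hlt | hlt
      · obtain ⟨s, hs, hs', hs''⟩ := hK _ hzp (o p - o q).natAbs (by omega)
          (d p (c (e p (I p))) + o p + σ)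
        push_cast at hs'
        refine hs'' ?_
        have := hcmp (s - (d p (c (e p (I p))) + o p)) (by omega) (by omega)
        rw [show d p (c (e p (I p))) + o p + (s - (d p (c (e p (I p))) + o p)) = s by ring] at this
        rw [this]
        exact congrArg _ (by omega)
      · obtain ⟨s, hs, hs', hs''⟩ := hK _ hzp (o p - o q).natAbs (by omega)
          (d p (c (e p (I p))) + o q + σ)
        push_cast at hs'
        refine hs'' ?_
        have := hcmp (s - (d p (c (e p (I p))) + o q)) (by omega) (by omega)
        rw [show d p (c (e p (I p))) + o q + (s - (d p (c (e p (I p))) + o q)) = s by ring] at this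
        rw [← this]
        exact congrArg _ (by omega)
    -- ξ^q(z) is ξ^{p+1}(x). The cells of `i` and `i'`, seen in ξᵖ(z), are transported to ξ^q(z),
    -- where both become cells of this one decomposition.
    set x := (extend ξ)^[q - p - 1] z with hx
    obtain ⟨g, hg0, hg⟩ := str_extend_iterate hne (q - p - 1) z
    obtain ⟨g', hg0', hg'⟩ := str_extend_iterate hne (p + 1) x
    rw [hx, ← Function.iterate_add_apply, show p + 1 + (q - p - 1) = q by omega] at hg'
    have hgd : ∀ j, g' (g j) = d q j := fun j => by
      have h1 := hg'.comp hg
      rw [show q - p - 1 + (p + 1) = q by omega] at h1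
      have h2 := h1.cut_sub_eq (hd q) j
      rw [hg0, hg0', hd0] at h2
      omega
    have s1 := (hg.comp hc).comp (he q)
    have s2 := (hg.comp hc').comp (he' q)
    rw [show P - q + (1 + (q - p - 1)) = P - p by omega] at s1 s2
    have s3 := (hd p).comp hc
    have s4 := (hd p).comp hc'
    rw [add_comm 1 p] at s3 s4
    have h1 := (he p).step (I p)
    have h2 := (he' p).step (I' p)
    have i1 := hI p
    have i2 := hI1 p
    have i3 := hI' p
    have i4 := hI1' p
    obtain ⟨u1, u2⟩ := (he p).subcell_eq s3 s1 hg' a1 (k := i - e p (I p)) (by omega) (by omega)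
    obtain ⟨v1, v2⟩ := (he' p).subcell_eq s4 s2 hg' a3 (k := i' - e' p (I' p)) (by omega) (by omega)
    rw [add_sub_cancel] at u1 u2 v1 v2
    set κ := g (c (e q (I q))) + (i - e p (I p)) with hκ
    set κ' := g (c' (e' q (I' q))) + (i' - e' p (I' p)) with hκ'
    rw [hgd] at u1 v1
    have w1 := hg'.step κ
    have w2 := hg'.step κ'
    have w3 := s3.step i
    have w4 := s4.step i'
    rw [← u2] at w1
    rw [← v2] at w2
    have m1 := (hd p).strictMono hne
    have n1 := m1.monotone hi
    have n2 := m1 hi1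
    have n3 := m1.monotone hi'
    have n4 := m1 hi1'
    simp only [o] at hoeq
    -- Both transported cells contain the image of the point `t`, because the offsets are equal.
    have hκκ : κ = κ' := hg'.cell_unique hne
      (t := d q (c (e q (I q))) + (d p t - d p (c (e p (I p)))))
      (by omega) (by omega) (by omega) (by omega)
    refine ⟨by rw [u2, v2, hκκ], m1.injective ?_⟩
    rw [hκκ] at u1
    omega
  have hcard : Nat.card (((A × A) × (A × A)) × Set.Icc (-(Q : ℤ)) Q) < Nat.card (Fin (P + 1)) := by
    rw [Nat.card_fin]; omega
  obtain ⟨p, q, hpq, hdata⟩ : ∃ p q, p ≠ q ∧ data p = data q := by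
    by_contra! hinj
    have : Function.Injective data := fun p q hpq => by
      by_contra hne'
      exact hinj p q hne' hpq
    exact absurd (Nat.card_le_card_of_injective data this) (not_le.2 hcard)
  rcases lt_or_gt_of_ne hpq with hlt | hlt
  · exact key p q hlt hdata
  · exact key q p hlt hdata.symm

/-- Recognizability: two decompositions differ by a translation of the indices. -/
theorem IsRegular.recognizable (h : IsRegular ξ)
    (hap : ∀ m : ℕ, 0 < m → ∃ x ∈ Omega ξ, ∃ t : ℤ, x (t + m) ≠ x t)
    {z y y' : ℤ → A} {c c' : ℤ → ℤ} (hy : y ∈ Omega ξ) (hy' : y' ∈ Omega ξ)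
    (hc : Str ξ 1 z c y) (hc' : Str ξ 1 z c' y') :
    ∃ k, ∀ i, c' i = c (i + k) ∧ y' i = y (i + k) := by
  have hne := h.ne_nil
  have hm := hc.strictMono hne
  have key : ∀ j, ∃ k, c k = c' j ∧ y k = y' j := fun j => by
    obtain ⟨k, hk, hk'⟩ := hc.exists_cell hne (c' j)
    have := h.cells_eq hap hy hy' hc hc' hk hk' (i' := j) le_rfl
      (hc'.strictMono hne (by omega))
    exact ⟨k, this.2, this.1⟩
  choose k hk hk' using key
  have hsucc : ∀ j, k (j + 1) = k j + 1 := fun j => by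
    refine hm.injective ?_
    rw [hk, hc'.step, hc.step, hk, hk']
  have hlin : ∀ j, k j = j + k 0 := fun j => by
    induction j using Int.induction_on with
    | zero => simp
    | succ j ih => rw [hsucc, ih]; ring
    | pred j ih =>
      have := hsucc (-j - 1)
      rw [sub_add_cancel, ih] at this
      omega
  exact ⟨k 0, fun i => ⟨by rw [← hlin, hk], by rw [← hlin, hk']⟩⟩

end Recognizability

end Subst

/-! ### Perron–Frobenius theory -/

section PerronFrobenius

variable {A : Type*} [Fintype A] [DecidableEq A]

theorem Matrix.mulVec_pos_of_nonneg {B : Matrix A A ℝ} (hB : ∀ i j, 0 < B i j) {x : A → ℝ}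
    (hx : ∀ i, 0 ≤ x i) (hx0 : x ≠ 0) (i : A) : 0 < (B *ᵥ x) i := by
  obtain ⟨j, hj⟩ := Function.ne_iff.1 hx0
  exact Finset.sum_pos' (fun k _ => mul_nonneg (hB i k).le (hx k))
    ⟨j, Finset.mem_univ _, mul_pos (hB i j) (lt_of_le_of_ne (hx j) (Ne.symm hj))⟩

theorem Matrix.pow_mulVec_of_eigenvector {R : Type*} [CommRing R] {B : Matrix A A R} {x : A → R}
    {r : R} (h : B *ᵥ x = r • x) (k : ℕ) : (B ^ k) *ᵥ x = r ^ k • x := by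
  induction k with
  | zero => simp
  | succ k ih => rw [pow_succ, ← Matrix.mulVec_mulVec, h, Matrix.mulVec_smul, ih, smul_smul, pow_succ']

/-- A primitive matrix has a positive eigenvector. -/
theorem Matrix.IsPrimitive.exists_pos_eigenvector [Nonempty A] {B : Matrix A A ℝ}
    (hB : B.IsPrimitive) : ∃ r : ℝ, 0 < r ∧ ∃ x : A → ℝ, (∀ i, 0 < x i) ∧ B *ᵥ x = r • x := by
  obtain ⟨k, hk0, hk⟩ := hB.exists_pos_pow
  set R := ∑ i, ∑ j, B i j with hR
  have hcont : Continuous fun x : A → ℝ => B *ᵥ x := B.mulVecLin.continuous_of_finiteDimensional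
  -- The Collatz–Wielandt principle: maximize `r` among the pairs with r x ≤ B x. Where this is not
  -- an equality, `B ^ k` makes all the inequalities strict and `r` could be increased.
  let K : Set (ℝ × (A → ℝ)) := (Set.Icc 0 R ×ˢ stdSimplex ℝ A) ∩
    {p | ∀ i, p.1 * p.2 i ≤ (B *ᵥ p.2) i}
  have hK : IsCompact K := by
    refine (isCompact_Icc.prod (isCompact_stdSimplex _ A)).inter_right ?_
    simp only [Set.ofPred_forall]
    refine isClosed_iInter fun i => isClosed_le (by fun_prop) ?_
    exact (continuous_apply i).comp (hcont.comp continuous_snd)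
  have hle : ∀ r (x : A → ℝ), x ∈ stdSimplex ℝ A → (∀ i, r * x i ≤ (B *ᵥ x) i) → r ≤ R := by
    intro r x hx hrx
    calc r = ∑ i, r * x i := by rw [← Finset.mul_sum, hx.2, mul_one]
      _ ≤ ∑ i, (B *ᵥ x) i := Finset.sum_le_sum fun i _ => hrx i
      _ ≤ R := Finset.sum_le_sum fun i _ => Finset.sum_le_sum fun j _ =>
        mul_le_of_le_one_right (hB.nonneg i j)
          (hx.2 ▸ Finset.single_le_sum (fun l _ => hx.1 l) (Finset.mem_univ j))
  have hne : K.Nonempty := by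
    obtain ⟨a⟩ := ‹Nonempty A›
    refine ⟨(0, Pi.single a 1), ⟨⟨le_rfl, ?_⟩, single_mem_stdSimplex ℝ a⟩, fun i => ?_⟩
    · exact Finset.sum_nonneg fun i _ => Finset.sum_nonneg fun j _ => hB.nonneg i j
    · simpa using hB.nonneg i a
  obtain ⟨⟨r, x⟩, ⟨⟨hr, hx⟩, hrx⟩, hmax⟩ := hK.exists_isMaxOn hne continuous_fst.continuousOn
  have hr0 : 0 ≤ r := hr.1
  have hx0 : x ≠ 0 := by
    rintro rfl
    simpa using hx.2
  have hy : ∀ i, 0 < ((B ^ k) *ᵥ x) i := Matrix.mulVec_pos_of_nonneg hk hx.1 hx0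
  have heq : B *ᵥ x = r • x := by
    by_contra hne'
    have hd : ∀ i, 0 < ((B ^ k) *ᵥ (B *ᵥ x - r • x)) i :=
      Matrix.mulVec_pos_of_nonneg hk (fun i => by simpa using hrx i) (sub_ne_zero.2 hne')
    set y := (B ^ k) *ᵥ x with hydef
    have hd' : ∀ i, r * y i < (B *ᵥ y) i := fun i => by
      have := hd i
      rw [Matrix.mulVec_sub, Matrix.mulVec_mulVec, ← pow_succ, pow_succ', ← Matrix.mulVec_mulVec,
        Matrix.mulVec_smul] at this
      simpa [hydef] using this
    set r' := Finset.univ.inf' Finset.univ_nonempty fun i => (B *ᵥ y) i / y i with hr'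
    have hrr' : r < r' := (Finset.lt_inf'_iff _).2 fun i _ => (lt_div_iff₀ (hy i)).2 (hd' i)
    have hr'y : ∀ i, r' * y i ≤ (B *ᵥ y) i := fun i =>
      (le_div_iff₀ (hy i)).1 (Finset.inf'_le _ (Finset.mem_univ i))
    set s := ∑ i, y i with hs
    have hs0 : 0 < s := Finset.sum_pos (fun i _ => hy i) Finset.univ_nonempty
    have hmem : s⁻¹ • y ∈ stdSimplex ℝ A := by
      refine ⟨fun i => mul_nonneg (inv_nonneg.2 hs0.le) (hy i).le, ?_⟩
      simp only [Pi.smul_apply, smul_eq_mul, ← Finset.mul_sum]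
      exact inv_mul_cancel₀ hs0.ne'
    have hineq : ∀ i, r' * (s⁻¹ • y) i ≤ (B *ᵥ (s⁻¹ • y)) i := fun i => by
      rw [Matrix.mulVec_smul]
      simp only [Pi.smul_apply, smul_eq_mul]
      rw [mul_left_comm]
      exact mul_le_mul_of_nonneg_left (hr'y i) (inv_nonneg.2 hs0.le)
    have : (r', s⁻¹ • y) ∈ K :=
      ⟨⟨⟨hr0.trans hrr'.le, hle _ _ hmem hineq⟩, hmem⟩, hineq⟩
    exact absurd (hmax this) (not_le.2 hrr')
  rw [Matrix.pow_mulVec_of_eigenvector heq] at hy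
  have hpos : ∀ i, 0 < x i := fun i => lt_of_le_of_ne (hx.1 i) fun h => by
    have := hy i
    simp [← h] at this
  refine ⟨r, lt_of_le_of_ne hr0 ?_, x, hpos, heq⟩
  rintro rfl
  obtain ⟨a⟩ := ‹Nonempty A›
  have := hy a
  simp [zero_pow hk0.ne'] at this

/-- For an eigenvector `w`, |z||w| ≤ B|w| entrywise; pair this with the positive left eigenvector
`y`. -/
theorem Matrix.norm_root_charpoly_le {B : Matrix A A ℝ} (hB : ∀ i j, 0 ≤ B i j) {r : ℝ} {y : A → ℝ}
    (hy : ∀ i, 0 < y i) (hry : Bᵀ *ᵥ y = r • y) {z : ℂ}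
    (hz : Polynomial.aeval z B.charpoly = 0) : ‖z‖ ≤ r := by
  have h1 : ((B.map (algebraMap ℝ ℂ)).charpoly).eval z = 0 := by
    rw [Matrix.charpoly_map, Polynomial.eval_map_algebraMap, hz]
  rw [Matrix.eval_charpoly] at h1
  obtain ⟨w, hw0, hw⟩ := Matrix.exists_mulVec_eq_zero_iff.2 h1
  have h2 : ∀ i, z * w i = ∑ j, (B i j : ℂ) * w j := fun i => by
    have := congrFun hw i
    rw [Matrix.sub_mulVec] at this
    simpa [Matrix.mulVec, dotProduct, sub_eq_zero, Matrix.diagonal_apply, Matrix.scalar_apply]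
      using this
  have h3 : ∀ i, ‖z‖ * ‖w i‖ ≤ ∑ j, B i j * ‖w j‖ := fun i => by
    rw [← norm_mul, h2]
    refine (norm_sum_le _ _).trans_eq (Finset.sum_congr rfl fun j _ => ?_)
    rw [norm_mul, Complex.norm_real, Real.norm_of_nonneg (hB i j)]
  have h4 : ‖z‖ * ∑ i, y i * ‖w i‖ ≤ r * ∑ i, y i * ‖w i‖ := by
    calc ‖z‖ * ∑ i, y i * ‖w i‖ = ∑ i, y i * (‖z‖ * ‖w i‖) := by
          rw [Finset.mul_sum]; exact Finset.sum_congr rfl fun i _ => by ring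
      _ ≤ ∑ i, y i * ∑ j, B i j * ‖w j‖ :=
          Finset.sum_le_sum fun i _ => mul_le_mul_of_nonneg_left (h3 i) (hy i).le
      _ = ∑ j, (Bᵀ *ᵥ y) j * ‖w j‖ := by
          simp only [Finset.mul_sum, Matrix.mulVec, dotProduct, Matrix.transpose_apply,
            Finset.sum_mul]
          rw [Finset.sum_comm]
          exact Finset.sum_congr rfl fun i _ => Finset.sum_congr rfl fun j _ => by ring
      _ = r * ∑ i, y i * ‖w i‖ := by
          rw [hry, Finset.mul_sum]
          exact Finset.sum_congr rfl fun i _ => by simp; ring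
  refine le_of_mul_le_mul_right h4 ?_
  obtain ⟨j, hj⟩ := Function.ne_iff.1 hw0
  exact Finset.sum_pos' (fun i _ => mul_nonneg (hy i).le (norm_nonneg _))
    ⟨j, Finset.mem_univ _, mul_pos (hy j) (norm_pos_iff.2 hj)⟩

/-- The eigenvalue of a positive eigenvector of a primitive matrix is a simple root. -/
theorem Matrix.IsPrimitive.rootMultiplicity_le_one {B : Matrix A A ℝ} (hB : B.IsPrimitive)
    [Nonempty A] {r : ℝ} {x y : A → ℝ} (hx : ∀ i, 0 < x i) (hrx : B *ᵥ x = r • x)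
    (hy : ∀ i, 0 < y i) (hry : Bᵀ *ᵥ y = r • y) : B.charpoly.rootMultiplicity r ≤ 1 := by
  obtain ⟨k, hk0, hk⟩ := hB.exists_pos_pow
  -- Subtracting the least ratio times `x` leaves a nonnegative eigenvector with a zero entry, which
  -- `B ^ k` would make positive unless the vector is zero.
  have hsimple : ∀ v : A → ℝ, B *ᵥ v = r • v → ∃ c : ℝ, c • x = v := fun v hv => by
    obtain ⟨i, -, hi⟩ := Finset.exists_min_image Finset.univ (fun i => v i / x i)
      Finset.univ_nonempty
    refine ⟨v i / x i, ?_⟩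
    by_contra hne
    have h1 : ∀ j, 0 ≤ (v - (v i / x i) • x) j := fun j => by
      have := (le_div_iff₀ (hx j)).1 (hi j (Finset.mem_univ j))
      simpa using this
    have h2 := Matrix.mulVec_pos_of_nonneg hk h1 (sub_ne_zero.2 (Ne.symm hne)) i
    rw [Matrix.pow_mulVec_of_eigenvector (r := r)] at h2
    · simp [div_mul_cancel₀ _ (hx i).ne'] at h2
    · rw [Matrix.mulVec_sub, Matrix.mulVec_smul, hv, hrx, smul_sub, smul_comm]
  have hgen : ∀ m : ℕ, ∀ v : A → ℝ, ((B.mulVecLin - algebraMap ℝ (Module.End ℝ (A → ℝ)) r) ^ m) v = 0 →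
      ∃ c : ℝ, c • x = v := by
    intro m
    induction m with
    | zero => exact fun v hv => ⟨0, by simpa [eq_comm] using hv⟩
    | succ m ih =>
      intro v hv
      rw [pow_succ, Module.End.mul_apply] at hv
      obtain ⟨c, hc⟩ := ih _ hv
      -- The left eigenvector kills the range of B - r but not `x`, so there is no Jordan block.
      have h1 : y ⬝ᵥ (c • x) = 0 := by
        rw [hc]
        simp only [LinearMap.sub_apply, Matrix.mulVecLin_apply, Module.algebraMap_end_apply]
        rw [dotProduct_sub, Matrix.dotProduct_mulVec, ← Matrix.mulVec_transpose, hry,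
          smul_dotProduct, dotProduct_smul, sub_self]
      have h2 : 0 < y ⬝ᵥ x := Finset.sum_pos (fun i _ => mul_pos (hy i) (hx i)) Finset.univ_nonempty
      rw [dotProduct_smul, smul_eq_mul, mul_eq_zero, or_iff_left h2.ne'] at h1
      rw [h1, zero_smul] at hc
      refine hsimple v ?_
      simpa [sub_eq_zero, eq_comm, Module.algebraMap_end_apply] using hc
  rw [← Matrix.charpoly_mulVecLin, ← LinearMap.finrank_maxGenEigenspace_eq]
  refine finrank_le_one (⟨x, ?_⟩ : Module.End.maxGenEigenspace B.mulVecLin r) ?_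
  · rw [Module.End.mem_maxGenEigenspace]
    refine ⟨1, ?_⟩
    simp [hrx]
  · rintro ⟨v, hv⟩
    rw [Module.End.mem_maxGenEigenspace] at hv
    obtain ⟨m, hm⟩ := hv
    obtain ⟨c, hc⟩ := hgen m v (by rwa [Algebra.algebraMap_eq_smul_one])
    exact ⟨c, Subtype.ext hc⟩

end PerronFrobenius

/-! ### Characteristic polynomials -/

section Charpoly

/-- The cofactor is the characteristic polynomial on the quotient: at each `t` the determinant of t
- f is a product over the subspace and the quotient. -/
theorem LinearMap.charpoly_restrict_dvd {V : Type*} [AddCommGroup V] [Module ℝ V]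
    [FiniteDimensional ℝ V] (f : V →ₗ[ℝ] V) (W : Submodule ℝ V) (hf : ∀ x ∈ W, f x ∈ W) :
    (f.restrict hf).charpoly ∣ f.charpoly := by
  have hf' : W ≤ W.comap f := hf
  refine ⟨(W.mapQ W f hf').charpoly, Polynomial.funext fun t => ?_⟩
  rw [Polynomial.eval_mul, LinearMap.eval_charpoly, LinearMap.eval_charpoly, LinearMap.eval_charpoly]
  have hg : W ≤ W.comap (algebraMap ℝ (Module.End ℝ V) t - f) := fun x hx =>
    W.sub_mem (W.smul_mem t hx) (hf x hx)
  rw [LinearMap.det_eq_det_mul_det W _ hg]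
  congr 2
  ext x
  simp [Module.algebraMap_end_apply]

theorem Polynomial.norm_eval_zero_eq_prod_roots {p : Polynomial ℂ} (hp : p.Monic) :
    ‖p.eval 0‖ = (p.roots.map fun z => ‖z‖).prod := by
  conv_lhs => rw [(IsAlgClosed.splits p).eq_prod_roots_of_monic hp]
  rw [Polynomial.eval_multiset_prod, Multiset.map_map]
  refine (map_multiset_prod (normHom : ℂ →*₀ ℝ) _).trans ?_
  simp [Multiset.map_map]

end Charpoly

/-! ### Decaying orbits of a linear map -/

section Decay

variable {V : Type*} [NormedAddCommGroup V] [NormedSpace ℝ V] [FiniteDimensional ℝ V]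

/-- The iterates of a linear map that tend to `0` are summable. -/
theorem Module.End.summable_norm_of_tendsto (T : Module.End ℝ V) {v : V}
    (hv : Tendsto (fun k : ℕ => (T ^ k) v) atTop (𝓝 0)) : Summable fun k : ℕ => ‖(T ^ k) v‖ := by
  -- In finite dimension, decay of the iterates at each vector of `W` is decay of their norms on
  -- `W`, so some power halves all norms there.
  let W : Submodule ℝ V :=
    { carrier := {v | Tendsto (fun k : ℕ => (T ^ k) v) atTop (𝓝 0)}
      zero_mem' := by simp
      add_mem' := fun {a b} ha hb => by
        have := Tendsto.add ha hb
        simpa using this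
      smul_mem' := fun c a ha => by
        have := Tendsto.const_smul ha c
        simpa using this }
  let b := Module.finBasis ℝ W
  let e : W →L[ℝ] (Fin (Module.finrank ℝ W) → ℝ) :=
    (b.equivFun : W →ₗ[ℝ] _).toContinuousLinearMap
  have hbound : ∀ (k : ℕ) (w : W), ‖(T ^ k) w‖ ≤ (‖e‖ * ∑ i, ‖(T ^ k) (b i)‖) * ‖w‖ := by
    intro k w
    have h1 : (w : V) = ∑ i, e w i • (b i : V) := by
      have := congrArg Subtype.val (b.sum_equivFun w)
      rw [Submodule.coe_sum] at this
      exact this.symm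
    calc ‖(T ^ k) w‖ = ‖∑ i, e w i • (T ^ k) (b i)‖ := by rw [h1, map_sum]; simp
      _ ≤ ∑ i, ‖e w i • (T ^ k) (b i)‖ := norm_sum_le _ _
      _ ≤ ∑ i, (‖e‖ * ‖w‖) * ‖(T ^ k) (b i)‖ := Finset.sum_le_sum fun i _ => by
          rw [norm_smul]
          exact mul_le_mul_of_nonneg_right ((norm_le_pi_norm (e w) i).trans (e.le_opNorm w))
            (norm_nonneg _)
      _ = _ := by rw [← Finset.mul_sum]; ring
  have hlim : Tendsto (fun k : ℕ => ‖e‖ * ∑ i, ‖(T ^ k) (b i)‖) atTop (𝓝 0) := by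
    have : Tendsto (fun k : ℕ => ‖e‖ * ∑ i, ‖(T ^ k) (b i : V)‖) atTop
        (𝓝 (‖e‖ * ∑ i : Fin (Module.finrank ℝ W), ‖(0 : V)‖)) :=
      (tendsto_finsetSum _ fun i _ => ((b i).2 : Tendsto _ _ _).norm).const_mul _
    simpa using this
  obtain ⟨k, hk⟩ := (hlim.eventually (ge_mem_nhds (show (0 : ℝ) < 1 / 2 by norm_num))).exists
  have hmem : ∀ m : ℕ, (T ^ m) v ∈ W := fun m => by
    change Tendsto (fun k : ℕ => (T ^ k) ((T ^ m) v)) atTop (𝓝 0)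
    simp only [← Module.End.mul_apply, ← pow_add]
    exact hv.comp (tendsto_add_atTop_nat m)
  have hhalf : ∀ m : ℕ, ‖(T ^ (k + m)) v‖ ≤ 1 / 2 * ‖(T ^ m) v‖ := fun m => by
    have := hbound k ⟨_, hmem m⟩
    rw [pow_add, Module.End.mul_apply]
    exact this.trans (mul_le_mul_of_nonneg_right hk (norm_nonneg _))
  -- The partial sums satisfy s_n ≤ s_{k+n} ≤ s_k + s_n / 2.
  refine summable_of_sum_range_le (c := 2 * ∑ m ∈ Finset.range k, ‖(T ^ m) v‖)
    (fun _ => norm_nonneg _) fun n => ?_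
  have h1 : ∑ m ∈ Finset.range n, ‖(T ^ m) v‖ ≤ ∑ m ∈ Finset.range (k + n), ‖(T ^ m) v‖ :=
    Finset.sum_le_sum_of_subset_of_nonneg (by simp) fun _ _ _ => norm_nonneg _
  have h2 : ∑ m ∈ Finset.range n, ‖(T ^ (k + m)) v‖ ≤
      1 / 2 * ∑ m ∈ Finset.range n, ‖(T ^ m) v‖ := by
    rw [Finset.mul_sum]
    exact Finset.sum_le_sum fun m _ => hhalf m
  rw [Finset.sum_range_add] at h1
  linarith

end Decay

namespace Subst

/-! ### The transposed incidence matrix and its integral structure -/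

section Linear

variable {A : Type*} [Fintype A] [DecidableEq A] {ξ : A → List A}

theorem sum_map_eq_sum_count (w : List A) (f : A → ℝ) :
    (w.map f).sum = ∑ a, (w.count a : ℝ) * f a := by
  induction w with
  | nil => simp
  | cons b w ih =>
    simp [List.count_cons, ih, add_mul, Finset.sum_add_distrib, add_comm]

theorem transposeMap_apply (v : A → ℝ) (b : A) : transposeMap ξ v b = ((ξ b).map v).sum := by
  rw [sum_map_eq_sum_count]
  rfl

theorem sum_map_flatMap (f : A → List A) (w : List A) (v : A → ℝ) :
    ((w.flatMap f).map v).sum = (w.map fun a => ((f a).map v).sum).sum := by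
  induction w with
  | nil => simp
  | cons a w ih => simp [ih]

theorem transposeMap_pow_apply (n : ℕ) (v : A → ℝ) (b : A) :
    (transposeMap ξ ^ n) v b = ((iter ξ n b).map v).sum := by
  induction n generalizing v b with
  | zero => simp [iter]
  | succ n ih =>
    rw [pow_succ, Module.End.mul_apply, ih, iter, sum_map_flatMap]
    exact congrArg List.sum (List.map_congr_left fun a _ => transposeMap_apply v a)

theorem transposeMap_pow_const (n : ℕ) (c : ℝ) (b : A) :
    (transposeMap ξ ^ n) (fun _ => c) b = (iter ξ n b).length * c := by
  rw [transposeMap_pow_apply]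
  simp

theorem mem_iter_of_pow_pos {n : ℕ} {a b : A} (h : 0 < (incidence ξ ^ n) a b) : a ∈ iter ξ n b := by
  by_contra hab
  have h1 : (transposeMap ξ ^ n) (Pi.single a 1) b = (incidence ξ ^ n) a b := by
    have : transposeMap ξ ^ n = ((incidence ξ)ᵀ ^ n).mulVecLin := by
      rw [transposeMap, ← Matrix.toLin'_apply', ← Matrix.toLin'_apply', Matrix.toLin'_pow]
    rw [this, ← Matrix.transpose_pow, Matrix.mulVecLin_apply, Matrix.mulVec_single_one]
    rfl
  rw [transposeMap_pow_apply, List.sum_eq_zero] at h1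
  · exact h.ne h1
  · intro x hx
    obtain ⟨c, hc, rfl⟩ := List.mem_map.1 hx
    rw [Pi.single_eq_of_ne]
    rintro rfl
    exact hab hc

theorem isRegular_of_primitive (hs : IsSubstitution ξ) (hp : (incidence ξ).IsPrimitive)
    (hpr : IsProper ξ) : IsRegular ξ where
  ne_nil b hb := by
    obtain ⟨a, ha⟩ := hpr.1
    simpa [hb] using ha b
  growing := hs.2
  mixing := by
    obtain ⟨k, -, hk⟩ := hp.exists_pos_pow
    exact ⟨k, fun a b => mem_iter_of_pow_pos (hk a b)⟩
  proper := hpr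

theorem _root_.Matrix.IsPrimitive.transpose {B : Matrix A A ℝ} (h : B.IsPrimitive) :
    Bᵀ.IsPrimitive := by
  obtain ⟨k, hk0, hk⟩ := h.exists_pos_pow
  exact ⟨fun i j => h.nonneg j i, k, hk0, fun i j => by
    rw [← Matrix.transpose_pow]; exact hk j i⟩

/-- The Perron number and its positive eigenvectors. -/
theorem exists_perron [Nonempty A] (hp : (incidence ξ).IsPrimitive)
    (hu : ∃! z : ℂ, z ∈ charRoots ξ ∧ 1 < ‖z‖) :
    ∃ β : ℝ, 1 < β ∧ IsPerronNumber ξ β ∧ (∀ z ∈ charRoots ξ, z = β ∨ ‖z‖ ≤ 1) ∧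
      (incidence ξ).charpoly.rootMultiplicity β ≤ 1 ∧
      ∃ l : A → ℝ, (∀ a, 0 < l a) ∧ transposeMap ξ l = β • l := by
  obtain ⟨r, hr0, x, hx, hrx⟩ := hp.exists_pos_eigenvector
  obtain ⟨s, -, y, hy, hsy⟩ := hp.transpose.exists_pos_eigenvector
  have hrs : s = r := by
    have h1 : y ⬝ᵥ (incidence ξ *ᵥ x) = ((incidence ξ)ᵀ *ᵥ y) ⬝ᵥ x := by
      rw [Matrix.dotProduct_mulVec, Matrix.mulVec_transpose]
    rw [hrx, hsy, dotProduct_smul, smul_dotProduct] at h1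
    have h2 : 0 < y ⬝ᵥ x := Finset.sum_pos (fun i _ => mul_pos (hy i) (hx i)) Finset.univ_nonempty
    exact (mul_right_cancel₀ h2.ne' h1).symm
  subst hrs
  have hbound : ∀ z ∈ charRoots ξ, ‖z‖ ≤ s := fun z hz =>
    Matrix.norm_root_charpoly_le hp.nonneg hy hsy hz
  obtain ⟨z₀, ⟨hz₀, hz₀1⟩, huniq⟩ := hu
  have hs1 : 1 < s := hz₀1.trans_le (hbound _ hz₀)
  have hsroot : (s : ℂ) ∈ charRoots ξ := by
    have h1 : (incidence ξ).charpoly.eval s = 0 := by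
      rw [Matrix.eval_charpoly, ← Matrix.exists_mulVec_eq_zero_iff]
      refine ⟨x, fun h => (hx (Classical.arbitrary A)).ne' (congrFun h _), ?_⟩
      rw [Matrix.sub_mulVec, hrx, sub_eq_zero]
      ext i
      simp [Matrix.mulVec_diagonal]
    change Polynomial.aeval (algebraMap ℝ ℂ s) _ = 0
    rw [Polynomial.aeval_algebraMap_apply, Polynomial.coe_aeval_eq_eval, h1, map_zero]
  have hs₀ : (s : ℂ) = z₀ := huniq _ ⟨hsroot, by simpa [abs_of_pos hr0] using hs1⟩
  have halt : ∀ z ∈ charRoots ξ, z = s ∨ ‖z‖ ≤ 1 := fun z hz => by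
    by_cases h : 1 < ‖z‖
    · exact .inl ((huniq z ⟨hz, h⟩).trans hs₀.symm)
    · exact .inr (not_lt.1 h)
  exact ⟨s, hs1, ⟨hr0, hsroot, fun z hz hne => ((halt z hz).resolve_left hne).trans_lt hs1⟩, halt,
    hp.rootMultiplicity_le_one hx hrx hy hsy, y, hy, hsy⟩

/-- The incidence matrix over the integers. -/
def intIncidence (ξ : A → List A) : Matrix A A ℤ := Matrix.of fun i j => ((ξ j).count i : ℤ)

theorem intIncidence_map : (intIncidence ξ).map (Int.castRingHom ℝ) = incidence ξ := by
  ext i j; simp [intIncidence, incidence]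

/-- Applied below to the nonzero eigenvalues outside E^s: only β can contribute a factor above `1`,
and at most once. -/
theorem _root_.Multiset.prod_norm_le_of_count_le_one {s : Multiset ℂ} {β : ℝ} (hβ : 1 ≤ β)
    (hs : ∀ z ∈ s, z = β ∨ ‖z‖ ≤ 1) (hc : s.count (β : ℂ) ≤ 1) :
    (s.map fun z => ‖z‖).prod ≤ β := by
  have hle : ∀ s : Multiset ℂ, (∀ z ∈ s, ‖z‖ ≤ 1) → (s.map fun z => ‖z‖).prod ≤ 1 := by
    intro s
    induction s using Multiset.induction_on with
    | empty => simp
    | cons a s ih =>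
      intro h
      rw [Multiset.map_cons, Multiset.prod_cons]
      exact mul_le_one₀ (h a (by simp))
        (Multiset.prod_nonneg fun x hx => by
          obtain ⟨z, -, rfl⟩ := Multiset.mem_map.1 hx
          exact norm_nonneg z) (ih fun z hz => h z (by simp [hz]))
  by_cases hβs : (β : ℂ) ∈ s
  · obtain ⟨t, rfl⟩ := Multiset.exists_cons_of_mem hβs
    have hβt : (β : ℂ) ∉ t := by
      rw [Multiset.count_cons_self] at hc
      exact Multiset.count_eq_zero.1 (by omega)
    rw [Multiset.map_cons, Multiset.prod_cons, Complex.norm_real,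
      Real.norm_of_nonneg (zero_le_one.trans hβ)]
    refine mul_le_of_le_one_right (zero_le_one.trans hβ) (hle t fun z hz => ?_)
    refine (hs z (by simp [hz])).resolve_left ?_
    rintro rfl
    exact hβt hz
  · refine (hle s fun z hz => (hs z hz).resolve_left ?_).trans hβ
    rintro rfl
    exact hβs hz

/-- The product of the nonzero eigenvalues is `±1`. -/
theorem exists_charpoly_factor [Nonempty A] (hp : (incidence ξ).IsPrimitive)
    (hu : ∃! z : ℂ, z ∈ charRoots ξ ∧ 1 < ‖z‖)
    (hd : ∀ β, IsPerronNumber ξ β →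
      β * |LinearMap.det ((transposeMap ξ).restrict (stable_invariant ξ))| = 1) :
    ∃ (k : ℕ) (q : Polynomial ℤ), (intIncidence ξ).charpoly = Polynomial.X ^ k * q ∧
      (q.eval 0) * (q.eval 0) = 1 := by
  obtain ⟨β, hβ1, hβ, halt, hmult, -⟩ := exists_perron hp hu
  have hdet := hd β hβ
  have hmonic := (intIncidence ξ).charpoly_monic
  obtain ⟨q, hq, hndvd⟩ :=
    (intIncidence ξ).charpoly.exists_eq_pow_rootMultiplicity_mul_and_not_dvd hmonic.ne_zero 0
  rw [Polynomial.C_0, sub_zero] at hq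
  set k := (intIncidence ξ).charpoly.rootMultiplicity 0 with hk
  rw [Polynomial.dvd_iff_isRoot, Polynomial.IsRoot.def] at hndvd
  refine ⟨k, q, hq, ?_⟩
  have hqm : q.Monic := (Polynomial.monic_X_pow k).of_mul_monic_left (hq ▸ hmonic)
  set T := transposeMap ξ with hT
  set S := T.restrict (stable_invariant ξ) with hS
  have hTc : T.charpoly = (incidence ξ).charpoly := by
    rw [hT, transposeMap, Matrix.charpoly_mulVecLin, Matrix.charpoly_transpose]
  have hpR : (incidence ξ).charpoly = (intIncidence ξ).charpoly.map (Int.castRingHom ℝ) := by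
    rw [← Matrix.charpoly_map, intIncidence_map]
  set pC := (incidence ξ).charpoly.map (algebraMap ℝ ℂ) with hpC
  set qC := q.map (Int.castRingHom ℂ) with hqC
  have hpC' : pC = Polynomial.X ^ k * qC := by
    rw [hpC, hpR, Polynomial.map_map, RingHom.ext_int ((algebraMap ℝ ℂ).comp (Int.castRingHom ℝ))
      (Int.castRingHom ℂ), hq, Polynomial.map_mul, Polynomial.map_pow, Polynomial.map_X]
  have hqCm : qC.Monic := hqm.map _
  have hpCm : pC.Monic := ((incidence ξ).charpoly_monic).map _
  set sC := S.charpoly.map (algebraMap ℝ ℂ) with hsC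
  have hsCm : sC.Monic := S.charpoly_monic.map _
  have hdvd : sC ∣ pC := by
    rw [hsC, hpC, ← hTc]
    exact Polynomial.map_dvd _ (T.charpoly_restrict_dvd _ (stable_invariant ξ))
  have hsnorm : ‖sC.eval 0‖ = |LinearMap.det S| := by
    rw [hsC, Polynomial.eval_zero_map, LinearMap.det_eq_sign_charpoly_coeff,
      Polynomial.coeff_zero_eq_eval_zero]
    simp [abs_mul]
  have hs0 : (0 : ℂ) ∉ sC.roots := by
    rw [Polynomial.mem_roots hsCm.ne_zero, Polynomial.IsRoot.def, ← norm_eq_zero, hsnorm]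
    intro h0
    rw [h0, mul_zero] at hdet
    exact zero_ne_one hdet
  have hroots : pC.roots = k • {0} + qC.roots := by
    rw [hpC', Polynomial.roots_mul (hpC' ▸ hpCm.ne_zero), Polynomial.roots_pow, Polynomial.roots_X]
  -- The determinant on E^s is nonzero, so removing the factor `X ^ k` loses none of the eigenvalues
  -- on E^s.
  have hle : sC.roots ≤ qC.roots := by
    have h1 := Polynomial.roots.le_of_dvd hpCm.ne_zero hdvd
    rw [hroots] at h1
    rw [Multiset.le_iff_count] at h1 ⊢
    intro z
    by_cases hz : z = 0
    · rw [hz, Multiset.count_eq_zero.2 hs0]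
      exact Nat.zero_le _
    · have := h1 z
      rwa [Multiset.count_add, Multiset.count_nsmul, Multiset.count_singleton, if_neg hz, mul_zero,
        zero_add] at this
  obtain ⟨t, ht⟩ := Multiset.le_iff_exists_add.1 hle
  have htle : (t.map fun z => ‖z‖).prod ≤ β := by
    have htq : t ≤ qC.roots := ht ▸ Multiset.le_add_left _ _
    have htp : t ≤ pC.roots := htq.trans (hroots ▸ Multiset.le_add_left _ _)
    refine Multiset.prod_norm_le_of_count_le_one hβ1.le (fun z hz => halt z ?_) ?_
    · have := Multiset.mem_of_le htp hz
      rw [Polynomial.mem_roots hpCm.ne_zero, Polynomial.IsRoot.def, Polynomial.eval_map_algebraMap]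
        at this
      exact this
    · refine (Multiset.count_le_of_le _ htp).trans ?_
      rw [Polynomial.count_roots]
      refine le_of_eq_of_le ?_ hmult
      exact (Polynomial.eq_rootMultiplicity_map (algebraMap ℝ ℂ).injective β).symm
  -- |q(0)| is |det| on E^s times a product at most β, and (iii) bounds this by `1`. As q(0) is a
  -- nonzero integer, it is ±1.
  have hprod : ‖qC.eval 0‖ ≤ 1 := by
    rw [Polynomial.norm_eval_zero_eq_prod_roots hqCm, ht, Multiset.map_add, Multiset.prod_add,
      ← Polynomial.norm_eval_zero_eq_prod_roots hsCm, hsnorm, ← hdet, mul_comm]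
    exact mul_le_mul_of_nonneg_right htle (abs_nonneg _)
  have habs : |q.eval 0| ≤ 1 := by
    rw [hqC, Polynomial.eval_zero_map] at hprod
    simp only [eq_intCast, Complex.norm_intCast] at hprod
    exact_mod_cast hprod
  have h3 := abs_pos.2 hndvd
  have h4 : |q.eval 0| = 1 := by omega
  rw [← abs_mul_abs_self, h4, one_mul]

/-- On the image of a power, the transposed incidence matrix is invertible over the integers. -/
theorem exists_pow_eq_pow_mul [Nonempty A] (hp : (incidence ξ).IsPrimitive)
    (hu : ∃! z : ℂ, z ∈ charRoots ξ ∧ 1 < ‖z‖)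
    (hd : ∀ β, IsPerronNumber ξ β →
      β * |LinearMap.det ((transposeMap ξ).restrict (stable_invariant ξ))| = 1) :
    ∃ (k : ℕ) (R : Matrix A A ℤ), ∀ m : ℕ,
      (intIncidence ξ)ᵀ ^ k = (intIncidence ξ)ᵀ ^ (k + m) * R ^ m := by
  obtain ⟨k, q, hq, hq1⟩ := exists_charpoly_factor hp hu hd
  set N := (intIncidence ξ)ᵀ with hN
  have hCH := Matrix.aeval_self_charpoly N
  rw [hN, Matrix.charpoly_transpose, hq, ← hN, map_mul, map_pow, Polynomial.aeval_X,
    ← Polynomial.X_mul_divX_add q, map_add, map_mul, Polynomial.aeval_X, Polynomial.aeval_C,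
    Polynomial.coeff_zero_eq_eval_zero] at hCH
  set c := q.eval 0 with hc
  set r := Polynomial.aeval N q.divX with hr
  -- Cayley–Hamilton reads Nᵏ(N r + c) = 0, where `c` is its own inverse.
  have h1 : N ^ k = N ^ (k + 1) * (-c • r) := by
    have h2 : N ^ k * (N * r) = -(c • N ^ k) := by
      rw [mul_add, Algebra.algebraMap_eq_smul_one, mul_smul_comm, mul_one] at hCH
      exact eq_neg_of_add_eq_zero_left hCH
    rw [mul_smul_comm, pow_succ, mul_assoc, h2, smul_neg, neg_smul, neg_neg, smul_smul, hq1,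
      one_smul]
  refine ⟨k, -c • r, fun m => ?_⟩
  induction m with
  | zero => simp
  | succ m ih =>
    calc N ^ k = N ^ (k + m) * (-c • r) ^ m := ih
      _ = N ^ m * N ^ k * (-c • r) ^ m := by rw [← pow_add, add_comm]
      _ = N ^ m * (N ^ (k + 1) * (-c • r)) * (-c • r) ^ m := by rw [← h1]
      _ = N ^ (k + (m + 1)) * (-c • r) ^ (m + 1) := by
        rw [← mul_assoc, ← pow_add, mul_assoc, ← pow_succ']
        congr 2; omega

theorem transposeMap_intCast (z : A → ℤ) :
    transposeMap ξ (fun a => (z a : ℝ)) = fun a => (((intIncidence ξ)ᵀ *ᵥ z) a : ℝ) := by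
  ext b
  rw [transposeMap_apply, sum_map_eq_sum_count]
  simp [Matrix.mulVec, dotProduct, intIncidence]

theorem transposeMap_pow_intCast (n : ℕ) (z : A → ℤ) :
    (transposeMap ξ ^ n) (fun a => (z a : ℝ)) = fun a => ((((intIncidence ξ)ᵀ ^ n) *ᵥ z) a : ℝ) := by
  induction n with
  | zero => simp
  | succ n ih =>
    rw [pow_succ', Module.End.mul_apply, ih, transposeMap_intCast, Matrix.mulVec_mulVec, pow_succ']

/-- A vector whose iterates approach the integer vectors is, up to an integer vector, one whose
iterates tend to `0`. -/
theorem exists_intVector [Nonempty A] (hp : (incidence ξ).IsPrimitive)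
    (hu : ∃! z : ℂ, z ∈ charRoots ξ ∧ 1 < ‖z‖)
    (hd : ∀ β, IsPerronNumber ξ β →
      β * |LinearMap.det ((transposeMap ξ).restrict (stable_invariant ξ))| = 1)
    {x : A → ℝ} {z : ℕ → A → ℤ}
    (hz : Tendsto (fun n : ℕ => (transposeMap ξ ^ n) x - fun a => (z n a : ℝ)) atTop (𝓝 0)) :
    ∃ w : A → ℤ, (fun a => (w a : ℝ)) ∈ eventualRange ξ ∧
      Tendsto (fun n : ℕ => (transposeMap ξ ^ n) (x - fun a => (w a : ℝ))) atTop (𝓝 0) := by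
  obtain ⟨k, R, hR⟩ := exists_pow_eq_pow_mul hp hu hd
  set T := transposeMap ξ with hT
  set N := (intIncidence ξ)ᵀ with hN
  -- The difference of the two sides is an integer vector that tends to `0`.
  have hstep : ∀ᶠ n in atTop, z (n + 1) = N *ᵥ z n := by
    have hcont : Continuous T := T.continuous_of_finiteDimensional
    have h1 : Tendsto (fun n : ℕ => T ((T ^ n) x - fun a => (z n a : ℝ)) -
        ((T ^ (n + 1)) x - fun a => (z (n + 1) a : ℝ))) atTop (𝓝 (T 0 - 0)) :=
      ((hcont.tendsto 0).comp hz).sub (hz.comp (tendsto_add_atTop_nat 1))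
    have h2 : ∀ n, T ((T ^ n) x - fun a => (z n a : ℝ)) -
        ((T ^ (n + 1)) x - fun a => (z (n + 1) a : ℝ)) =
        fun a => ((z (n + 1) a - (N *ᵥ z n) a : ℤ) : ℝ) := fun n => by
      rw [map_sub, hT, transposeMap_intCast, ← hN, pow_succ', Module.End.mul_apply]
      ext a
      simp
    simp only [h2, map_zero, sub_zero] at h1
    rw [tendsto_pi_nhds] at h1
    have h3 : ∀ a, ∀ᶠ n in atTop, z (n + 1) a = (N *ᵥ z n) a := fun a => by
      filter_upwards [(h1 a).eventually (Metric.ball_mem_nhds _ one_pos)] with n hn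
      rw [Pi.zero_apply, Real.dist_eq, sub_zero, ← Int.cast_abs] at hn
      have h5 : |z (n + 1) a - (N *ᵥ z n) a| < 1 := by exact_mod_cast hn
      have := abs_lt.1 h5
      omega
    filter_upwards [eventually_all.2 h3] with n hn
    exact funext hn
  obtain ⟨K, hK⟩ := eventually_atTop.1 hstep
  have hKj : ∀ j, z (K + j) = (N ^ j) *ᵥ z K := fun j => by
    induction j with
    | zero => simp
    | succ j ih => rw [← add_assoc, hK _ (by omega), ih, Matrix.mulVec_mulVec, pow_succ']
  -- `R` inverts `N` on the image of `N ^ k`. The vector is `z K` pulled back by `K` steps, with `k`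
  -- further factors that land in that image, so its orbit eventually coincides with `z`.
  refine ⟨(N ^ k * R ^ (K + k)) *ᵥ z K, ?_, ?_⟩
  · rw [eventualRange, Submodule.mem_iInf]
    intro m
    refine ⟨fun a => (((N ^ k * R ^ m * R ^ (K + k)) *ᵥ z K) a : ℝ), ?_⟩
    rw [transposeMap_pow_intCast, ← hN, Matrix.mulVec_mulVec, ← mul_assoc, ← mul_assoc, ← pow_add,
      add_comm m k, ← hR]
  · rw [← tendsto_add_atTop_iff_nat (K + k)]
    refine (hz.comp (tendsto_add_atTop_nat (K + k))).congr fun n => ?_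
    have h4 : n + (K + k) = K + (n + k) := by omega
    simp only [Function.comp_apply]
    have h5 : N ^ (n + (K + k)) * (N ^ k * R ^ (K + k)) = N ^ (n + k) := by
      rw [← mul_assoc, ← pow_add, show n + (K + k) + k = n + (k + (K + k)) by omega, pow_add,
        mul_assoc, ← hR, ← pow_add]
    rw [map_sub, transposeMap_pow_intCast, ← hN, Matrix.mulVec_mulVec, h5, h4, hKj]

/-- The stable component of a vector whose iterates tend to `0`. -/
theorem existsUnique_stable_part {v : A → ℝ}
    (hv : Tendsto (fun n : ℕ => (transposeMap ξ ^ n) v) atTop (𝓝 0)) :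
    ∃! u : A → ℝ, u ∈ stable ξ ∧ v - u ∈ nilspace ξ := by
  have hnil : ∀ x, x ∈ nilspace ξ ↔ ∃ k : ℕ, (transposeMap ξ ^ k) x = 0 := fun x => by
    rw [nilspace, Module.End.mem_maxGenEigenspace]
    simp
  have hsup : nilspace ξ = ⨆ n, LinearMap.ker (transposeMap ξ ^ n) := by
    ext x
    rw [hnil, Submodule.mem_iSup_of_directed]
    · simp
    · refine Monotone.directed_le fun m n hmn x hx => ?_
      rw [LinearMap.mem_ker] at hx ⊢
      rw [← Nat.sub_add_cancel hmn, pow_add, Module.End.mul_apply, hx, map_zero]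
  -- The Fitting decomposition.
  have hcompl : IsCompl (nilspace ξ) (eventualRange ξ) := by
    rw [hsup]
    exact (transposeMap ξ).isCompl_iSup_ker_pow_iInf_range_pow
  obtain ⟨a, ha, u, hu, rfl⟩ := Submodule.mem_sup.1
    (hcompl.sup_eq_top ▸ Submodule.mem_top : v ∈ nilspace ξ ⊔ eventualRange ξ)
  refine ⟨u, ⟨⟨hu, ?_⟩, by simpa using ha⟩, ?_⟩
  · obtain ⟨k, hk⟩ := (hnil a).1 ha
    refine hv.congr' ?_
    filter_upwards [eventually_ge_atTop k] with n hn
    rw [map_add, ← Nat.sub_add_cancel hn, pow_add, Module.End.mul_apply, hk, map_zero, zero_add]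
  · rintro u' ⟨hu', hau'⟩
    have h1 : u' - u ∈ eventualRange ξ := sub_mem hu'.1 hu
    have h2 : u' - u ∈ nilspace ξ := by
      have := sub_mem ha hau'
      convert this using 1
      abel
    have h3 : u' - u ∈ nilspace ξ ⊓ eventualRange ξ := ⟨h2, h1⟩
    rw [hcompl.inf_eq_bot, Submodule.mem_bot, sub_eq_zero] at h3
    exact h3

theorem exists_pow_eq_zero_of_mem_nilspace {x : A → ℝ} (hx : x ∈ nilspace ξ) :
    ∃ k : ℕ, ∀ n ≥ k, (transposeMap ξ ^ n) x = 0 := by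
  rw [nilspace, Module.End.mem_maxGenEigenspace] at hx
  obtain ⟨k, hk⟩ := hx
  rw [zero_smul, sub_zero] at hk
  refine ⟨k, fun n hn => ?_⟩
  rw [← Nat.sub_add_cancel hn, pow_add, Module.End.mul_apply, hk, map_zero]

end Linear

end Subst

namespace Subst

/-! ### Lengths |ξⁿ(a)| as almost periods of the eigenvalues -/

section Eigenvalue

variable {A : Type*} [TopologicalSpace A] [DiscreteTopology A] {ξ : A → List A}

theorem tendsto_of_agree {x x' : ℕ → ℤ → A} {y : ℤ → A} (hx : Tendsto x atTop (𝓝 y))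
    (h : ∀ R : ℕ, ∀ t : ℤ, |t| ≤ R → x' R t = x R t) : Tendsto x' atTop (𝓝 y) := by
  rw [tendsto_pi_nhds] at hx ⊢
  intro t
  refine (hx t).congr' ?_
  filter_upwards [eventually_ge_atTop t.natAbs] with R hR
  exact (h R t (by rw [abs_le]; omega)).symm

/-- Continuous functions on the full shift are uniformly continuous. -/
theorem exists_agree_dist_le [Finite A] {E : Type*} [NormedAddCommGroup E] {g : (ℤ → A) → E}
    (hg : Continuous g) {ε : ℝ} (hε : 0 < ε) :
    ∃ R : ℕ, ∀ x x' : ℤ → A, (∀ t : ℤ, |t| ≤ R → x' t = x t) → ‖g x' - g x‖ ≤ ε := by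
  by_contra! hcon
  choose x x' hxx' hlt using hcon
  obtain ⟨y, φ, hφ, hlim⟩ := CompactSpace.tendsto_subseq x
  have hlim' : Tendsto (fun R => x' (φ R)) atTop (𝓝 y) :=
    tendsto_of_agree hlim fun R t ht => hxx' (φ R) t (ht.trans (by exact_mod_cast hφ.id_le R))
  have h1 : Tendsto (fun R => ‖g (x' (φ R)) - g (x (φ R))‖) atTop (𝓝 ‖g y - g y‖) :=
    (((hg.tendsto y).comp hlim').sub ((hg.tendsto y).comp hlim)).norm
  rw [sub_self, norm_zero] at h1
  exact absurd (ge_of_tendsto' h1 fun R => (hlt (φ R)).le) (not_le.2 hε)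

variable [MeasurableSpace A] {μ : Measure (ℤ → A)}

theorem ae_eigenvalue_pow (hμ : IsInvariantProbability ξ μ) {lam : ℂ} {f : (ℤ → A) → ℂ}
    (hf : (fun x => f (shift x)) =ᵐ[μ] fun x => lam * f x) :
    ∀ᵐ x ∂μ, ∀ k : ℕ, f (fun t => x (t + k)) = lam ^ k * f x := by
  rw [ae_all_iff]
  intro k
  induction k with
  | zero => simp
  | succ k ih =>
    filter_upwards [hμ.invariant.quasiMeasurePreserving.ae ih, hf] with x hx hx'
    rw [hx', ← mul_assoc, ← pow_succ] at hx
    rw [← hx]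
    congr 1
    funext t
    simp only [shift]
    congr 1; push_cast; ring

theorem exists_norm_ge_of_not_ae_zero {f : (ℤ → A) → ℂ} (hf : ¬ f =ᵐ[μ] 0) :
    ∃ δ > 0, μ {x | δ ≤ ‖f x‖} ≠ 0 := by
  by_contra! hcon
  refine hf ?_
  have h1 : ∀ᵐ x ∂μ, ∀ k : ℕ, ‖f x‖ < 1 / ((k : ℝ) + 1) := by
    rw [ae_all_iff]
    intro k
    have := hcon (1 / ((k : ℝ) + 1)) (by positivity)
    rw [ae_iff]
    simpa only [not_lt] using this
  filter_upwards [h1] with x hx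
  have h2 := ge_of_tendsto' tendsto_one_div_add_atTop_nhds_zero_nat fun k => (hx k).le
  exact norm_le_zero_iff.1 h2

variable [Finite A] [DiscreteMeasurableSpace A]

/-- The key estimate: the lengths of the words `ξⁿ(a)` are almost periods of the eigenvalues. -/
theorem tendsto_eigenvalue_pow (h : IsRegular ξ) (hμ : IsInvariantProbability ξ μ) {lam : ℂ}
    (hlam : ‖lam‖ = 1) (hl : IsEigenvalue μ lam) (a : A) :
    Tendsto (fun n => lam ^ (iter ξ n a).length) atTop (𝓝 1) := by
  have := hμ.prob
  have hne := h.ne_nil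
  obtain ⟨f, hf2, hf0, hfS⟩ := hl
  have hfint : Integrable f μ := hf2.integrable (by norm_num)
  obtain ⟨δ, hδ, hE⟩ := exists_norm_ge_of_not_ae_zero hf0
  set E := {x | δ ≤ ‖f x‖} with hEdef
  have hpow := ae_eigenvalue_pow hμ hfS
  set m := μ.real E with hm
  have hm0 : 0 < m := ENNReal.toReal_pos hE (measure_ne_top _ _)
  obtain ⟨C, hC0, hC⟩ := h.exists_length_le_mul
  obtain ⟨L, hL⟩ := exists_length_le ξ 1
  obtain ⟨b₀, hb₀⟩ := h.proper.1
  obtain ⟨p, hp⟩ := h.mixing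
  obtain ⟨D, hD⟩ := h.exists_reads (u := [a]) ⟨0, a, by simp [iter]⟩
  -- Properness enters here: after each word of level `1 + n` the same long word ξⁿ(b₀) is read
  -- again.
  have hcons : ∀ n b, ∃ w, iter ξ (1 + n) b = iter ξ n b₀ ++ w := fun n b => by
    obtain ⟨w, hw⟩ := List.head?_eq_some_iff.1 (hb₀ b)
    exact ⟨w.flatMap (iter ξ n), by rw [iter_add, iter_one, hw, List.flatMap_cons]⟩
  have hread : ∀ {x : ℤ → A} {t : ℤ} {n : ℕ} {b : A}, Reads x t (iter ξ (1 + n) b) →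
      Reads x t (iter ξ n b₀) := fun {x t n b} hr => by
    obtain ⟨w, hw⟩ := hcons n b
    rw [hw, reads_append] at hr
    exact hr.1
  have hnext : ∀ n b, (iter ξ (1 + n) b).length ≤ L * C * (iter ξ n b₀).length := fun n b => by
    rw [iter_add]
    refine (length_flatMap_le (fun c => hC n c b₀) _).trans ?_
    rw [mul_assoc]
    exact Nat.mul_le_mul_right _ (hL b)
  set Q : ℕ := (D + 2) * (L * C) with hQ
  have hstrong : Tendsto (fun n => lam ^ (iter ξ (n + 1) a).length) atTop (𝓝 1) := by
    rw [Metric.tendsto_atTop]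
    intro ε hε
    have hQ0 : (0 : ℝ) ≤ Q := Nat.cast_nonneg _
    -- Chosen so that `4 * c / H`, below, equals ε δ / 2.
    set η := ε * δ * m / (16 * (Q + 1)) with hη
    have hη0 : 0 < η := by positivity
    obtain ⟨g, hg, hgint⟩ := hfint.exists_boundedContinuous_integral_sub_le hη0
    obtain ⟨R, hR⟩ := exists_agree_dist_le g.continuous (ε := ε * δ / 4) (by positivity)
    set G : (ℤ → A) → ℝ := fun x => ‖f x - g x‖ with hG
    have hGint : Integrable G μ := (hfint.sub hgint).norm
    have hshift : ∀ k : ℕ, MeasurePreserving (fun (x : ℤ → A) (t : ℤ) => x (t + k)) μ μ := fun k => by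
      have := hμ.invariant.iterate k
      have e : (shift^[k] : (ℤ → A) → ℤ → A) = fun x t => x (t + k) := funext fun x =>
        shift_iterate x k
      rwa [e] at this
    have hGk : ∀ k : ℕ, Integrable (fun x => G fun t => x (t + k)) μ := fun k =>
      (hshift k).integrable_comp_of_integrable hGint
    have hGk' : ∀ k : ℕ, ∫ x, G (fun t => x (t + k)) ∂μ = ∫ x, G x ∂μ := fun k => by
      have h1 := (hshift k).map_eq
      conv_rhs => rw [← h1]
      rw [integral_map (hshift k).measurable.aemeasurable]
      rw [h1]
      exact hGint.aestronglyMeasurable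
    obtain ⟨n₀, hn₀⟩ := eventually_atTop.1 (h.eventually_le_length (4 * R + 1))
    refine ⟨n₀, fun n hn => ?_⟩
    set H := (iter ξ n b₀).length with hH
    have hHR : 4 * R + 1 ≤ H := hn₀ n hn b₀
    set N := Q * H with hN
    set c := (Q + 1) * H * η / m * 2 with hc
    have hH0 : (0 : ℝ) < H := by
      have : 0 < H := by omega
      exact_mod_cast this
    have hc0 : 0 < c := by positivity
    -- Markov's inequality: the sum has integral at most `N * η`, too small for it to be at least
    -- `c` almost everywhere on `E`.
    obtain ⟨x, hxΩ, hxE, hxpow, hxc⟩ : ∃ x ∈ Omega ξ, x ∈ E ∧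
        (∀ k : ℕ, f (fun t => x (t + k)) = lam ^ k * f x) ∧
        ∑ k ∈ Finset.range N, G (fun t => x (t + k)) < c := by
      by_contra! hcon
      have hsum : Integrable (fun x => ∑ k ∈ Finset.range N, G fun t => x (t + k)) μ :=
        integrable_finsetSum _ fun k _ => hGk k
      have h1 := mul_meas_ge_le_integral_of_nonneg (μ := μ)
        (f := fun x => ∑ k ∈ Finset.range N, G fun t => x (t + k))
        (Eventually.of_forall fun x => Finset.sum_nonneg fun k _ => norm_nonneg _) hsum c
      have h2 : m ≤ μ.real {x | c ≤ ∑ k ∈ Finset.range N, G fun t => x (t + k)} := by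
        refine ENNReal.toReal_mono (measure_ne_top _ _) (measure_mono_ae ?_)
        filter_upwards [hμ.carried, hpow] with x hx hx' hxE
        exact hcon x hx hxE hx'
      rw [integral_finsetSum _ fun k _ => hGk k, Finset.sum_congr rfl fun k _ => hGk' k] at h1
      rw [Finset.sum_const, Finset.card_range, nsmul_eq_mul] at h1
      have h3 : c * m ≤ N * η :=
        (mul_le_mul_of_nonneg_left h2 hc0.le).trans (h1.trans
          (mul_le_mul_of_nonneg_left hg (Nat.cast_nonneg _)))
      have h4 : c * m = (Q + 1) * H * η * 2 := by
        rw [hc]; field_simp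
      rw [h4, hN] at h3
      push_cast at h3
      nlinarith [mul_pos hH0 hη0, mul_nonneg hQ0 (mul_pos hH0 hη0).le]
    obtain ⟨y, hy, d, hd⟩ := exists_desubstitution hne (1 + n) hxΩ
    obtain ⟨j, hj, hj'⟩ := hd.exists_cell hne 0
    obtain ⟨i, hi, hi', hia⟩ := hD y hy (j + 1)
    have hya : y i = a := hia.1
    have hmono := hd.strictMono hne
    have hr1 := hread (hd.reads i)
    have hr2 := hread (hd.reads (i + 1))
    have hs1 := hd.step i
    have hs2 := hd.step (i + 1)
    rw [hya] at hs1
    have hlen2 : H ≤ (iter ξ (1 + n) (y (i + 1))).length := by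
      obtain ⟨w, hw⟩ := hcons n (y (i + 1))
      rw [hw, List.length_append]
      omega
    have hlen1 : H ≤ (iter ξ (1 + n) a).length := by
      obtain ⟨w, hw⟩ := hcons n a
      rw [hw, List.length_append]
      omega
    have hpos : 0 < d i := hj'.trans_le (hmono.monotone hi)
    have hend : d (i + 1 + 1) ≤ N := by
      have h1 := hd.cut_le (hnext n) j (D + 2)
      have h2 : d (i + 1 + 1) ≤ d (j + (D + 2 : ℕ)) := hmono.monotone (by push_cast; omega)
      have h3 : (((D + 2 : ℕ) : ℤ)) * ((L * C * H : ℕ) : ℤ) = N := by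
        rw [hN, hQ]; push_cast; ring
      rw [h3] at h1
      omega
    obtain ⟨t, ht⟩ := Int.eq_ofNat_of_zero_le hpos.le
    set l := (iter ξ (1 + n) a).length with hldef
    -- The word ξⁿ(b₀) is read both from `t` and from `t + l`, so away from its ends the two
    -- translates agree up to distance `R`.
    have hagree : ∀ k : ℕ, R ≤ k → k + R < H →
        ‖g (fun s => x (s + (t + l + k : ℕ))) - g (fun s => x (s + (t + k : ℕ)))‖ ≤ ε * δ / 4 := by
      intro k hk hk'
      refine hR _ _ fun s hs => ?_
      rw [abs_le] at hs
      have := hr2.eq_of_reads hr1 (k := s + k) (by omega) (by omega)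
      push_cast
      rw [show s + ((t : ℤ) + l + k) = d (i + 1) + (s + k) by rw [hs1, ht]; ring, this, ht]
      congr 1; ring
    set I := Finset.Ico R (H - R) with hI
    have hIcard : (I.card : ℝ) ≥ H / 2 := by
      rw [hI, Nat.card_Ico, Nat.sub_sub, Nat.cast_sub (by omega)]
      have : (4 : ℝ) * R + 1 ≤ H := by exact_mod_cast hHR
      push_cast
      linarith
    have hIne : I.Nonempty := Finset.nonempty_Ico.2 (by omega)
    have hsub : ∀ q : ℕ, q + H ≤ N → ∑ k ∈ I, G (fun s => x (s + (q + k : ℕ))) < c := by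
      intro q hq
      refine lt_of_le_of_lt ?_ hxc
      rw [← Finset.sum_image (f := fun k : ℕ => G fun s => x (s + k)) (g := fun k => q + k)
        (fun u _ v _ huv => by dsimp only at huv; omega)]
      refine Finset.sum_le_sum_of_subset_of_nonneg (fun u hu => ?_) fun _ _ _ => norm_nonneg _
      obtain ⟨v, hv, rfl⟩ := Finset.mem_image.1 hu
      rw [hI, Finset.mem_Ico] at hv
      rw [Finset.mem_range]
      omega
    have hsub1 := hsub t (by omega)
    have hsub2 := hsub (t + l) (by omega)
    -- Two sums below `c` over at least `H / 2` indices: some index is at most the average.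
    obtain ⟨k, hk, hkle⟩ : ∃ k ∈ I, G (fun s => x (s + (t + k : ℕ))) +
        G (fun s => x (s + (t + l + k : ℕ))) ≤ 4 * c / H := by
      refine Finset.exists_le_of_sum_le hIne ?_
      rw [Finset.sum_add_distrib, Finset.sum_const, nsmul_eq_mul]
      have : 2 * c ≤ I.card * (4 * c / H) := by
        calc 2 * c = H / 2 * (4 * c / H) := by field_simp; norm_num
          _ ≤ _ := mul_le_mul_of_nonneg_right hIcard (by positivity)
      linarith
    rw [hI, Finset.mem_Ico] at hk
    have hag := hagree k hk.1 (by omega)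
    simp only [hG, hxpow] at hkle
    have h4c : 4 * c / H ≤ ε * δ / 2 := by
      rw [hc, hη]
      have : 4 * ((Q + 1) * H * (ε * δ * m / (16 * (Q + 1))) / m * 2) / H = ε * δ / 2 := by
        field_simp
        norm_num
      exact this.le
    have hfin : ‖lam ^ (t + l + k) * f x - lam ^ (t + k) * f x‖ ≤ 3 / 4 * (ε * δ) := by
      set g₁ := g (fun s => x (s + (t + k : ℕ)))
      set g₂ := g (fun s => x (s + (t + l + k : ℕ)))
      calc ‖lam ^ (t + l + k) * f x - lam ^ (t + k) * f x‖
          = ‖(lam ^ (t + l + k) * f x - g₂) + (g₂ - g₁) - (lam ^ (t + k) * f x - g₁)‖ := by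
            congr 1; ring
        _ ≤ ‖lam ^ (t + l + k) * f x - g₂‖ + ‖g₂ - g₁‖ + ‖lam ^ (t + k) * f x - g₁‖ :=
            (norm_sub_le _ _).trans (add_le_add_left (norm_add_le _ _) _)
        _ ≤ _ := by linarith
    have hfac : lam ^ (t + l + k) * f x - lam ^ (t + k) * f x =
        lam ^ (t + k) * ((lam ^ l - 1) * f x) := by ring
    rw [hfac, norm_mul, norm_pow, hlam, one_pow, one_mul, norm_mul] at hfin
    have hxE' : δ ≤ ‖f x‖ := hxE
    rw [dist_eq_norm, add_comm n 1]
    by_contra hge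
    push Not at hge
    have : ε * δ ≤ ‖lam ^ l - 1‖ * ‖f x‖ := mul_le_mul hge hxE' hδ.le (norm_nonneg _)
    nlinarith [mul_pos hε hδ]
  exact (tendsto_add_atTop_iff_nat 1).1 hstrong

end Eigenvalue

/-! ### Aperiodicity and the decomposition of the constant vectors -/

section Decomposition

/-- With `d` the signed distance to the nearest integer, the right side is 2|sin πd|, and Jordan's
inequality gives |sin πd| ≥ 2|d|. -/
theorem four_mul_abs_sub_round_le (x : ℝ) :
    4 * |x - round x| ≤ ‖Complex.exp (2 * Real.pi * Complex.I * x) - 1‖ := by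
  set d := x - round x with hd
  have h1 : Complex.exp (2 * Real.pi * Complex.I * x) = Complex.exp (Complex.I * (2 * Real.pi * d : ℝ)) := by
    rw [Complex.exp_eq_exp_iff_exists_int]
    refine ⟨round x, ?_⟩
    rw [hd]; push_cast; ring
  rw [h1, Complex.norm_exp_I_mul_ofReal_sub_one, Real.norm_eq_abs, abs_mul, abs_two]
  have h2 : |d| ≤ 1 / 2 := abs_sub_round x
  have h3 := Real.mul_abs_le_abs_sin (x := 2 * Real.pi * d / 2) (by
    rw [show 2 * Real.pi * d / 2 = Real.pi * d by ring, abs_mul, abs_of_pos Real.pi_pos]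
    nlinarith [Real.pi_pos])
  rw [show 2 * Real.pi * d / 2 = Real.pi * d by ring] at *
  rw [abs_mul, abs_of_pos Real.pi_pos, ← mul_assoc, div_mul_cancel₀ _ Real.pi_ne_zero] at h3
  linarith

theorem norm_exp_two_pi_I_mul (x : ℝ) : ‖Complex.exp (2 * Real.pi * Complex.I * x)‖ = 1 := by
  rw [show (2 * Real.pi * Complex.I * x : ℂ) = (2 * Real.pi * x : ℝ) * Complex.I by push_cast; ring]
  exact Complex.norm_exp_ofReal_mul_I _

variable {A : Type*} [Fintype A] [DecidableEq A]
    [TopologicalSpace A] [DiscreteTopology A] [MeasurableSpace A] [DiscreteMeasurableSpace A]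
    {ξ : A → List A} {μ : Measure (ℤ → A)} {n : ℕ} {α : Fin n → ℝ}

theorem HypothesesP.nonempty (hP : HypothesesP ξ μ α) : Nonempty A :=
  ⟨hP.substitution.1.choose⟩

theorem HypothesesP.isRegular (hP : HypothesesP ξ μ α) : IsRegular ξ :=
  isRegular_of_primitive hP.substitution hP.primitive hP.proper

/-- On a zero space the determinant is `1`, and (iii) would give β = 1. -/
theorem HypothesesP.pos (hP : HypothesesP ξ μ α) : 0 < n := by
  have := hP.nonempty
  obtain ⟨β, hβ1, hβ, -⟩ := exists_perron hP.primitive hP.unique_root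
  have h1 := hP.det_stable β hβ
  by_contra hn
  have h2 : Module.finrank ℝ (stable ξ) = 0 := by rw [hP.dim_stable]; omega
  rw [LinearMap.det_eq_one_of_finrank_eq_zero h2, abs_one, mul_one] at h1
  exact hβ1.ne' h1

/-- A common period `m` would force λᵐ = 1 for an eigenvalue λ, making its exponent rational. -/
theorem HypothesesP.aperiodic (hP : HypothesesP ξ μ α) (m : ℕ) (hm : 0 < m) :
    ∃ x ∈ Omega ξ, ∃ t : ℤ, x (t + m) ≠ x t := by
  by_contra! hcon
  obtain ⟨f, -, hf0, hfS⟩ := hP.eigenvalue ⟨0, hP.pos⟩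
  obtain ⟨x, hx, hx0, hxΩ⟩ : ∃ x : ℤ → A, (∀ k : ℕ, f (fun t => x (t + k)) =
      Complex.exp (2 * Real.pi * Complex.I * α ⟨0, hP.pos⟩) ^ k * f x) ∧ f x ≠ 0 ∧ x ∈ Omega ξ := by
    by_contra! hcon'
    refine hf0 ?_
    filter_upwards [ae_eigenvalue_pow hP.measure hfS, hP.measure.carried] with x hx hxΩ
    by_contra h0
    exact hcon' x hx h0 hxΩ
  have h1 := hx m
  rw [show (fun t => x (t + m)) = x from funext (hcon x hxΩ)] at h1
  have h2 : Complex.exp (2 * Real.pi * Complex.I * α ⟨0, hP.pos⟩) ^ m = 1 :=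
    mul_right_cancel₀ hx0 (by rw [← h1, one_mul])
  rw [← Complex.exp_nat_mul, Complex.exp_eq_one_iff] at h2
  obtain ⟨k, hk⟩ := h2
  have h3 : (m : ℝ) * α ⟨0, hP.pos⟩ = k := by
    have h4 : (2 * Real.pi * Complex.I : ℂ) ≠ 0 := Complex.two_pi_I_ne_zero
    have h5 : ((m : ℂ) * α ⟨0, hP.pos⟩) = k := by
      refine mul_right_cancel₀ h4 ?_
      rw [← hk]; ring
    exact_mod_cast h5
  have h6 := (Fintype.linearIndependent_iff.1 hP.independent)
    (Fin.cons (-(k : ℚ)) (fun i => if i = ⟨0, hP.pos⟩ then (m : ℚ) else 0)) (by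
      rw [Fin.sum_univ_succ]
      simp only [Fin.cons_zero, Fin.cons_succ, ite_smul, zero_smul, Finset.sum_ite_eq',
        Finset.mem_univ, if_true]
      rw [Rat.smul_def, Rat.smul_def]
      push_cast
      rw [h3]
      ring) (Fin.succ ⟨0, hP.pos⟩)
  simp only [Fin.cons_succ, if_true] at h6
  exact hm.ne' (by exact_mod_cast h6)

/-- The eigenvalues give decompositions of the constant vectors. -/
theorem HypothesesP.exists_decomposition (hP : HypothesesP ξ μ α) :
    ∃ (v : Fin n → A → ℝ) (w : Fin n → A → ℤ), IsDecomposition ξ α v w ∧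
      ((fun _ : A => (1 : ℝ)) ∈ eventualRange ξ → ∀ i, v i ∈ stable ξ) := by
  have := hP.nonempty
  have key : ∀ i, ∃ w : A → ℤ, (fun a => (w a : ℝ)) ∈ eventualRange ξ ∧
      Tendsto (fun k : ℕ => (transposeMap ξ ^ k) ((fun _ => α i) - fun a => (w a : ℝ)))
        atTop (𝓝 0) := fun i => by
    -- The `k`-th iterate of the constant vector has the entries |ξᵏ(a)| α_i, which approach their
    -- nearest integers.
    refine exists_intVector hP.primitive hP.unique_root hP.det_stable
      (z := fun k a => round ((iter ξ k a).length * α i)) ?_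
    rw [tendsto_pi_nhds]
    intro a
    simp only [Pi.sub_apply, Pi.zero_apply, transposeMap_pow_const]
    have h1 := tendsto_eigenvalue_pow hP.isRegular hP.measure (norm_exp_two_pi_I_mul (α i))
      (hP.eigenvalue i) a
    have h2 := (h1.sub_const 1).norm
    rw [sub_self, norm_zero] at h2
    refine squeeze_zero_norm (fun k => ?_) h2
    have h3 := four_mul_abs_sub_round_le ((iter ξ k a).length * α i)
    rw [← Complex.exp_nat_mul, show (((iter ξ k a).length : ℕ) : ℂ) *
      (2 * Real.pi * Complex.I * α i) = 2 * Real.pi * Complex.I *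
        (((iter ξ k a).length * α i : ℝ) : ℂ) by push_cast; ring]
    rw [Real.norm_eq_abs]
    linarith [abs_nonneg ((iter ξ k a).length * α i - round ((iter ξ k a).length * α i))]
  choose w hw hw' using key
  refine ⟨fun i => (fun _ => α i) - fun a => (w i a : ℝ), w, fun i => ⟨fun a => by simp, hw' i⟩,
    fun h1 i => ⟨?_, hw' i⟩⟩
  refine sub_mem ?_ (hw i)
  have := Submodule.smul_mem _ (α i) h1
  convert this using 1
  ext a
  simp

end Decomposition

end Subst

/-! ### The desubstitution map and entrance times -/

namespace Subst

/-- A regular substitution without a common period of the sequences of `Ω_ξ`. -/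
structure IsAperiodic {A : Type*} (ξ : A → List A) : Prop extends IsRegular ξ where
  aperiodic : ∀ m : ℕ, 0 < m → ∃ x ∈ Omega ξ, ∃ t : ℤ, x (t + m) ≠ x t

open Classical in
/-- The sequence `y` of `Ω_ξ` such that the orbit of `x` enters `ξ(Ω_ξ)` at `ξ(y)`. -/
noncomputable def desub {A : Type*} (ξ : A → List A) (x : ℤ → A) : ℤ → A :=
  if h : ∃ y ∈ Omega ξ, extend ξ y = shift^[entrance ξ 1 x] x then h.choose else x

section Desub

variable {A : Type*} [Finite A] {ξ : A → List A} {x y : ℤ → A} {c : ℤ → ℤ}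

theorem Str.extend_translate (h : IsAperiodic ξ) (hc : Str ξ 1 x c y) (i : ℤ) :
    extend ξ (fun t => y (t + i)) = fun t => x (t + c i) := by
  rw [← (hc.reindex i).eq_extend h.ne_nil, zero_add]

/-- By recognizability an orbit meets ξ(Ω_ξ) at the cuts only, so membership at level `j + 1` for
`x` is membership at level `j` for `y`. -/
theorem translate_mem_image_iff (h : IsAperiodic ξ) (hy : y ∈ Omega ξ) (hc : Str ξ 1 x c y) {j : ℕ}
    {s : Set (ℤ → A)} (hs : s ⊆ Omega ξ) {k : ℤ} :
    (fun t => x (t + k)) ∈ (extend ξ)^[j + 1] '' s ↔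
      ∃ i, c i = k ∧ (fun t => y (t + i)) ∈ (extend ξ)^[j] '' s := by
  constructor
  · rintro ⟨z, hz, hzx⟩
    rw [Function.iterate_succ_apply'] at hzx
    obtain ⟨c₁, -, hc₁⟩ := str_extend_iterate h.ne_nil j z
    have hz' : (extend ξ)^[j] z ∈ Omega ξ := hc₁.mem_Omega h.ne_nil (hs hz)
    obtain ⟨c', hc'0, hc'⟩ := str_extend h.ne_nil ((extend ξ)^[j] z)
    rw [hzx] at hc'
    obtain ⟨p, hp⟩ := h.recognizable h.aperiodic hy hz' (hc.comp_add k) hc'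
    refine ⟨p, ?_, z, hz, funext fun t => (hp t).2⟩
    have := (hp 0).1
    rw [hc'0, zero_add] at this
    omega
  · rintro ⟨i, rfl, z, hz, hzy⟩
    refine ⟨z, hz, ?_⟩
    rw [Function.iterate_succ_apply', hzy, hc.extend_translate h]

/-- Under this choice of indices `c 0` is the first entrance into ξ(Ω_ξ), and the coordinate `-1`
lies in ξ(y_{-1}). This is why the letter before the origin, not the one at it, serves as label
below. -/
theorem exists_normalized (h : IsAperiodic ξ) (hx : x ∈ Omega ξ) :
    ∃ y ∈ Omega ξ, ∃ c, Str ξ 1 x c y ∧ c (-1) < 0 ∧ 0 ≤ c 0 := by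
  let _ : TopologicalSpace A := ⊥
  have _ : DiscreteTopology A := ⟨rfl⟩
  obtain ⟨y, hy, c, hc⟩ := exists_desubstitution h.ne_nil 1 hx
  obtain ⟨i, hi, hi'⟩ := hc.exists_cell h.ne_nil (-1)
  refine ⟨_, comp_add_mem_Omega hy (i + 1), _, hc.reindex (i + 1), ?_, ?_⟩
  · rw [show -1 + (i + 1) = i by ring]; omega
  · rw [zero_add]; omega

theorem nonneg_of_cut_nonneg (h : IsAperiodic ξ) (hc : Str ξ 1 x c y) (h1 : c (-1) < 0) {i : ℤ}
    (hi : 0 ≤ c i) : 0 ≤ i := by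
  have := (hc.strictMono h.ne_nil).lt_iff_lt.1 (h1.trans_le hi)
  omega

theorem entrance_set_eq (h : IsAperiodic ξ) (hy : y ∈ Omega ξ) (hc : Str ξ 1 x c y)
    (h1 : c (-1) < 0) (h0 : 0 ≤ c 0) (j : ℕ) {s : Set (ℤ → A)} (hs : s ⊆ Omega ξ) :
    {k : ℕ | shift^[k] x ∈ (extend ξ)^[j + 1] '' s} =
      (fun i : ℕ => (c i).toNat) '' {i : ℕ | shift^[i] y ∈ (extend ξ)^[j] '' s} := by
  ext k
  simp only [Set.mem_ofPred_eq, Set.mem_image (f := fun i : ℕ => (c i).toNat), shift_iterate]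
  rw [translate_mem_image_iff h hy hc hs]
  constructor
  · rintro ⟨i, hi, hm⟩
    obtain ⟨p, rfl⟩ := Int.eq_ofNat_of_zero_le (nonneg_of_cut_nonneg h hc h1 (i := i) (by omega))
    exact ⟨p, hm, by omega⟩
  · rintro ⟨i, hm, hi⟩
    have := (hc.strictMono h.ne_nil).monotone (Int.natCast_nonneg i)
    exact ⟨i, by omega, hm⟩

theorem strictMono_toNat (h : IsAperiodic ξ) (hc : Str ξ 1 x c y) (h0 : 0 ≤ c 0) :
    StrictMono fun i : ℕ => (c i).toNat := fun i j hij => by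
  have h1 := hc.strictMono h.ne_nil (show (i : ℤ) < j by exact_mod_cast hij)
  have h2 := (hc.strictMono h.ne_nil).monotone (Int.natCast_nonneg i)
  dsimp only
  omega

theorem entrance_set_nonempty (h : IsAperiodic ξ) (hx : x ∈ Omega ξ) (j : ℕ) :
    {k : ℕ | shift^[k] x ∈ (extend ξ)^[j] '' Omega ξ}.Nonempty := by
  induction j generalizing x with
  | zero => exact ⟨0, x, hx, rfl⟩
  | succ j ih =>
    obtain ⟨y, hy, c, hc, h1, h0⟩ := exists_normalized h hx
    rw [entrance_set_eq h hy hc h1 h0 j subset_rfl]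
    exact (ih hy).image _

theorem entrance_zero (hx : x ∈ Omega ξ) : entrance ξ 0 x = 0 :=
  Nat.sInf_eq_zero.2 (.inl ⟨x, hx, rfl⟩)

theorem entrance_succ (h : IsAperiodic ξ) (hy : y ∈ Omega ξ) (hc : Str ξ 1 x c y)
    (h1 : c (-1) < 0) (h0 : 0 ≤ c 0) (j : ℕ) :
    entrance ξ (j + 1) x = (c (entrance ξ j y)).toNat := by
  have hm := strictMono_toNat h hc h0
  have hne := entrance_set_nonempty h hy j
  rw [entrance, entrance_set_eq h hy hc h1 h0 j subset_rfl]
  refine le_antisymm (Nat.sInf_le ⟨_, Nat.sInf_mem hne, rfl⟩) ?_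
  obtain ⟨i, hi, hi'⟩ := Nat.sInf_mem (hne.image fun i : ℕ => (c i).toNat)
  rw [← hi']
  exact hm.monotone (Nat.sInf_le hi)

theorem entrance_one (h : IsAperiodic ξ) (hy : y ∈ Omega ξ) (hc : Str ξ 1 x c y)
    (h1 : c (-1) < 0) (h0 : 0 ≤ c 0) : (entrance ξ 1 x : ℤ) = c 0 := by
  rw [entrance_succ h hy hc h1 h0 0, entrance_zero hy]
  simpa using h0

theorem desub_eq (h : IsAperiodic ξ) (hy : y ∈ Omega ξ) (hc : Str ξ 1 x c y)
    (h1 : c (-1) < 0) (h0 : 0 ≤ c 0) : desub ξ x = y := by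
  have hE : ∃ y ∈ Omega ξ, extend ξ y = shift^[entrance ξ 1 x] x := by
    refine ⟨y, hy, ?_⟩
    have := hc.extend_translate h 0
    simp only [add_zero] at this
    rw [this, shift_iterate, entrance_one h hy hc h1 h0]
  rw [desub, dif_pos hE]
  obtain ⟨hz, hz'⟩ := hE.choose_spec
  set z := hE.choose
  rw [shift_iterate, entrance_one h hy hc h1 h0] at hz'
  obtain ⟨c', hc'0, hc'⟩ := str_extend h.ne_nil z
  rw [hz'] at hc'
  obtain ⟨p, hp⟩ := h.recognizable h.aperiodic hy hz (hc.comp_add (c 0)) hc'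
  have hp0 := (hp 0).1
  rw [hc'0, zero_add] at hp0
  have : p = 0 := (hc.strictMono h.ne_nil).injective (by omega)
  subst this
  exact funext fun t => by simpa using (hp t).2

theorem desub_spec (h : IsAperiodic ξ) (hx : x ∈ Omega ξ) :
    desub ξ x ∈ Omega ξ ∧ ∃ c, Str ξ 1 x c (desub ξ x) ∧ c (-1) < 0 ∧ c 0 = entrance ξ 1 x := by
  obtain ⟨y, hy, c, hc, h1, h0⟩ := exists_normalized h hx
  rw [desub_eq h hy hc h1 h0]
  exact ⟨hy, c, hc, h1, (entrance_one h hy hc h1 h0).symm⟩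

theorem desub_mem (h : IsAperiodic ξ) (hx : x ∈ Omega ξ) : desub ξ x ∈ Omega ξ := (desub_spec h hx).1

theorem desub_iterate_mem (h : IsAperiodic ξ) (hx : x ∈ Omega ξ) (j : ℕ) :
    (desub ξ)^[j] x ∈ Omega ξ := by
  induction j with
  | zero => exact hx
  | succ j ih => rw [Function.iterate_succ_apply']; exact desub_mem h ih

theorem entrance_one_lt (h : IsAperiodic ξ) (hx : x ∈ Omega ξ) :
    entrance ξ 1 x < (ξ (desub ξ x (-1))).length := by
  obtain ⟨hy, c, hc, h1, h0⟩ := desub_spec h hx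
  have := hc.step (-1)
  rw [neg_add_cancel, iter_one] at this
  omega

theorem apply_neg_one_eq (h : IsAperiodic ξ) (hx : x ∈ Omega ξ) :
    (ξ (desub ξ x (-1)))[(ξ (desub ξ x (-1))).length - 1 - entrance ξ 1 x]? = some (x (-1)) := by
  obtain ⟨hy, c, hc, h1, h0⟩ := desub_spec h hx
  have hlt := entrance_one_lt h hx
  have h2 := hc.step (-1)
  rw [neg_add_cancel, iter_one] at h2
  have h3 := (hc.reads (-1))
  rw [iter_one] at h3
  have h4 := h3.getElem (k := (ξ (desub ξ x (-1))).length - 1 - entrance ξ 1 x) (by omega)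
  rw [List.getElem?_eq_getElem (by omega), ← h4]
  congr 2
  omega

/-- Every sequence `y` and position in the word `ξ (y (-1))` come from a point of `Ω_ξ`. -/
theorem exists_of_desub (h : IsAperiodic ξ) (hy : y ∈ Omega ξ) {k : ℕ}
    (hk : k < (ξ (y (-1))).length) :
    ∃ x ∈ Omega ξ, entrance ξ 1 x = k ∧ desub ξ x = y ∧ x = fun t => extend ξ y (t + -k) := by
  obtain ⟨c, hc0, hc⟩ := str_extend h.ne_nil y
  have hc' := hc.comp_add (-k)
  have h2 := hc.step (-1)
  rw [neg_add_cancel, iter_one] at h2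
  have h1 : c (-1) - -(k : ℤ) < 0 := by omega
  have h0 : 0 ≤ c 0 - -(k : ℤ) := by omega
  refine ⟨_, hc'.mem_Omega h.ne_nil hy, ?_, desub_eq h hy hc' h1 h0, rfl⟩
  have := entrance_one h hy hc' h1 h0
  omega

/-- The strictly increasing map sending `i` to the cut `c i` carries the visits of `desub ξ x`
bijectively to those of `x`. -/
theorem visits_succ (h : IsAperiodic ξ) (hx : x ∈ Omega ξ) (j : ℕ) (a : A) :
    visits ξ (j + 1) x a = visits ξ j (desub ξ x) a := by
  obtain ⟨hy, c, hc, h1, h0⟩ := desub_spec h hx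
  set y := desub ξ x
  have h0' : 0 ≤ c 0 := by omega
  have hm := strictMono_toNat h hc h0'
  have hcyl : cylinder ξ a ⊆ Omega ξ := fun z hz => hz.1
  rw [visits, visits]
  refine Eq.trans (congrArg Set.ncard ?_) (Set.ncard_image_of_injective _ hm.injective)
  ext k
  have h2 := Set.ext_iff.1 (entrance_set_eq h hy hc h1 h0' j hcyl) k
  simp only [Set.mem_ofPred_eq, Set.mem_image (f := fun i : ℕ => (c i).toNat)] at h2 ⊢
  rw [h2, entrance_succ h hy hc h1 h0', entrance_succ h hy hc h1 h0']
  constructor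
  · rintro ⟨e1, e2, i, hi, rfl⟩
    exact ⟨i, ⟨hm.le_iff_le.1 e1, hm.lt_iff_lt.1 e2, hi⟩, rfl⟩
  · rintro ⟨i, ⟨e1, e2, hi⟩, rfl⟩
    exact ⟨hm.le_iff_le.2 e1, hm.lt_iff_lt.2 e2, i, hi, rfl⟩

/-- The sum of `f` over the letters of `x` before its entrance in `ξ(Ω_ξ)`. -/
noncomputable def entranceSum (ξ : A → List A) (f : A → ℝ) (x : ℤ → A) : ℝ :=
  ∑ k ∈ Finset.range (entrance ξ 1 x), f (x k)

theorem Reads.sum_eq {t : ℤ} {w : List A} (hw : Reads x t w) (f : A → ℝ) :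
    ∑ k ∈ Finset.range w.length, f (x (t + k)) = (w.map f).sum := by
  induction w generalizing t with
  | nil => simp
  | cons a w ih =>
    rw [List.length_cons, Finset.sum_range_succ', List.map_cons, List.sum_cons, ← ih hw.2, add_comm]
    congr 1
    · simp [hw.1]
    · refine Finset.sum_congr rfl fun k _ => ?_
      congr 2; push_cast; ring

theorem entranceSum_eq (h : IsAperiodic ξ) (hx : x ∈ Omega ξ) (f : A → ℝ) :
    entranceSum ξ f x = (((ξ (desub ξ x (-1))).drop
      ((ξ (desub ξ x (-1))).length - entrance ξ 1 x)).map f).sum := by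
  obtain ⟨hy, c, hc, h1, h0⟩ := desub_spec h hx
  have hlt := entrance_one_lt h hx
  have h2 := hc.step (-1)
  have h3 := hc.reads (-1)
  rw [iter_one] at h2 h3
  set w := ξ (desub ξ x (-1))
  rw [← List.take_append_drop (w.length - entrance ξ 1 x) w, reads_append] at h3
  have h4 := h3.2.sum_eq f
  rw [← h4, entranceSum, List.length_drop, Nat.sub_sub_self hlt.le]
  refine Finset.sum_congr rfl fun k _ => ?_
  congr 2
  rw [List.length_take, neg_add_cancel] at *
  omega

end Desub

/-! ### The series as a cocycle -/

section Cocycle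

variable {A : Type*} [Fintype A] [DecidableEq A] {ξ : A → List A} {x y : ℤ → A}

theorem sum_visits (h : IsAperiodic ξ) (hx : x ∈ Omega ξ) (j : ℕ) (f : A → ℝ) :
    ∑ a, (visits ξ j x a : ℝ) * f a = entranceSum ξ f ((desub ξ)^[j] x) := by
  induction j generalizing x with
  | zero =>
    have h1 : ∀ a, visits ξ 0 x a =
        ((Finset.range (entrance ξ 1 x)).filter fun k : ℕ => x k = a).card := fun a => by
      rw [visits, ← Set.ncard_coe_finset]
      congr 1
      ext k
      simp only [entrance_zero hx, Set.mem_ofPred_eq, zero_le, true_and, zero_add,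
        Function.iterate_zero, Set.image_id, Finset.coe_filter, Finset.mem_range, cylinder]
      rw [shift_iterate]
      simp only [zero_add]
      exact and_congr_right fun _ => and_iff_right (comp_add_mem_Omega hx k)
    simp only [h1, Function.iterate_zero, id, entranceSum]
    simp only [Finset.card_filter, Nat.cast_sum, Finset.sum_mul]
    rw [Finset.sum_comm]
    refine Finset.sum_congr rfl fun k _ => ?_
    simp
  | succ j ih =>
    simp only [visits_succ h hx, Function.iterate_succ_apply]
    exact ih (desub_mem h hx)

/-- The sum of the series that defines one coordinate of `F`. -/
noncomputable def cocycle (ξ : A → List A) (v : A → ℝ) (x : ℤ → A) : ℝ :=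
  ∑' j, entranceSum ξ ((transposeMap ξ ^ j) v) ((desub ξ)^[j] x)

theorem term_eq (h : IsAperiodic ξ) (hx : x ∈ Omega ξ) {n : ℕ} (v : Fin n → A → ℝ) (i : Fin n)
    (j : ℕ) : term ξ v x i j = entranceSum ξ ((transposeMap ξ ^ j) (v i)) ((desub ξ)^[j] x) :=
  sum_visits h hx j _

theorem F_eq (h : IsAperiodic ξ) (hx : x ∈ Omega ξ) {n : ℕ} (v : Fin n → A → ℝ) :
    F ξ v x = fun i => cocycle ξ (v i) x := by
  funext i
  exact tsum_congr fun j => term_eq h hx v i j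

/-- The vectors whose iterates under the transposed incidence matrix tend to `0`. -/
abbrev IsDecaying (ξ : A → List A) (v : A → ℝ) : Prop :=
  Tendsto (fun k : ℕ => (transposeMap ξ ^ k) v) atTop (𝓝 0)

theorem IsDecaying.transposeMap_pow {v : A → ℝ} (hv : IsDecaying ξ v) (m : ℕ) :
    IsDecaying ξ ((transposeMap ξ ^ m) v) := by
  simp only [IsDecaying, ← Module.End.mul_apply, ← pow_add]
  exact hv.comp (tendsto_add_atTop_nat m)

theorem IsDecaying.transposeMap {v : A → ℝ} (hv : IsDecaying ξ v) :
    IsDecaying ξ (transposeMap ξ v) := by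
  simpa using hv.transposeMap_pow 1

theorem exists_abs_entranceSum_le (h : IsAperiodic ξ) : ∃ l : ℝ, 0 ≤ l ∧
    ∀ x ∈ Omega ξ, ∀ f : A → ℝ, |entranceSum ξ f x| ≤ l * ‖f‖ := by
  obtain ⟨l, hl⟩ := exists_length_le ξ 1
  refine ⟨l, Nat.cast_nonneg _, fun x hx f => ?_⟩
  have h1 := entrance_one_lt h hx
  have h2 := hl (desub ξ x (-1))
  rw [iter_one] at h2
  calc |entranceSum ξ f x| ≤ ∑ k ∈ Finset.range (entrance ξ 1 x), |f (x k)| :=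
        Finset.abs_sum_le_sum_abs _ _
    _ ≤ ∑ k ∈ Finset.range (entrance ξ 1 x), ‖f‖ :=
        Finset.sum_le_sum fun k _ => norm_le_pi_norm f (x k)
    _ = entrance ξ 1 x * ‖f‖ := by simp
    _ ≤ l * ‖f‖ := mul_le_mul_of_nonneg_right (by exact_mod_cast h1.le.trans h2) (norm_nonneg _)

theorem summable_cocycle (h : IsAperiodic ξ) (hx : x ∈ Omega ξ) {v : A → ℝ}
    (hv : IsDecaying ξ v) :
    Summable fun j => entranceSum ξ ((transposeMap ξ ^ j) v) ((desub ξ)^[j] x) := by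
  obtain ⟨l, -, hl⟩ := exists_abs_entranceSum_le h
  exact Summable.of_norm_bounded ((Module.End.summable_norm_of_tendsto _ hv).mul_left l)
    fun j => hl _ (desub_iterate_mem h hx j) _

/-- The self-similarity of the series, from which the cocycle equation and the affine structure of
the image follow. -/
theorem cocycle_eq (h : IsAperiodic ξ) (hx : x ∈ Omega ξ) {v : A → ℝ} (hv : IsDecaying ξ v) :
    cocycle ξ v x = entranceSum ξ v x + cocycle ξ (transposeMap ξ v) (desub ξ x) := by
  rw [cocycle, (summable_cocycle h hx hv).tsum_eq_zero_add]
  congr 1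

theorem exists_abs_cocycle_le (h : IsAperiodic ξ) : ∃ l : ℝ, 0 ≤ l ∧
    ∀ x ∈ Omega ξ, ∀ v : A → ℝ, IsDecaying ξ v →
      |cocycle ξ v x| ≤ l * ∑' j, ‖(transposeMap ξ ^ j) v‖ := by
  obtain ⟨l, hl0, hl⟩ := exists_abs_entranceSum_le h
  refine ⟨l, hl0, fun x hx v hv => ?_⟩
  rw [← tsum_mul_left]
  exact tsum_of_norm_bounded
    (f := fun j => entranceSum ξ ((transposeMap ξ ^ j) v) ((desub ξ)^[j] x)) ((Module.End.summable_norm_of_tendsto _ hv).mul_left l).hasSum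
    fun j => hl _ (desub_iterate_mem h hx j) _

theorem shift_eq (x : ℤ → A) : shift x = fun t => x (t + 1) := rfl

theorem shift_mem (hx : x ∈ Omega ξ) : shift x ∈ Omega ξ := comp_add_mem_Omega hx 1

/-- Either the origin stays before the same first cut, or it was a cut and the whole word ξ(y_0)
except its first letter comes next. -/
theorem entrance_shift (h : IsAperiodic ξ) (hx : x ∈ Omega ξ) (v : A → ℝ) :
    (desub ξ (shift x) = desub ξ x ∧ entranceSum ξ v (shift x) = entranceSum ξ v x - v (x 0)) ∨
    (desub ξ (shift x) = shift (desub ξ x) ∧ entranceSum ξ v x = 0 ∧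
      entranceSum ξ v (shift x) = transposeMap ξ v (desub ξ x 0) - v (x 0)) := by
  obtain ⟨hy, c, hc, h1, h0⟩ := desub_spec h hx
  set y := desub ξ x
  have hc1 := hc.comp_add 1
  by_cases hpos : 0 < entrance ξ 1 x
  · left
    have e1 : c (-1) - 1 < 0 := by omega
    have e0 : 0 ≤ c 0 - 1 := by omega
    refine ⟨desub_eq h hy hc1 e1 e0, ?_⟩
    have h2 := entrance_one h hy hc1 e1 e0
    obtain ⟨m, hm⟩ := Nat.exists_eq_succ_of_ne_zero hpos.ne'
    have h3 : entrance ξ 1 (shift x) = m := by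
      rw [shift_eq]; omega
    rw [entranceSum, entranceSum, h3, hm, Finset.sum_range_succ']
    simp [shift]
  · right
    have hz : entrance ξ 1 x = 0 := by omega
    have hc2 := hc1.reindex 1
    have hst := hc.step 0
    have hlen := length_iter_pos h.ne_nil 1 (y 0)
    rw [zero_add] at hst
    have e1 : c (-1 + 1) - 1 < 0 := by rw [neg_add_cancel]; omega
    have e0 : 0 ≤ c (0 + 1) - 1 := by rw [zero_add]; omega
    refine ⟨desub_eq h (shift_mem hy) hc2 e1 e0, by rw [entranceSum, hz]; simp, ?_⟩
    have h2 := entrance_one h (shift_mem hy) hc2 e1 e0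
    rw [zero_add] at h2
    have h3 := (hc.reads 0).sum_eq v
    rw [h0, hz, iter_one] at h3
    rw [iter_one] at hst hlen
    rw [transposeMap_apply, ← h3]
    obtain ⟨m, hm⟩ := Nat.exists_eq_succ_of_ne_zero hlen.ne'
    have h4 : entrance ξ 1 (shift x) = m := by
      rw [shift_eq]; omega
    rw [entranceSum, h4, hm, Finset.sum_range_succ']
    simp [shift]

/-- The cocycle equation. -/
theorem cocycle_shift (h : IsAperiodic ξ) (hx : x ∈ Omega ξ) {v : A → ℝ} (hv : IsDecaying ξ v) :
    cocycle ξ v (shift x) = cocycle ξ v x - v (x 0) := by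
  obtain ⟨l, hl0, hl⟩ := exists_abs_cocycle_le h
  -- The defect of the equation vanishes in the first case and is handed over to `T v` and the
  -- desubstitution in the second. Repeated, it is bounded by tails that tend to `0`.
  have hrec : ∀ {x : ℤ → A} {v : A → ℝ}, x ∈ Omega ξ → IsDecaying ξ v →
      |cocycle ξ v (shift x) - cocycle ξ v x + v (x 0)| ≤
        |cocycle ξ (transposeMap ξ v) (shift (desub ξ x)) - cocycle ξ (transposeMap ξ v) (desub ξ x) +
          transposeMap ξ v (desub ξ x 0)| := by
    intro x v hx hv
    rw [cocycle_eq h hx hv, cocycle_eq h (shift_mem hx) hv]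
    rcases entrance_shift h hx v with ⟨h1, h2⟩ | ⟨h1, h2, h3⟩
    · rw [h1, h2]
      ring_nf
      simp
    · rw [h1, h2, h3]
      refine le_of_eq ?_
      congr 1
      ring
  have hiter : ∀ (k : ℕ) {x : ℤ → A} {v : A → ℝ}, x ∈ Omega ξ → IsDecaying ξ v →
      |cocycle ξ v (shift x) - cocycle ξ v x + v (x 0)| ≤
        2 * (l * ∑' j, ‖(transposeMap ξ ^ (j + k)) v‖) + ‖(transposeMap ξ ^ k) v‖ := by
    intro k
    induction k with
    | zero =>
      intro x v hx hv
      have h1 := abs_le.1 (hl _ (shift_mem hx) v hv)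
      have h2 := abs_le.1 (hl _ hx v hv)
      have h3 := abs_le.1 (norm_le_pi_norm v (x 0))
      simp only [add_zero, pow_zero, Module.End.one_apply]
      rw [abs_le]
      constructor <;> linarith
    | succ k ih =>
      intro x v hx hv
      refine (hrec hx hv).trans ((ih (desub_mem h hx) hv.transposeMap).trans_eq ?_)
      simp only [← Module.End.mul_apply, ← pow_succ, add_assoc]
  have hlim : Tendsto (fun k => 2 * (l * ∑' j, ‖(transposeMap ξ ^ (j + k)) v‖) +
      ‖(transposeMap ξ ^ k) v‖) atTop (𝓝 (2 * (l * 0) + ‖(0 : A → ℝ)‖)) :=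
    (((tendsto_sum_nat_add fun k => ‖(transposeMap ξ ^ k) v‖).const_mul l).const_mul 2).add hv.norm
  simp only [mul_zero, norm_zero, add_zero] at hlim
  have := ge_of_tendsto' hlim fun k => hiter k hx hv
  have := abs_nonpos_iff.1 this
  linarith

theorem cocycle_sum (h : IsAperiodic ξ) (hx : x ∈ Omega ξ) {ι : Type*} (s : Finset ι) (r : ι → ℝ)
    {v : ι → A → ℝ} (hv : ∀ i ∈ s, IsDecaying ξ (v i)) :
    cocycle ξ (∑ i ∈ s, r i • v i) x = ∑ i ∈ s, r i * cocycle ξ (v i) x := by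
  simp only [cocycle, ← tsum_mul_left]
  rw [← Summable.tsum_finsetSum fun i hi => (summable_cocycle h hx (hv i hi)).mul_left _]
  refine tsum_congr fun j => ?_
  simp only [entranceSum, Finset.mul_sum, map_sum, map_smul, Finset.sum_apply, Pi.smul_apply,
    smul_eq_mul]
  exact Finset.sum_comm

end Cocycle

/-! ### Continuity -/

section Continuity

variable {A : Type*} [TopologicalSpace A] [DiscreteTopology A] [Finite A] {ξ : A → List A}

/-- The inverse map, which sends `(y, k)` to a translate of ξ(y), is a continuous bijection from a
compact space onto a Hausdorff one. -/
theorem continuousOn_desub_entrance (h : IsAperiodic ξ) :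
    ContinuousOn (fun x => (desub ξ x, entrance ξ 1 x)) (Omega ξ) := by
  let K : Set ((ℤ → A) × ℕ) := {p | p.1 ∈ Omega ξ ∧ p.2 < (ξ (p.1 (-1))).length}
  obtain ⟨l, hl⟩ := exists_length_le ξ 1
  have hcl : IsClosed K := by
    refine ((isClosed_Omega ξ).preimage continuous_fst).inter ?_
    let _ : TopologicalSpace (List A) := ⊥
    have hc : Continuous fun p : (ℤ → A) × ℕ => (p.2, (ξ (p.1 (-1))).length) := by
      refine continuous_snd.prodMk ?_
      exact (continuous_of_discreteTopology (f := fun a => (ξ a).length)).comp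
        ((continuous_apply (-1 : ℤ)).comp continuous_fst)
    exact (isClosed_discrete {q : ℕ × ℕ | q.1 < q.2}).preimage hc
  have hK : IsCompact K := by
    refine (((isClosed_Omega ξ).isCompact).prod (Set.finite_Iic l).isCompact).of_isClosed_subset hcl ?_
    rintro ⟨y, k⟩ ⟨hy, hk⟩
    refine ⟨hy, ?_⟩
    have := hl (y (-1))
    rw [iter_one] at this
    simp only [Set.mem_Iic] at *
    omega
  have : CompactSpace K := isCompact_iff_compactSpace.1 hK
  have hpre : ∀ p : K, (fun t => extend ξ p.1.1 (t + -p.1.2)) ∈ Omega ξ ∧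
      entrance ξ 1 (fun t => extend ξ p.1.1 (t + -p.1.2)) = p.1.2 ∧
      desub ξ (fun t => extend ξ p.1.1 (t + -p.1.2)) = p.1.1 := fun p => by
    obtain ⟨x, hx, h1, h2, rfl⟩ := exists_of_desub h p.2.1 p.2.2
    exact ⟨hx, h1, h2⟩
  let e : K ≃ Omega ξ :=
    { toFun := fun p => ⟨_, (hpre p).1⟩
      invFun := fun x => ⟨(desub ξ x, entrance ξ 1 x), desub_mem h x.2, entrance_one_lt h x.2⟩
      left_inv := fun p => Subtype.ext (Prod.ext (hpre p).2.2 (hpre p).2.1)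
      right_inv := fun x => by
        obtain ⟨-, c, hc, -, h0⟩ := desub_spec h x.2
        have := hc.extend_translate h 0
        simp only [add_zero] at this
        refine Subtype.ext (funext fun t => ?_)
        simp only [this, h0]
        exact congrArg x.1 (by ring) }
  have he : Continuous e := by
    refine Continuous.subtype_mk ?_ _
    have hcont : Continuous fun p : (ℤ → A) × ℕ => (fun t : ℤ => extend ξ p.1 (t + -p.2)) := by
      refine continuous_prod_of_discrete_right.2 fun k => ?_
      exact (continuous_translate (-(k : ℤ))).comp (continuous_extend ξ)
    exact hcont.comp continuous_subtype_val
  rw [continuousOn_iff_continuous_domRestrict]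
  exact continuous_subtype_val.comp he.continuous_symm_of_equiv_compact_to_t2

theorem continuousOn_desub_iterate (h : IsAperiodic ξ) (j : ℕ) :
    ContinuousOn ((desub ξ)^[j]) (Omega ξ) := by
  induction j with
  | zero => exact continuousOn_id
  | succ j ih =>
    rw [Function.iterate_succ']
    exact ((continuous_fst.comp_continuousOn (continuousOn_desub_entrance h))).comp ih
      fun x hx => desub_iterate_mem h hx j

theorem continuousOn_entranceSum (h : IsAperiodic ξ) (f : A → ℝ) :
    ContinuousOn (entranceSum ξ f) (Omega ξ) := by
  have h1 : Continuous fun p : (ℤ → A) × ℕ => ∑ k ∈ Finset.range p.2, f (p.1 k) := by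
    refine continuous_prod_of_discrete_right.2 fun k => ?_
    change Continuous fun x : ℤ → A => ∑ i ∈ Finset.range k, f (x i)
    refine continuous_finsetSum _ fun i _ => ?_
    exact (continuous_of_discreteTopology (f := f)).comp (continuous_apply (i : ℤ))
  exact h1.comp_continuousOn
    (continuousOn_id.prodMk (continuous_snd.comp_continuousOn (continuousOn_desub_entrance h)))

end Continuity

theorem continuousOn_cocycle {A : Type*} [TopologicalSpace A] [DiscreteTopology A] [Fintype A]
    [DecidableEq A] {ξ : A → List A} (h : IsAperiodic ξ) {v : A → ℝ} (hv : IsDecaying ξ v) :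
    ContinuousOn (cocycle ξ v) (Omega ξ) := by
  obtain ⟨l, -, hl⟩ := exists_abs_entranceSum_le h
  exact continuousOn_tsum (fun j => (continuousOn_entranceSum h _).comp
    (continuousOn_desub_iterate h j) fun x hx => desub_iterate_mem h hx j)
    ((Module.End.summable_norm_of_tendsto _ hv).mul_left l)
    fun j x hx => hl _ (desub_iterate_mem h hx j) _

end Subst

/-! ### Irrational translations and fibres over the torus -/

section Torus

variable {n : ℕ}

/-- The fundamental cube `(0, 1]ⁿ`. -/
def unitCube (n : ℕ) : Set (Fin n → ℝ) := Set.univ.pi fun _ => Set.Ioc 0 1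

theorem measurableSet_unitCube : MeasurableSet (unitCube n) :=
  MeasurableSet.univ_pi fun _ => measurableSet_Ioc

theorem continuous_torusProj : Continuous (torusProj (n := n)) :=
  continuous_pi fun i => (AddCircle.continuous_mk' 1).comp (continuous_apply i)

theorem measurePreserving_torusProj :
    MeasurePreserving (torusProj (n := n)) (volume.restrict (unitCube n)) volume := by
  have h := measurePreserving_pi (fun _ : Fin n => (volume : Measure ℝ).restrict (Set.Ioc 0 (0 + 1)))
    (fun _ : Fin n => (volume : Measure UnitAddCircle))
    fun _ => AddCircle.measurePreserving_mk 1 0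
  rw [← Measure.restrict_pi_pi, zero_add] at h
  exact h

theorem volume_unitCube : volume (unitCube n) = 1 := by
  rw [unitCube, Real.volume_pi_Ioc]
  simp

instance isProbabilityMeasure_torus : IsProbabilityMeasure (volume : Measure (Fin n → UnitAddCircle)) := by
  constructor
  rw [← measurePreserving_torusProj.measure_preimage MeasurableSet.univ.nullMeasurableSet]
  simp [volume_unitCube]

theorem torusProj_add (y z : Fin n → ℝ) : torusProj (y + z) = torusProj y + torusProj z := rfl

theorem torusProj_sub (y z : Fin n → ℝ) : torusProj (y - z) = torusProj y - torusProj z := rfl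

theorem torusProj_intCast (m : Fin n → ℤ) : torusProj (fun i => (m i : ℝ)) = 0 := by
  funext i
  exact (AddCircle.coe_eq_zero_iff 1).2 ⟨m i, by simp⟩

theorem torusProj_eq_iff {y z : Fin n → ℝ} :
    torusProj y = torusProj z ↔ ∃ m : Fin n → ℤ, y = fun i => z i + m i := by
  constructor
  · intro h
    have h1 : ∀ i, ∃ m : ℤ, (m : ℝ) = y i - z i := fun i => by
      have := congrFun h i
      simpa using (AddCircle.coe_eq_zero_iff 1).1 (show ((y i - z i : ℝ) : UnitAddCircle) = 0 by
        rw [AddCircle.coe_sub]; exact sub_eq_zero.2 this)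
    choose m hm using h1
    exact ⟨m, funext fun i => by rw [hm]; ring⟩
  · rintro ⟨m, rfl⟩
    have := torusProj_add z fun i => (m i : ℝ)
    rw [torusProj_intCast, add_zero] at this
    exact this

theorem mFourier_add_apply (k : Fin n → ℤ) (x a : Fin n → UnitAddCircle) :
    UnitAddTorus.mFourier k (x + a) = UnitAddTorus.mFourier k x * UnitAddTorus.mFourier k a := by
  simp only [UnitAddTorus.mFourier, ContinuousMap.coe_mk, Pi.add_apply, ← Finset.prod_mul_distrib]
  refine Finset.prod_congr rfl fun i _ => ?_
  rw [fourier_apply, fourier_apply, fourier_apply, smul_add, AddCircle.toCircle_add, Circle.coe_mul]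

theorem mFourier_torusProj_ne_one {α : Fin n → ℝ}
    (hα : LinearIndependent ℚ (Fin.cons 1 α : Fin (n + 1) → ℝ)) {k : Fin n → ℤ} (hk : k ≠ 0) :
    UnitAddTorus.mFourier k (torusProj α) ≠ 1 := by
  intro h
  have h1 : UnitAddTorus.mFourier k (torusProj α) =
      Complex.exp (2 * Real.pi * Complex.I * (∑ i, k i * α i : ℝ)) := by
    simp only [UnitAddTorus.mFourier, ContinuousMap.coe_mk, torusProj, fourier_coe_apply]
    rw [← Complex.exp_sum]
    congr 1
    push_cast
    rw [Finset.mul_sum]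
    refine Finset.sum_congr rfl fun i _ => ?_
    ring
  rw [h1, Complex.exp_eq_one_iff] at h
  obtain ⟨m, hm⟩ := h
  have h2 : (∑ i, k i * α i : ℝ) = m := by
    have : (2 * Real.pi * Complex.I) ≠ 0 := by simp [Real.pi_ne_zero]
    rw [mul_comm] at hm
    exact_mod_cast mul_right_cancel₀ this hm
  have h3 := Fintype.linearIndependent_iff.1 hα (Fin.cons (-(m : ℚ)) fun i => (k i : ℚ)) (by
    rw [Fin.sum_univ_succ]
    simp only [Fin.cons_zero, Fin.cons_succ, Rat.smul_def]
    push_cast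
    linarith)
  refine hk (funext fun i => ?_)
  have := h3 i.succ
  simpa using this

/-- Two finite measures of the same mass that are invariant under an irrational translation of the
torus are equal. -/
theorem eq_of_invariant {α : Fin n → ℝ}
    (hα : LinearIndependent ℚ (Fin.cons 1 α : Fin (n + 1) → ℝ))
    {ν ν' : Measure (Fin n → UnitAddCircle)} [IsFiniteMeasure ν] [IsFiniteMeasure ν']
    (hν : MeasurePreserving (fun t => t - torusProj α) ν ν)
    (hν' : MeasurePreserving (fun t => t - torusProj α) ν' ν') (hm : ν Set.univ = ν' Set.univ) :
    ν = ν' := by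
  have hI : ∀ {ν : Measure (Fin n → UnitAddCircle)} [IsFiniteMeasure ν]
      (f : C(Fin n → UnitAddCircle, ℂ)), Integrable f ν := fun f =>
    (BoundedContinuousFunction.mkOfCompact f).integrable _
  -- Invariance multiplies a Fourier coefficient by a number other than `1` when `k ≠ 0`;
  -- trigonometric polynomials being dense, the total mass determines the measure.
  have hzero : ∀ {ν : Measure (Fin n → UnitAddCircle)} [IsFiniteMeasure ν],
      MeasurePreserving (fun t => t - torusProj α) ν ν → ∀ {k : Fin n → ℤ}, k ≠ 0 →
      ∫ t, UnitAddTorus.mFourier k t ∂ν = 0 := by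
    intro ν _ hν k hk
    have h1 : ∫ t, UnitAddTorus.mFourier k (t - torusProj α) ∂ν =
        ∫ t, UnitAddTorus.mFourier k t ∂ν := by
      conv_rhs => rw [← hν.map_eq]
      exact (integral_map hν.measurable.aemeasurable
        (UnitAddTorus.mFourier k).continuous.aestronglyMeasurable).symm
    have h2 : ∫ t, UnitAddTorus.mFourier k t ∂ν =
        (∫ t, UnitAddTorus.mFourier k (t - torusProj α) ∂ν) *
          UnitAddTorus.mFourier k (torusProj α) := by
      rw [← integral_mul_const]
      refine integral_congr_ae (.of_forall fun t => ?_)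
      dsimp only
      rw [← mFourier_add_apply, sub_add_cancel]
    rw [h1] at h2
    by_contra hne
    exact mFourier_torusProj_ne_one hα hk (mul_left_cancel₀ hne (by rw [← h2, mul_one]))
  let L : Measure (Fin n → UnitAddCircle) → C(Fin n → UnitAddCircle, ℂ) → ℂ := fun ν f => ∫ t, f t ∂ν
  have hcont : ∀ {ν : Measure (Fin n → UnitAddCircle)} [IsFiniteMeasure ν], Continuous (L ν) := by
    intro ν _
    refine Metric.continuous_iff.2 fun f ε hε => ⟨ε / (ν.real Set.univ + 1), by positivity, fun g hg => ?_⟩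
    rw [dist_eq_norm, ← integral_sub (hI g) (hI f)]
    refine (norm_integral_le_of_norm_le_const (.of_forall fun t => ?_)).trans_lt
      (?_ : dist g f * ν.real Set.univ < ε)
    · rw [← dist_eq_norm]; exact ContinuousMap.dist_apply_le_dist t
    · have h0 : 0 ≤ ν.real Set.univ := measureReal_nonneg
      rw [lt_div_iff₀ (by positivity)] at hg
      nlinarith [dist_nonneg (x := g) (y := f)]
  have hall : ∀ f : C(Fin n → UnitAddCircle, ℂ), L ν f = L ν' f := by
    intro f
    have hcl : IsClosed {f | L ν f = L ν' f} := isClosed_eq hcont hcont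
    have hf : f ∈ (Submodule.span ℂ (Set.range (UnitAddTorus.mFourier (d := Fin n)))).topologicalClosure := by
      rw [UnitAddTorus.span_mFourier_closure_eq_top]; trivial
    refine closure_minimal (fun g hg => ?_) hcl hf
    induction hg using Submodule.span_induction with
    | mem g hg =>
      obtain ⟨k, rfl⟩ := hg
      by_cases hk : k = 0
      · subst hk
        simp only [L, UnitAddTorus.mFourier_zero, ContinuousMap.one_apply, Set.mem_ofPred_eq,
          integral_const, Measure.real, hm]
      · simp only [L, Set.mem_ofPred_eq, hzero hν hk, hzero hν' hk]
    | zero => simp [L]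
    | add g g' _ _ h h' =>
      simp only [L, Set.mem_ofPred_eq, ContinuousMap.add_apply] at h h' ⊢
      rw [integral_add (hI g) (hI g'), integral_add (hI g) (hI g'), h, h']
    | smul c g _ h =>
      simp only [L, Set.mem_ofPred_eq, ContinuousMap.smul_apply] at h ⊢
      rw [integral_smul, integral_smul, h]
  refine ext_of_forall_integral_eq_of_IsFiniteMeasure fun f => ?_
  have := hall ⟨fun t => (f t : ℂ), by fun_prop⟩
  simp only [L, ContinuousMap.coe_mk, integral_complex_ofReal] at this
  exact_mod_cast this

theorem measurePreserving_sub_torus (a : Fin n → UnitAddCircle) :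
    MeasurePreserving (fun t => t - a) (volume : Measure (Fin n → UnitAddCircle)) volume :=
  measurePreserving_pi _ _ fun i => measurePreserving_sub_right volume (a i)

/-- The restriction of the volume to an invariant set `s` is invariant, hence a multiple of the
volume; evaluate both on the complement of `s`. -/
theorem ergodic_sub_torusProj {α : Fin n → ℝ}
    (hα : LinearIndependent ℚ (Fin.cons 1 α : Fin (n + 1) → ℝ)) :
    Ergodic (fun t => t - torusProj α) (volume : Measure (Fin n → UnitAddCircle)) := by
  have hmp := measurePreserving_sub_torus (torusProj α)
  refine ⟨hmp, ⟨fun {s} hs hinv => ?_⟩⟩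
  have h1 := hmp.restrict_preimage hs
  rw [hinv] at h1
  have h2 : MeasurePreserving (fun t => t - torusProj α)
      (volume s • (volume : Measure (Fin n → UnitAddCircle))) (volume s • volume) :=
    ⟨hmp.measurable, by rw [Measure.map_smul, hmp.map_eq]⟩
  have _ : IsFiniteMeasure (volume s • (volume : Measure (Fin n → UnitAddCircle))) :=
    Measure.smul_finite _ (measure_ne_top _ _)
  have h3 := eq_of_invariant hα h1 h2 (by simp)
  have h4 := congrFun (congrArg DFunLike.coe h3) sᶜ
  rw [Measure.restrict_apply hs.compl, Set.compl_inter_self, measure_empty, Measure.smul_apply,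
    smul_eq_mul, eq_comm, mul_eq_zero] at h4
  rw [eventuallyConst_set']
  rcases h4 with h4 | h4
  · exact .inl (ae_eq_empty.2 h4)
  · exact .inr (ae_eq_univ.2 h4)

/-- The representative in the unit cube of a point of the torus. -/
noncomputable def torusLift (t : Fin n → UnitAddCircle) : Fin n → ℝ :=
  fun i => (AddCircle.measurableEquivIoc 1 0 (t i) : ℝ)

theorem measurable_torusLift : Measurable (torusLift (n := n)) :=
  measurable_pi_lambda _ fun i => measurable_subtype_coe.comp
    ((AddCircle.measurableEquivIoc 1 0).measurable.comp (measurable_pi_apply i))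

theorem torusProj_torusLift (t : Fin n → UnitAddCircle) : torusProj (torusLift t) = t :=
  funext fun i => (AddCircle.measurableEquivIoc 1 0).symm_apply_apply (t i)

theorem encard_fibre_eq_tsum (K : Set (Fin n → ℝ)) (y : Fin n → ℝ) :
    (({z ∈ K | torusProj z = torusProj y}.encard : ℕ∞) : ENNReal) =
      ∑' m : Fin n → ℤ, K.indicator 1 (fun i => y i + m i) := by
  have hinj : Function.Injective fun (m : Fin n → ℤ) (i : Fin n) => y i + (m i : ℝ) := by
    intro m m' h
    funext i
    simpa using congrFun h i
  have h1 : {z ∈ K | torusProj z = torusProj y} =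
      (fun (m : Fin n → ℤ) (i : Fin n) => y i + (m i : ℝ)) ''
        {m | (fun i => y i + (m i : ℝ)) ∈ K} := by
    ext z
    constructor
    · rintro ⟨hz, h⟩
      obtain ⟨m, rfl⟩ := torusProj_eq_iff.1 h
      exact ⟨m, hz, rfl⟩
    · rintro ⟨m, hm, rfl⟩
      exact ⟨hm, torusProj_eq_iff.2 ⟨m, rfl⟩⟩
  rw [h1, hinj.encard_image, ← ENNReal.tsum_set_one, tsum_subtype _ (fun _ => (1 : ENNReal))]
  rfl

theorem measurable_encard_fibre {K : Set (Fin n → ℝ)} (hK : MeasurableSet K) :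
    Measurable fun t => (({z ∈ K | torusProj z = t}.encard : ℕ∞) : ENNReal) := by
  have h : (fun t => (({z ∈ K | torusProj z = t}.encard : ℕ∞) : ENNReal)) =
      fun t => ∑' m : Fin n → ℤ, K.indicator 1 (fun i => torusLift t i + m i) := by
    funext t
    rw [← encard_fibre_eq_tsum, torusProj_torusLift]
  rw [h]
  refine Measurable.tsum fun m => (measurable_one.indicator hK).comp ?_
  exact measurable_pi_lambda _ fun i =>
    ((measurable_pi_apply i).comp measurable_torusLift).add_const _

/-- The measure of a set is the mean number of its points above a point of the torus. -/
theorem lintegral_encard_fibre {K : Set (Fin n → ℝ)} (hK : MeasurableSet K) :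
    ∫⁻ t, (({z ∈ K | torusProj z = t}.encard : ℕ∞) : ENNReal) = volume K := by
  rw [← measurePreserving_torusProj.lintegral_comp (measurable_encard_fibre hK)]
  simp only [encard_fibre_eq_tsum]
  let τ : (Fin n → ℤ) → (Fin n → ℝ) → Fin n → ℝ := fun m y => y + fun i => (m i : ℝ)
  have hτ : ∀ m, MeasurePreserving (τ m) := fun m => measurePreserving_add_right volume _
  have hτi : ∀ m, Function.Injective (τ m) := fun m => add_left_injective _
  refine (lintegral_tsum (f := fun m y => K.indicator 1 (τ m y)) fun m =>
    ((measurable_one.indicator hK).comp (hτ m).measurable).aemeasurable).trans ?_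
  have h1 : ∀ m, ∫⁻ y in unitCube n, K.indicator (1 : (Fin n → ℝ) → ENNReal) (τ m y) =
      volume (K ∩ τ m '' unitCube n) := by
    intro m
    have h2 : MeasurableSet (τ m '' unitCube n) :=
      (MeasurableEquiv.addRight (fun i => (m i : ℝ))).measurableSet_image.2 measurableSet_unitCube
    have h3 : (fun y : Fin n → ℝ => K.indicator (1 : (Fin n → ℝ) → ENNReal) (τ m y)) =
        (τ m ⁻¹' K).indicator 1 := rfl
    rw [h3, lintegral_indicator_one ((hτ m).measurable hK),
      Measure.restrict_apply ((hτ m).measurable hK),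
      ← (hτ m).measure_preimage (hK.inter h2).nullMeasurableSet, Set.preimage_inter,
      Set.preimage_image_eq _ (hτi m)]
  -- The integer translates of the cube tile the space; as the sides are (0, 1], the tile of a point
  -- is found by the ceiling.
  have hmem : ∀ m z, z ∈ τ m '' unitCube n ↔ ∀ i, m i = ⌈z i⌉ - 1 := by
    intro m z
    constructor
    · rintro ⟨y, hy, rfl⟩ i
      have h := hy i trivial
      have : ⌈y i⌉ = 1 := by
        rw [Int.ceil_eq_iff]; simpa using h
      simp [τ, this]
    · intro h
      refine ⟨fun i => z i - m i, fun i _ => ?_, funext fun i => by simp [τ]⟩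
      have h1 := Int.le_ceil (z i)
      have h2 := Int.ceil_lt_add_one (z i)
      show z i - (m i : ℝ) ∈ Set.Ioc 0 1
      rw [h i]
      push_cast
      constructor <;> linarith
  simp only [h1]
  rw [← measure_iUnion]
  · congr 1
    rw [← Set.inter_iUnion, Set.inter_eq_left]
    exact fun z _ => Set.mem_iUnion.2 ⟨fun i => ⌈z i⌉ - 1, (hmem _ _).2 fun _ => rfl⟩
  · intro m m' hne
    refine Set.disjoint_left.2 fun z hz hz' => hne (funext fun i => ?_)
    rw [(hmem _ _).1 hz.2 i, (hmem _ _).1 hz'.2 i]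
  · exact fun m => hK.inter ((MeasurableEquiv.addRight (fun i => (m i : ℝ))).measurableSet_image.2
      measurableSet_unitCube)

/-- For a measurable null superset the number of points above `t` has integral zero, so almost every
fibre is empty. -/
theorem volume_torusProj_image_eq_zero {N : Set (Fin n → ℝ)} (hN : volume N = 0) :
    volume (torusProj '' N) = 0 := by
  obtain ⟨N', hNN', hm, h0⟩ := exists_measurable_superset_of_null hN
  have h := lintegral_encard_fibre hm
  rw [h0, lintegral_eq_zero_iff (measurable_encard_fibre hm)] at h
  refine measure_mono_null (fun t ht => ?_) h
  obtain ⟨y, hy, rfl⟩ := ht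
  intro h
  have h2 : {z ∈ N' | torusProj z = torusProj y}.encard = 0 := by
    simpa using h
  rw [Set.encard_eq_zero] at h2
  exact h2.subset ⟨hNN' hy, rfl⟩

end Torus

/-! ### Null overlaps in graph-directed affine systems -/

section Overlap

/-- The union is covered after removing from `s i` its overlap with `s j`, so a positive overlap
would make the union strictly smaller than the sum. -/
theorem MeasureTheory.measure_inter_eq_zero_of_sum_le {X ι : Type*} [MeasurableSpace X]
    {μ : Measure X} {s : ι → Set X} {I : Finset ι} (hs : ∀ i ∈ I, MeasurableSet (s i))
    (hfin : ∀ i ∈ I, μ (s i) ≠ ⊤)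
    (hle : ∑ i ∈ I, μ.real (s i) ≤ μ.real (⋃ i ∈ I, s i)) {i j : ι} (hi : i ∈ I) (hj : j ∈ I)
    (hij : i ≠ j) : μ (s i ∩ s j) = 0 := by
  classical
  have h1 : (⋃ k ∈ I, s k) ⊆ (⋃ k ∈ I.erase i, s k) ∪ (s i \ s j) := by
    intro x hx
    obtain ⟨k, hk, hxk⟩ := Set.mem_iUnion₂.1 hx
    by_cases hxj : x ∈ s j
    · exact .inl (Set.mem_iUnion₂.2 ⟨j, Finset.mem_erase.2 ⟨hij.symm, hj⟩, hxj⟩)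
    · by_cases hki : k = i
      · subst hki; exact .inr ⟨hxk, hxj⟩
      · exact .inl (Set.mem_iUnion₂.2 ⟨k, Finset.mem_erase.2 ⟨hki, hk⟩, hxk⟩)
  have hfin' : μ (s i \ s j) ≠ ⊤ := measure_ne_top_of_subset Set.sdiff_subset (hfin i hi)
  have hU : μ (⋃ k ∈ I.erase i, s k) ≠ ⊤ :=
    (measure_biUnion_lt_top (I.erase i).finite_toSet fun k hk =>
      (hfin k (Finset.mem_of_mem_erase hk)).lt_top).ne
  have h2 : μ.real (⋃ k ∈ I, s k) ≤ ∑ k ∈ I.erase i, μ.real (s k) + μ.real (s i \ s j) :=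
    (measureReal_mono h1 (measure_union_lt_top hU.lt_top hfin'.lt_top).ne).trans
      ((measureReal_union_le _ _).trans
        (add_le_add_left (measureReal_biUnion_finset_le _ _) _))
  rw [← Finset.add_sum_erase I _ hi] at hle
  have h3 := measureReal_inter_add_sdiff (s := s i) (hs j hj) (hfin i hi)
  have h4 : μ.real (s i ∩ s j) = 0 := le_antisymm (by linarith) measureReal_nonneg
  exact (measureReal_eq_zero_iff (measure_ne_top_of_subset Set.inter_subset_left (hfin i hi))).1 h4

variable {n : ℕ}

/-- The affine map `y ↦ t + N y`. -/
def affineImage (N : Matrix (Fin n) (Fin n) ℝ) (t : Fin n → ℝ) (X : Set (Fin n → ℝ)) :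
    Set (Fin n → ℝ) := (fun y => t + N *ᵥ y) '' X

theorem volume_affineImage (N : Matrix (Fin n) (Fin n) ℝ) (t : Fin n → ℝ) (X : Set (Fin n → ℝ)) :
    volume (affineImage N t X) = ENNReal.ofReal |N.det| * volume X := by
  have h : affineImage N t X = (fun y => -t + y) ⁻¹' (Matrix.toLin' N '' X) := by
    ext y
    simp only [affineImage, Set.mem_image, Set.mem_preimage, Matrix.toLin'_apply]
    refine exists_congr fun x => and_congr_right fun _ => ?_
    rw [eq_neg_add_iff_add_eq]
  rw [h, measure_preimage_add, Measure.addHaar_image_linearMap, LinearMap.det_toLin']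

theorem IsCompact.affineImage {N : Matrix (Fin n) (Fin n) ℝ} {t : Fin n → ℝ}
    {X : Set (Fin n → ℝ)} (hX : IsCompact X) : IsCompact (affineImage N t X) :=
  hX.image (continuous_const.add (Continuous.matrix_mulVec continuous_const continuous_id))

/-- In a graph-directed system of affine maps, the images of compact sets that are covered by their
pieces overlap in null sets, when the contraction of volumes is balanced by the number of pieces. -/
theorem volume_affineImage_inter_eq_zero {A P : Type*} [Fintype A] [DecidableEq A] [Fintype P]
    {src letter : P → A} {N : Matrix (Fin n) (Fin n) ℝ} {t : P → Fin n → ℝ}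
    {R : A → Set (Fin n → ℝ)} (hR : ∀ a, IsCompact (R a))
    (hcover : ∀ a, R a ⊆ ⋃ p ∈ Finset.univ.filter fun p => letter p = a,
      affineImage N (t p) (R (src p)))
    {l : A → ℝ} (hl : ∀ a, 0 < l a)
    (hbal : ∀ b, |N.det| * ∑ p ∈ Finset.univ.filter (fun p => src p = b), l (letter p) = l b)
    {p q : P} (hpq : p ≠ q) (hletter : letter p = letter q) :
    volume (affineImage N (t p) (R (src p)) ∩ affineImage N (t q) (R (src q))) = 0 := by
  have hc : ∀ p, IsCompact (affineImage N (t p) (R (src p))) := fun p => (hR _).affineImage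
  have hvol : ∀ p, volume.real (affineImage N (t p) (R (src p))) =
      |N.det| * volume.real (R (src p)) := fun p => by
    rw [Measure.real, volume_affineImage, ENNReal.toReal_mul, ENNReal.toReal_ofReal (abs_nonneg _),
      Measure.real]
  have h1 : ∀ a, volume.real (R a) ≤
      volume.real (⋃ p ∈ Finset.univ.filter fun p => letter p = a,
        affineImage N (t p) (R (src p))) := fun a =>
    measureReal_mono (hcover a) (measure_biUnion_lt_top (Finset.finite_toSet _) fun p _ =>
      (hc p).measure_lt_top).ne
  have h2 : ∀ a, volume.real (⋃ p ∈ Finset.univ.filter fun p => letter p = a,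
        affineImage N (t p) (R (src p))) ≤
      ∑ p ∈ Finset.univ.filter fun p => letter p = a,
        volume.real (affineImage N (t p) (R (src p))) := fun a => measureReal_biUnion_finset_le _ _
  -- Regrouped by source, the weighted sum of the pieces equals that of the covered sets. The
  -- inequalities `h1` and `h2` are therefore equalities for every letter.
  have h3 : ∑ a, l a * ∑ p ∈ Finset.univ.filter (fun p => letter p = a),
        volume.real (affineImage N (t p) (R (src p))) = ∑ a, l a * volume.real (R a) := by
    simp only [Finset.mul_sum, hvol]
    have e1 : ∀ a, ∑ p ∈ Finset.univ.filter (fun p => letter p = a),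
        l a * (|N.det| * volume.real (R (src p))) =
        ∑ p ∈ Finset.univ.filter (fun p => letter p = a),
          l (letter p) * (|N.det| * volume.real (R (src p))) := fun a =>
      Finset.sum_congr rfl fun p hp => by rw [(Finset.mem_filter.1 hp).2]
    simp only [e1]
    rw [Finset.sum_fiberwise, ← Finset.sum_fiberwise _ src]
    refine Finset.sum_congr rfl fun b _ => ?_
    rw [← hbal b, Finset.mul_sum, Finset.sum_mul]
    refine Finset.sum_congr rfl fun p hp => ?_
    rw [(Finset.mem_filter.1 hp).2]
    ring
  have h4 : ∀ a, volume.real (R a) = ∑ p ∈ Finset.univ.filter (fun p => letter p = a),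
      volume.real (affineImage N (t p) (R (src p))) := by
    have := (Finset.sum_eq_sum_iff_of_le (s := Finset.univ) fun a _ =>
      mul_le_mul_of_nonneg_left ((h1 a).trans (h2 a)) (hl a).le).1 h3.symm
    exact fun a => mul_left_cancel₀ (hl a).ne' (this a (Finset.mem_univ a))
  refine measure_inter_eq_zero_of_sum_le (I := Finset.univ.filter fun p' => letter p' = letter q)
    (fun p _ => (hc p).measurableSet) (fun p _ => (hc p).measure_lt_top.ne)
    ((h4 _).symm.le.trans (h1 _)) ?_ ?_ hpq <;> simp [hletter]

theorem volume_setOf_sum_eq {g : Fin n → ℝ} (hg : g ≠ 0) (c : ℝ) :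
    volume {y : Fin n → ℝ | ∑ i, g i * y i = c} = 0 := by
  let L : (Fin n → ℝ) →ₗ[ℝ] ℝ := ∑ i, g i • LinearMap.proj i
  have hL : ∀ y, L y = ∑ i, g i * y i := fun y => by simp [L, LinearMap.sum_apply]
  by_cases hne : ∃ y, L y = c
  · obtain ⟨y₀, hy₀⟩ := hne
    have h : {y : Fin n → ℝ | ∑ i, g i * y i = c} = (fun y => -y₀ + y) ⁻¹' (LinearMap.ker L : Set (Fin n → ℝ)) := by
      ext y
      simp only [Set.mem_ofPred_eq, Set.mem_preimage, SetLike.mem_coe, LinearMap.mem_ker, map_add,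
        map_neg, hy₀, ← hL]
      rw [neg_add_eq_zero, eq_comm]
    rw [h, measure_preimage_add]
    refine Measure.addHaar_submodule _ _ fun htop => hg (funext fun i => ?_)
    have := LinearMap.ker_eq_top.1 htop
    have := LinearMap.congr_fun this (Pi.single i 1)
    rw [hL] at this
    simpa [Pi.single_apply] using this
  · convert measure_empty (μ := (volume : Measure (Fin n → ℝ)))
    refine Set.eq_empty_of_forall_notMem fun y hy => hne ⟨y, (hL y).trans hy⟩

end Overlap

namespace Subst

/-! ### Points determined by their positions at all levels -/

section Agreement

variable {A : Type*} [Finite A] {ξ : A → List A} {x x' : ℤ → A}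

/-- Properness gains a letter at each end: beyond the words known to agree, the next one on the
right has a fixed first letter and the next one on the left a fixed last letter. The window grows
even when words have length one. -/
theorem eq_on_of_desub_eq_on (h : IsAperiodic ξ) (hx : x ∈ Omega ξ) (hx' : x' ∈ Omega ξ)
    (he : entrance ξ 1 x = entrance ξ 1 x') {j : ℕ}
    (hy : ∀ t : ℤ, -1 - j ≤ t → t < j → desub ξ x t = desub ξ x' t) {t : ℤ}
    (ht : -2 - j ≤ t) (ht' : t ≤ j) (hj : desub ξ x (-1) = desub ξ x' (-1)) : x t = x' t := by
  obtain ⟨-, c, hc, hc1, hc0⟩ := desub_spec h hx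
  obtain ⟨-, c', hc', hc1', hc0'⟩ := desub_spec h hx'
  set y := desub ξ x
  set y' := desub ξ x'
  obtain ⟨⟨r₁, hr₁⟩, r₂, hr₂⟩ := h.proper
  have hm := hc.strictMono h.ne_nil
  have hpos : ∀ m : ℕ, (m : ℤ) ≤ j → c m = c' m ∧ (m : ℤ) ≤ c m := by
    intro m
    induction m with
    | zero => intro _; simp only [Nat.cast_zero]; omega
    | succ m ih =>
      intro hmj
      push_cast at hmj ⊢
      obtain ⟨h1, h2⟩ := ih (by omega)
      have h3 := hm (show (m : ℤ) < m + 1 by omega)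
      have := hc.step m
      have := hc'.step m
      rw [hy m (by omega) (by omega)] at *
      omega
  have hneg : ∀ m : ℕ, (m : ℤ) ≤ j → c (-1 - m) = c' (-1 - m) ∧ c (-1 - m) ≤ -1 - m := by
    intro m
    induction m with
    | zero =>
      intro _
      have h1 := hc.step (-1)
      have h2 := hc'.step (-1)
      rw [hj] at h1
      simp only [neg_add_cancel] at h1 h2
      simp only [Nat.cast_zero, sub_zero]
      omega
    | succ m ih =>
      intro hmj
      push_cast at hmj ⊢
      obtain ⟨h1, h2⟩ := ih (by omega)
      have h3 := hm (show (-1 - (m + 1) : ℤ) < -1 - m by omega)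
      have e1 := hc.step (-1 - (m + 1))
      have e2 := hc'.step (-1 - (m + 1))
      rw [hy (-1 - (m + 1)) (by omega) (by omega)] at e1
      rw [show (-1 - (m + 1) + 1 : ℤ) = -1 - m by ring] at e1 e2
      omega
  obtain ⟨i, hi, hi'⟩ := hc.exists_cell h.ne_nil t
  have hst := hc.step i
  have hread := hc.reads i
  rcases lt_or_ge i (-1 - (j : ℤ)) with hlt | hge
  · have h1 := hm.monotone (show i + 1 ≤ -1 - (j : ℤ) by omega)
    obtain ⟨h2, h3⟩ := hneg j le_rfl
    have hij : i = -2 - j := by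
      by_contra hne
      have := hm (show i + 1 < -1 - (j : ℤ) by omega)
      omega
    subst hij
    have key : ∀ {z w : ℤ → A} {d : ℤ → ℤ}, Str ξ 1 z d w → ∀ i, z (d (i + 1) - 1) = r₂ := by
      intro z w d hd i
      have h4 := hd.step i
      have h5 := length_iter_pos h.ne_nil 1 (w i)
      have h6 := (hd.reads i).getElem (k := (iter ξ 1 (w i)).length - 1) (by omega)
      have h7 := hr₂ (w i)
      simp only [iter_one] at h4 h5 h6
      rw [List.getLast?_eq_getElem?, List.getElem?_eq_getElem (by omega)] at h7
      rw [← Option.some_inj, ← h7, ← h6]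
      congr 2
      omega
    have h4 := key hc (-2 - j)
    have h5 := key hc' (-2 - j)
    rw [show (-2 - j + 1 : ℤ) = -1 - j by ring] at *
    rw [show t = c (-1 - j) - 1 by omega, h4, h2, h5]
  · rcases lt_or_ge i j with hlt' | hge'
    · have hcc : c i = c' i := by
        rcases lt_or_ge i 0 with h0 | h0
        · obtain ⟨m, hm⟩ := Int.eq_ofNat_of_zero_le (show 0 ≤ -1 - i by omega)
          rw [show i = -1 - (m : ℤ) by omega]
          exact (hneg m (by omega)).1
        · lift i to ℕ using h0
          exact (hpos i (by omega)).1
      have hread' := hc'.reads i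
      rw [← hy i hge hlt'] at hread'
      have := hread.eq_of_reads hread' (k := t - c i) (by omega) (by omega)
      rw [← hcc] at this
      simpa using this
    · obtain ⟨h2, h3⟩ := hpos j le_rfl
      have h4 := hm.monotone hge'
      have key : ∀ {z w : ℤ → A} {d : ℤ → ℤ}, Str ξ 1 z d w → ∀ i, z (d i) = r₁ := by
        intro z w d hd i
        have h5 := length_iter_pos h.ne_nil 1 (w i)
        have h6 := (hd.reads i).getElem (k := 0) (by omega)
        have h7 := hr₁ (w i)
        simp only [iter_one] at h5 h6
        rw [List.head?_eq_getElem?, List.getElem?_eq_getElem (by omega)] at h7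
        rw [← Option.some_inj, ← h7, ← h6]
        simp
      rw [show t = c j by omega, key hc, h2, key hc']

/-- A point of `Ω_ξ` is determined by its entrance times and the letters before the origin at all
levels. -/
theorem eq_of_forall_address_eq (h : IsAperiodic ξ) {Q : (ℤ → A) → (ℤ → A) → Prop}
    (hQ : ∀ x x', Q x x' → x ∈ Omega ξ ∧ x' ∈ Omega ξ ∧ x (-1) = x' (-1) ∧
      entrance ξ 1 x = entrance ξ 1 x' ∧ Q (desub ξ x) (desub ξ x')) (hxx : Q x x') : x = x' := by
  have key : ∀ j : ℕ, ∀ x x', Q x x' → ∀ t : ℤ, -1 - j ≤ t → t < j → x t = x' t := by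
    intro j
    induction j with
    | zero =>
      intro x x' hxx t ht ht'
      obtain rfl : t = -1 := by push_cast at *; omega
      exact (hQ x x' hxx).2.2.1
    | succ j ih =>
      intro x x' hxx t ht ht'
      obtain ⟨hx, hx', -, he, hq⟩ := hQ x x' hxx
      push_cast at ht ht'
      exact eq_on_of_desub_eq_on h hx hx' he (ih _ _ hq) (by omega) (by omega) (hQ _ _ hq).2.2.1
  funext t
  exact key (t.natAbs + 1) x x' hxx t (by omega) (by omega)

end Agreement

/-! ### The component in E⁰ and linear independence -/

section Nilpotent

variable {A : Type*} [Fintype A] [DecidableEq A] {ξ : A → List A}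

theorem finite_image_entranceSum (h : IsAperiodic ξ) (f : A → ℝ) :
    (entranceSum ξ f '' Omega ξ).Finite := by
  refine (Set.finite_range fun p : Σ b, Fin (ξ b).length =>
    (((ξ p.1).drop ((ξ p.1).length - p.2)).map f).sum).subset ?_
  rintro _ ⟨x, hx, rfl⟩
  exact ⟨⟨desub ξ x (-1), entrance ξ 1 x, entrance_one_lt h hx⟩, (entranceSum_eq h hx f).symm⟩

theorem isDecaying_of_mem_nilspace {e : A → ℝ} (he : e ∈ nilspace ξ) : IsDecaying ξ e := by
  obtain ⟨k, hk⟩ := exists_pow_eq_zero_of_mem_nilspace he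
  exact tendsto_const_nhds.congr' (eventually_atTop.2 ⟨k, fun n hn => (hk n hn).symm⟩)

/-- The series stops after a bounded number of terms, each with finitely many possible values. -/
theorem finite_image_cocycle (h : IsAperiodic ξ) {e : A → ℝ} (he : e ∈ nilspace ξ) :
    (cocycle ξ e '' Omega ξ).Finite := by
  obtain ⟨k, hk⟩ := exists_pow_eq_zero_of_mem_nilspace he
  have hd := isDecaying_of_mem_nilspace he
  clear he
  induction k generalizing e with
  | zero =>
    refine (Set.finite_singleton 0).subset ?_
    rintro _ ⟨x, -, rfl⟩
    simp [cocycle, hk, entranceSum]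
  | succ k ih =>
    have h1 := ih (e := transposeMap ξ e) (fun n hn => by
      rw [← Module.End.mul_apply, ← pow_succ]; exact hk _ (by omega)) hd.transposeMap
    refine ((finite_image_entranceSum h e).image2 (· + ·) h1).subset ?_
    rintro _ ⟨x, hx, rfl⟩
    exact ⟨_, ⟨x, hx, rfl⟩, _, ⟨_, desub_mem h hx, rfl⟩, (cocycle_eq h hx hd).symm⟩

/-- If the image of `F` covers the torus, the components in `Eˢ` are linearly independent. -/
theorem linearIndependent_of_surjective (h : IsAperiodic ξ) {n : ℕ} {v u : Fin n → A → ℝ}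
    (hv : ∀ i, IsDecaying ξ (v i)) (hu : ∀ i, v i - u i ∈ nilspace ξ)
    (hsurj : (fun x => torusProj (F ξ v x)) '' Omega ξ = Set.univ) : LinearIndependent ℝ u := by
  rw [Fintype.linearIndependent_iff]
  intro g hg
  by_contra! hne
  have hg0 : g ≠ 0 := fun h0 => by simp [h0] at hne
  have he : ∑ i, g i • v i ∈ nilspace ξ := by
    have : ∑ i, g i • v i = ∑ i, g i • (v i - u i) := by
      simp only [smul_sub, Finset.sum_sub_distrib, hg, sub_zero]
    rw [this]
    exact Submodule.sum_mem _ fun i _ => Submodule.smul_mem _ _ (hu i)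
  have hfin := finite_image_cocycle h he
  -- A relation among the `u i` puts the combination of the `v i` into E⁰, so a nonzero linear form
  -- takes finitely many values on the image of `F`.
  have hsub : F ξ v '' Omega ξ ⊆ ⋃ c ∈ cocycle ξ (∑ i, g i • v i) '' Omega ξ,
      {y | ∑ i, g i * y i = c} := by
    rintro _ ⟨x, hx, rfl⟩
    refine Set.mem_iUnion₂.2 ⟨_, ⟨x, hx, rfl⟩, ?_⟩
    rw [Set.mem_ofPred_eq, F_eq h hx, cocycle_sum h hx _ _ fun i _ => hv i]
  have hnull : volume (F ξ v '' Omega ξ) = 0 :=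
    measure_mono_null hsub ((measure_biUnion_null_iff hfin.countable).2 fun c _ =>
      volume_setOf_sum_eq hg0 c)
  have h1 := volume_torusProj_image_eq_zero hnull
  rw [Set.image_image, hsurj, measure_univ] at h1
  exact one_ne_zero h1

end Nilpotent

end Subst

namespace Subst

/-! ### The affine system of the image of F and injectivity almost everywhere -/

section Pieces

variable {A : Type*} [Fintype A] [DecidableEq A] {ξ : A → List A} {n : ℕ} {u : Fin n → A → ℝ}
  {N : Matrix (Fin n) (Fin n) ℝ}

/-- The positions in the words `ξ b`, counted from the right. -/
abbrev Position (ξ : A → List A) : Type _ := Σ b, Fin (ξ b).length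

/-- The letter at a position. -/
def Position.letter (p : Position ξ) : A := (ξ p.1).get p.2.rev

/-- The sum of `f` over the letters to the right of a position. -/
def Position.tailSum (p : Position ξ) (f : A → ℝ) : ℝ :=
  (((ξ p.1).drop ((ξ p.1).length - p.2)).map f).sum

/-- The position of the origin of a point of `Ω_ξ` in its desubstitution. -/
noncomputable def address (h : IsAperiodic ξ) {x : ℤ → A} (hx : x ∈ Omega ξ) : Position ξ :=
  ⟨desub ξ x (-1), entrance ξ 1 x, entrance_one_lt h hx⟩

theorem letter_address (h : IsAperiodic ξ) {x : ℤ → A} (hx : x ∈ Omega ξ) :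
    (address h hx).letter = x (-1) := by
  have h1 := apply_neg_one_eq h hx
  have h2 := entrance_one_lt h hx
  rw [List.getElem?_eq_getElem (by omega), Option.some_inj] at h1
  rw [← h1, Position.letter, List.get_eq_getElem]
  simp only [address, Fin.val_rev]
  congr 1
  omega

theorem F_eq_add_mulVec (h : IsAperiodic ξ) (hu : ∀ i, IsDecaying ξ (u i))
    (hN : ∀ i, transposeMap ξ (u i) = ∑ j, N i j • u j) {x : ℤ → A} (hx : x ∈ Omega ξ) :
    F ξ u x = (fun i => (address h hx).tailSum (u i)) + N *ᵥ F ξ u (desub ξ x) := by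
  rw [F_eq h hx, F_eq h (desub_mem h hx)]
  funext i
  rw [cocycle_eq h hx (hu i), entranceSum_eq h hx, hN,
    cocycle_sum h (desub_mem h hx) _ _ fun j _ => hu j]
  rfl

/-- With an eigenvector for β as `l`, this is the balance condition of the affine system, since
β|det N| = 1. -/
theorem sum_letter (l : A → ℝ) (b : A) :
    ∑ p ∈ Finset.univ.filter (fun p : Position ξ => p.1 = b), l p.letter = transposeMap ξ l b := by
  rw [transposeMap_apply, Finset.sum_filter, Fintype.sum_sigma, Finset.sum_eq_single b]
  · simp only [if_true, Position.letter]
    refine (Equiv.sum_comp Fin.revPerm fun k => l ((ξ b).get k)).trans ?_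
    conv_rhs => rw [← List.ofFn_get (ξ b), List.map_ofFn, List.sum_ofFn]
    rfl
  · intro b' _ hb'
    simp [hb']
  · simp

variable [TopologicalSpace A] [DiscreteTopology A]

theorem continuousOn_F (h : IsAperiodic ξ) {v : Fin n → A → ℝ} (hv : ∀ i, IsDecaying ξ (v i)) :
    ContinuousOn (F ξ v) (Omega ξ) :=
  (continuousOn_pi.2 fun i => continuousOn_cocycle h (hv i)).congr fun _ hx => F_eq h hx v

/-- The image under `F` of the points with a given letter before the origin. -/
def piece (ξ : A → List A) {n : ℕ} (u : Fin n → A → ℝ) (b : A) : Set (Fin n → ℝ) :=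
  F ξ u '' {x ∈ Omega ξ | x (-1) = b}

theorem isCompact_piece (h : IsAperiodic ξ) (hu : ∀ i, IsDecaying ξ (u i)) (b : A) :
    IsCompact (piece ξ u b) := by
  have hcl : IsClosed (Omega ξ ∩ (fun x : ℤ → A => x (-1)) ⁻¹' {b}) :=
    (isClosed_Omega ξ).inter ((isClosed_discrete {b}).preimage (continuous_apply (-1 : ℤ)))
  exact hcl.isCompact.image_of_continuousOn ((continuousOn_F h hu).mono fun x hx => hx.1)

theorem piece_subset (h : IsAperiodic ξ) (hu : ∀ i, IsDecaying ξ (u i))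
    (hN : ∀ i, transposeMap ξ (u i) = ∑ j, N i j • u j) (a : A) :
    piece ξ u a ⊆ ⋃ p ∈ Finset.univ.filter fun p : Position ξ => p.letter = a,
      affineImage N (fun i => p.tailSum (u i)) (piece ξ u p.1) := by
  rintro _ ⟨x, ⟨hx, rfl⟩, rfl⟩
  refine Set.mem_iUnion₂.2 ⟨address h hx, by simp [letter_address], _, ⟨_, ⟨desub_mem h hx, rfl⟩, rfl⟩,
    (F_eq_add_mulVec h hu hN hx).symm⟩

/-- The affine image of a set of values at a position. -/
abbrev Position.image (N : Matrix (Fin n) (Fin n) ℝ) (u : Fin n → A → ℝ) (p : Position ξ)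
    (X : Set (Fin n → ℝ)) : Set (Fin n → ℝ) :=
  affineImage N (fun i => p.tailSum (u i)) X

theorem F_mem_image (h : IsAperiodic ξ) (hu : ∀ i, IsDecaying ξ (u i))
    (hN : ∀ i, transposeMap ξ (u i) = ∑ j, N i j • u j) {x : ℤ → A} (hx : x ∈ Omega ξ) :
    F ξ u x ∈ (address h hx).image N u (piece ξ u (address h hx).1) :=
  ⟨_, ⟨_, ⟨desub_mem h hx, rfl⟩, rfl⟩, (F_eq_add_mulVec h hu hN hx).symm⟩

theorem volume_image_inter_eq_zero (h : IsAperiodic ξ) (hu : ∀ i, IsDecaying ξ (u i))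
    (hN : ∀ i, transposeMap ξ (u i) = ∑ j, N i j • u j) {l : A → ℝ} (hl : ∀ a, 0 < l a)
    {β : ℝ} (hβl : transposeMap ξ l = β • l) (hβ : β * |N.det| = 1) {p q : Position ξ}
    (hpq : p ≠ q) (hletter : p.letter = q.letter) :
    volume (p.image N u (piece ξ u p.1) ∩ q.image N u (piece ξ u q.1)) = 0 :=
  volume_affineImage_inter_eq_zero (src := fun p : Position ξ => p.1)
    (letter := fun p : Position ξ => p.letter) (t := fun (p : Position ξ) i => p.tailSum (u i))
    (isCompact_piece h hu) (piece_subset h hu hN) hl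
    (fun b => by
      rw [sum_letter, hβl, Pi.smul_apply, smul_eq_mul, ← mul_assoc, mul_comm _ β, hβ, one_mul])
    hpq hletter

/-- All words ξ(b) end with one letter, and the last position has an empty tail. So the linear
images of the pieces of `a` and `b` under `N` are pieces of one set, and `N` is invertible. -/
theorem volume_piece_inter_eq_zero (h : IsAperiodic ξ) (hu : ∀ i, IsDecaying ξ (u i))
    (hN : ∀ i, transposeMap ξ (u i) = ∑ j, N i j • u j) {l : A → ℝ} (hl : ∀ a, 0 < l a)
    {β : ℝ} (hβl : transposeMap ξ l = β • l) (hβ : β * |N.det| = 1) {a b : A} (hab : a ≠ b) :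
    volume (piece ξ u a ∩ piece ξ u b) = 0 := by
  have hdet : N.det ≠ 0 := fun h0 => by simp [h0] at hβ
  obtain ⟨-, r, hr⟩ := h.proper
  let z : ∀ b, Position ξ := fun b => ⟨b, 0, List.length_pos_iff.2 (h.ne_nil b)⟩
  have hz : ∀ b, (z b).letter = r := fun b => by
    have h1 := hr b
    have h2 := List.length_pos_iff.2 (h.ne_nil b)
    rw [List.getLast?_eq_getElem?, List.getElem?_eq_getElem (by omega), Option.some_inj] at h1
    rw [← h1, Position.letter, List.get_eq_getElem]
    simp [z, Fin.val_rev]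
  have ht : ∀ b, (fun i => (z b).tailSum (u i)) = 0 := fun b => by
    funext i
    simp [z, Position.tailSum]
  have h1 := volume_image_inter_eq_zero h hu hN hl hβl hβ (p := z a) (q := z b)
    (fun e => hab (congrArg Sigma.fst e)) ((hz a).trans (hz b).symm)
  rw [Position.image, Position.image, ht, ht] at h1
  have h3 : volume (affineImage N 0 (piece ξ u a ∩ piece ξ u b)) = 0 :=
    measure_mono_null (Set.subset_inter (Set.image_mono Set.inter_subset_left)
      (Set.image_mono Set.inter_subset_right)) h1
  rw [volume_affineImage, mul_eq_zero] at h3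
  exact h3.resolve_left (by simpa using hdet)

theorem exists_null_address_eq (h : IsAperiodic ξ) (hu : ∀ i, IsDecaying ξ (u i))
    (hN : ∀ i, transposeMap ξ (u i) = ∑ j, N i j • u j) {l : A → ℝ} (hl : ∀ a, 0 < l a)
    {β : ℝ} (hβl : transposeMap ξ l = β • l) (hβ : β * |N.det| = 1) :
    ∃ D : Set (Fin n → ℝ), volume D = 0 ∧ ∀ {x x'} (hx : x ∈ Omega ξ) (hx' : x' ∈ Omega ξ),
      F ξ u x ∉ D → F ξ u x = F ξ u x' → x (-1) = x' (-1) ∧ address h hx = address h hx' := by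
  refine ⟨(⋃ (a : A) (b : A) (_ : a ≠ b), piece ξ u a ∩ piece ξ u b) ∪
    ⋃ (p : Position ξ) (q : Position ξ) (_ : p ≠ q) (_ : p.letter = q.letter),
      p.image N u (piece ξ u p.1) ∩ q.image N u (piece ξ u q.1), measure_union_null ?_ ?_, ?_⟩
  · simp only [measure_iUnion_null_iff]
    exact fun a b hab => volume_piece_inter_eq_zero h hu hN hl hβl hβ hab
  · simp only [measure_iUnion_null_iff]
    exact fun p q hpq hpq' => volume_image_inter_eq_zero h hu hN hl hβl hβ hpq hpq'
  · intro x x' hx hx' hnD hxx'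
    have hl1 : x (-1) = x' (-1) := by
      by_contra hne
      exact hnD (.inl (Set.mem_iUnion₂.2 ⟨_, _, Set.mem_iUnion.2
        ⟨hne, ⟨x, ⟨hx, rfl⟩, rfl⟩, ⟨x', ⟨hx', rfl⟩, hxx'.symm⟩⟩⟩))
    refine ⟨hl1, ?_⟩
    by_contra hne
    refine hnD (.inr (Set.mem_iUnion₂.2 ⟨_, _, Set.mem_iUnion₂.2
      ⟨hne, ?_, F_mem_image h hu hN hx, hxx' ▸ F_mem_image h hu hN hx'⟩⟩))
    rw [letter_address, letter_address, hl1]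

/-- `F` is injective up to a null set of values, when it is built on a basis of `Eˢ`. -/
theorem exists_null_injOn (h : IsAperiodic ξ) (hu : ∀ i, IsDecaying ξ (u i))
    (hN : ∀ i, transposeMap ξ (u i) = ∑ j, N i j • u j) {l : A → ℝ} (hl : ∀ a, 0 < l a)
    {β : ℝ} (hβl : transposeMap ξ l = β • l) (hβ : β * |N.det| = 1) :
    ∃ N₀ : Set (Fin n → ℝ), volume N₀ = 0 ∧
      Set.InjOn (F ξ u) {x ∈ Omega ξ | F ξ u x ∉ N₀} := by
  have hdet : N.det ≠ 0 := fun h0 => by simp [h0] at hβ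
  have hinj : Function.Injective fun y : Fin n → ℝ => N *ᵥ y :=
    Matrix.mulVec_injective_iff_isUnit.2 ((Matrix.isUnit_iff_isUnit_det N).2 hdet.isUnit)
  obtain ⟨D, hD, haddr⟩ := exists_null_address_eq h hu hN hl hβl hβ
  -- Values some desubstitution of which may fall in the bad set `D`. Avoiding all `E k` passes from
  -- a point to its desubstitution.
  let E : ℕ → Set (Fin n → ℝ) := fun k => (fun X => ⋃ p : Position ξ, p.image N u X)^[k] D
  have hsucc : ∀ k, E (k + 1) = ⋃ p : Position ξ, p.image N u (E k) := fun k =>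
    Function.iterate_succ_apply' _ _ _
  have hE : ∀ k, volume (E k) = 0 := by
    intro k
    induction k with
    | zero => exact hD
    | succ k ih =>
      rw [hsucc]
      refine measure_iUnion_null_iff.2 fun p => ?_
      rw [volume_affineImage]
      exact mul_eq_zero_of_right _ ih
  refine ⟨⋃ k, E k, measure_iUnion_null_iff.2 hE, ?_⟩
  rintro x ⟨hx, hxN⟩ x' ⟨hx', -⟩ hxx'
  refine eq_of_forall_address_eq h (Q := fun x x' => x ∈ Omega ξ ∧ x' ∈ Omega ξ ∧
    F ξ u x ∉ ⋃ k, E k ∧ F ξ u x = F ξ u x') ?_ ⟨hx, hx', hxN, hxx'⟩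
  clear! x x'
  rintro x x' ⟨hx, hx', hxN, hxx'⟩
  obtain ⟨hl1, ha⟩ := haddr hx hx' (fun h0 => hxN (Set.mem_iUnion.2 ⟨0, h0⟩)) hxx'
  have e1 := F_eq_add_mulVec h hu hN hx
  have e2 := F_eq_add_mulVec h hu hN hx'
  have hent : entrance ξ 1 x = entrance ξ 1 x' := congrArg (fun p : Position ξ => (p.2 : ℕ)) ha
  refine ⟨hx, hx', hl1, hent, desub_mem h hx, desub_mem h hx', fun h0 => ?_, ?_⟩
  · obtain ⟨k, hk⟩ := Set.mem_iUnion.1 h0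
    refine hxN (Set.mem_iUnion.2 ⟨k + 1, ?_⟩)
    rw [hsucc]
    exact Set.mem_iUnion.2 ⟨address h hx, _, hk, e1.symm⟩
  · rw [← ha, ← hxx', e1] at e2
    exact hinj (add_left_cancel e2)

end Pieces

/-- A basis of `Eˢ` yields a matrix of the transposed incidence map on `Eˢ`. -/
theorem exists_matrix_of_linearIndependent {A : Type*} [Fintype A] [DecidableEq A] {ξ : A → List A}
    {n : ℕ} {u : Fin n → A → ℝ} (hu : ∀ i, u i ∈ stable ξ) (hli : LinearIndependent ℝ u)
    (hdim : Module.finrank ℝ (stable ξ) = n) : ∃ N : Matrix (Fin n) (Fin n) ℝ,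
      N.det = LinearMap.det ((transposeMap ξ).restrict (stable_invariant ξ)) ∧
      ∀ i, transposeMap ξ (u i) = ∑ j, N i j • u j := by
  set u' : Fin n → stable ξ := fun i => ⟨u i, hu i⟩
  have hli' : LinearIndependent ℝ u' := LinearIndependent.of_comp (stable ξ).subtype hli
  let b := Module.Basis.mk hli' (hli'.span_eq_top_of_card_eq_finrank' (by simp [hdim])).ge
  set T := (transposeMap ξ).restrict (stable_invariant ξ)
  refine ⟨(LinearMap.toMatrix b b T)ᵀ, by rw [Matrix.det_transpose, LinearMap.det_toMatrix], ?_⟩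
  intro i
  have h1 := b.sum_repr (T (b i))
  have h2 : ∀ i, b i = u' i := fun i => Module.Basis.mk_apply _ _ _
  have h3 := congrArg Subtype.val h1
  simp only [Submodule.coe_sum, Submodule.coe_smul, h2] at h3
  simp only [Matrix.transpose_apply, LinearMap.toMatrix_apply, h2]
  exact h3.symm

end Subst

namespace Subst

/-! ### The factor map onto the torus -/

section Factor

variable {A : Type*} [Fintype A] [DecidableEq A] {ξ : A → List A} {n : ℕ} {α : Fin n → ℝ}
  {v : Fin n → A → ℝ} {w : Fin n → A → ℤ}

theorem torusProj_F_shift (h : IsAperiodic ξ) (hd : IsDecomposition ξ α v w) {x : ℤ → A}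
    (hx : x ∈ Omega ξ) :
    torusProj (F ξ v (shift x)) = torusProj (F ξ v x) - torusProj α := by
  rw [← torusProj_sub, torusProj_eq_iff]
  refine ⟨fun i => w i (x 0), ?_⟩
  rw [F_eq h hx, F_eq h (shift_mem hx)]
  funext i
  have := (hd i).1 (x 0)
  rw [cocycle_shift h hx (hd i).2, Pi.sub_apply]
  linarith

/-- The number of points of `Ω_ξ` above a point of the torus is invariant. -/
theorem encard_fibre_sub (h : IsAperiodic ξ) (hd : IsDecomposition ξ α v w)
    (t : Fin n → UnitAddCircle) :
    {x ∈ Omega ξ | torusProj (F ξ v x) = t - torusProj α}.encard =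
      {x ∈ Omega ξ | torusProj (F ξ v x) = t}.encard := by
  have hinj : Function.Injective (shift : (ℤ → A) → ℤ → A) := fun x y hxy => funext fun k => by
    simpa [shift] using congrFun hxy (k - 1)
  rw [← hinj.encard_image {x ∈ Omega ξ | torusProj (F ξ v x) = t}]
  congr 1
  ext x
  constructor
  · rintro ⟨hx, hxt⟩
    have hs : shift (fun k => x (k + -1)) = x := funext fun k => by simp [shift]
    have hx' := comp_add_mem_Omega hx (-1)
    refine ⟨_, ⟨hx', ?_⟩, hs⟩
    have := torusProj_F_shift h hd hx'
    rw [hs, hxt] at this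
    exact (sub_left_injective this).symm
  · rintro ⟨x, ⟨hx, rfl⟩, rfl⟩
    exact ⟨shift_mem hx, torusProj_F_shift h hd hx⟩

variable [TopologicalSpace A] [DiscreteTopology A]

theorem continuousOn_torusProj_F (h : IsAperiodic ξ) (hv : ∀ i, IsDecaying ξ (v i)) :
    ContinuousOn (fun x => torusProj (F ξ v x)) (Omega ξ) :=
  continuous_torusProj.comp_continuousOn (continuousOn_F h hv)

variable [MeasurableSpace A] [DiscreteMeasurableSpace A] {μ : Measure (ℤ → A)}

theorem aemeasurable_torusProj_F (h : IsAperiodic ξ) (hμ : IsInvariantProbability ξ μ)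
    (hv : ∀ i, IsDecaying ξ (v i)) : AEMeasurable (fun x => torusProj (F ξ v x)) μ := by
  have h1 := (continuousOn_torusProj_F h hv).aemeasurable (μ := μ) (isClosed_Omega ξ).measurableSet
  rwa [Measure.restrict_eq_self_of_ae_mem hμ.carried] at h1

theorem map_torusProj_F (h : IsAperiodic ξ) (hμ : IsInvariantProbability ξ μ)
    (hα : LinearIndependent ℚ (Fin.cons 1 α : Fin (n + 1) → ℝ)) (hd : IsDecomposition ξ α v w) :
    μ.map (fun x => torusProj (F ξ v x)) = volume := by
  have _ := hμ.prob
  have hm := aemeasurable_torusProj_F h hμ fun i => (hd i).2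
  have _ : IsProbabilityMeasure (μ.map fun x => torusProj (F ξ v x)) :=
    Measure.isProbabilityMeasure_map hm
  have hsub := measurePreserving_sub_torus (torusProj α)
  refine eq_of_invariant hα ⟨hsub.measurable, ?_⟩ hsub (by simp)
  rw [AEMeasurable.map_map_of_aemeasurable hsub.measurable.aemeasurable hm]
  have h1 : (fun t => t - torusProj α) ∘ (fun x => torusProj (F ξ v x)) =ᵐ[μ]
      (fun x => torusProj (F ξ v x)) ∘ shift := by
    filter_upwards [hμ.carried] with x hx
    exact (torusProj_F_shift h hd hx).symm
  rw [Measure.map_congr h1, ← AEMeasurable.map_map_of_aemeasurable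
    (by rwa [hμ.invariant.map_eq]) hμ.invariant.measurable.aemeasurable, hμ.invariant.map_eq]

/-- The image is closed and carries the image measure, which is Lebesgue; its complement is open and
null, hence empty. -/
theorem image_torusProj_F (h : IsAperiodic ξ) (hμ : IsInvariantProbability ξ μ)
    (hα : LinearIndependent ℚ (Fin.cons 1 α : Fin (n + 1) → ℝ)) (hd : IsDecomposition ξ α v w) :
    (fun x => torusProj (F ξ v x)) '' Omega ξ = Set.univ := by
  have hcl : IsClosed ((fun x => torusProj (F ξ v x)) '' Omega ξ) :=
    ((isClosed_Omega ξ).isCompact.image_of_continuousOn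
      (continuousOn_torusProj_F h fun i => (hd i).2)).isClosed
  have h0 : volume ((fun x => torusProj (F ξ v x)) '' Omega ξ)ᶜ = 0 := by
    rw [← map_torusProj_F h hμ hα hd, Measure.map_apply_of_aemeasurable
      (aemeasurable_torusProj_F h hμ fun i => (hd i).2) hcl.measurableSet.compl]
    refine measure_mono_null (fun x hx hxΩ => hx ⟨x, hxΩ, rfl⟩) hμ.carried
  have h1 := (hcl.isOpen_compl.measure_eq_zero_iff volume).1 h0
  rwa [Set.compl_empty_iff] at h1

end Factor

/-! ### Counting the points of a fibre -/

section Counting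

variable {A : Type*} [Fintype A] [DecidableEq A] [TopologicalSpace A] [DiscreteTopology A]
  {ξ : A → List A} {n : ℕ} {v u : Fin n → A → ℝ}

/-- Each coordinate of the difference is the cocycle of `v i - u i`, a vector of E⁰. -/
theorem finite_image_F_sub (h : IsAperiodic ξ) (hv : ∀ i, IsDecaying ξ (v i))
    (hu : ∀ i, IsDecaying ξ (u i)) (huv : ∀ i, v i - u i ∈ nilspace ξ) :
    ((fun x => F ξ v x - F ξ u x) '' Omega ξ).Finite := by
  refine (Set.Finite.pi' fun i => finite_image_cocycle h (huv i)).subset ?_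
  rintro _ ⟨x, hx, rfl⟩ i
  refine ⟨x, hx, ?_⟩
  have h1 := cocycle_sum h hx Finset.univ ![1, -1] (v := ![v i, u i])
    (by intro j _; fin_cases j; exacts [hv i, hu i])
  simp only [Fin.sum_univ_two, Matrix.cons_val_zero, Matrix.cons_val_one, one_smul, neg_smul,
    one_mul, neg_mul, ← sub_eq_add_neg] at h1
  rw [h1]
  simp only [F_eq h hx, Pi.sub_apply]

/-- The mean number of points of `Ω_ξ` above a point of the torus is the volume of the image of `F`,
for a map `F` that is almost injective. -/
theorem exists_measurable_encard_fibre (h : IsAperiodic ξ) (hv : ∀ i, IsDecaying ξ (v i))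
    (hu : ∀ i, IsDecaying ξ (u i)) (huv : ∀ i, v i - u i ∈ nilspace ξ) {N₀ : Set (Fin n → ℝ)}
    (hN₀ : volume N₀ = 0) (hinj : Set.InjOn (F ξ u) {x ∈ Omega ξ | F ξ u x ∉ N₀}) :
    AEMeasurable (fun t => (({x ∈ Omega ξ | torusProj (F ξ v x) = t}.encard : ℕ∞) : ENNReal))
      volume ∧
    ∫⁻ t, (({x ∈ Omega ξ | torusProj (F ξ v x) = t}.encard : ℕ∞) : ENNReal) =
      volume (F ξ u '' Omega ξ) := by
  have hfin := finite_image_F_sub h hv hu huv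
  set Γ := hfin.toFinset
  -- On `W g` the two maps differ by the translation `g`, so volumes and almost injectivity pass
  -- from `u` to `v` piece by piece; different pieces may still overlap under `F ξ v`.
  let W : (Fin n → ℝ) → Set (ℤ → A) := fun g => Omega ξ ∩ (fun x => F ξ v x - F ξ u x) ⁻¹' {g}
  have hW : ∀ g, IsCompact (W g) := fun g =>
    (((continuousOn_F h hv).sub (continuousOn_F h hu)).preimage_isClosed_of_isClosed
      (isClosed_Omega ξ) isClosed_singleton).isCompact
  have hWΩ : ∀ g, W g ⊆ Omega ξ := fun g => Set.inter_subset_left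
  have hWF : ∀ {g x}, x ∈ W g → F ξ v x = g + F ξ u x := fun hx => by
    rw [← hx.2]; simp
  have hcv : ∀ g, IsCompact (F ξ v '' W g) := fun g =>
    (hW g).image_of_continuousOn ((continuousOn_F h hv).mono (hWΩ g))
  have hcu : ∀ g, IsCompact (F ξ u '' W g) := fun g =>
    (hW g).image_of_continuousOn ((continuousOn_F h hu).mono (hWΩ g))
  have hΓ : ∀ {x}, x ∈ Omega ξ → F ξ v x - F ξ u x ∈ Γ := fun hx =>
    hfin.mem_toFinset.2 ⟨_, hx, rfl⟩
  have hvol : ∀ g, volume (F ξ v '' W g) = volume (F ξ u '' W g) := by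
    intro g
    have : F ξ v '' W g = (fun y => -g + y) ⁻¹' (F ξ u '' W g) := by
      ext y
      simp only [Set.mem_image, Set.mem_preimage]
      refine exists_congr fun x => and_congr_right fun hx => ?_
      rw [hWF hx, eq_neg_add_iff_add_eq]
    rw [this, measure_preimage_add]
  have hcount : ∀ᵐ t : Fin n → UnitAddCircle,
      (({x ∈ Omega ξ | torusProj (F ξ v x) = t}.encard : ℕ∞) : ENNReal) =
      ∑ g ∈ Γ, (({z ∈ F ξ v '' W g | torusProj z = t}.encard : ℕ∞) : ENNReal) := by
    have hnull : ∀ g ∈ Γ, ∀ᵐ t : Fin n → UnitAddCircle, t ∉ torusProj '' ((fun y => -g + y) ⁻¹' N₀) :=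
      fun g _ => measure_eq_zero_iff_ae_notMem.1
        (volume_torusProj_image_eq_zero (by rw [measure_preimage_add, hN₀]))
    filter_upwards [(Finset.eventually_all Γ).2 hnull] with t ht
    have h1 : {x ∈ Omega ξ | torusProj (F ξ v x) = t} =
        ⋃ g ∈ (Γ : Set (Fin n → ℝ)), {x ∈ W g | torusProj (F ξ v x) = t} := by
      ext x
      simp only [Set.mem_iUnion₂]
      exact ⟨fun hx => ⟨_, hΓ hx.1, ⟨hx.1, rfl⟩, hx.2⟩, fun ⟨g, _, hx, hxt⟩ => ⟨hWΩ g hx, hxt⟩⟩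
    have h2 : (Γ : Set (Fin n → ℝ)).PairwiseDisjoint
        fun g => {x ∈ W g | torusProj (F ξ v x) = t} := by
      intro g _ g' _ hne
      exact Set.disjoint_left.2 fun x hx hx' => hne (hx.1.2.symm.trans hx'.1.2)
    rw [h1, Γ.finite_toSet.encard_biUnion h2, finsum_mem_coe_finset, ← ENat.toENNRealRingHom_apply, map_sum]
    refine Finset.sum_congr rfl fun g hg => ?_
    have h3 : {z ∈ F ξ v '' W g | torusProj z = t} =
        F ξ v '' {x ∈ W g | torusProj (F ξ v x) = t} := by
      ext z
      constructor
      · rintro ⟨⟨x, hx, rfl⟩, hxt⟩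
        exact ⟨x, ⟨hx, hxt⟩, rfl⟩
      · rintro ⟨x, ⟨hx, hxt⟩, rfl⟩
        exact ⟨⟨x, hx, rfl⟩, hxt⟩
    have h4 : Set.InjOn (F ξ v) {x ∈ W g | torusProj (F ξ v x) = t} := by
      have hnot : ∀ {x}, x ∈ W g → torusProj (F ξ v x) = t → F ξ u x ∉ N₀ := by
        intro x hx hxt h0
        refine ht g hg ⟨F ξ v x, ?_, hxt⟩
        rw [Set.mem_preimage, hWF hx, neg_add_cancel_left]
        exact h0
      rintro x ⟨hx, hxt⟩ x' ⟨hx', hxt'⟩ hxx'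
      rw [hWF hx, hWF hx'] at hxx'
      exact hinj ⟨hx.1, hnot hx hxt⟩ ⟨hx'.1, hnot hx' hxt'⟩ (add_left_cancel hxx')
    rw [h3, h4.encard_image]
  have hmeas : ∀ g ∈ Γ, Measurable fun t : Fin n → UnitAddCircle =>
      (({z ∈ F ξ v '' W g | torusProj z = t}.encard : ℕ∞) : ENNReal) := fun g _ =>
    measurable_encard_fibre (hcv g).measurableSet
  refine ⟨⟨_, Finset.measurable_fun_sum Γ hmeas, hcount⟩, ?_⟩
  rw [lintegral_congr_ae hcount, lintegral_finsetSum _ hmeas]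
  simp only [lintegral_encard_fibre (hcv _).measurableSet, hvol]
  have hunion : F ξ u '' Omega ξ = ⋃ g ∈ Γ, F ξ u '' W g := by
    ext y
    simp only [Set.mem_iUnion₂]
    constructor
    · rintro ⟨x, hx, rfl⟩
      exact ⟨_, hΓ hx, x, ⟨hx, rfl⟩, rfl⟩
    · rintro ⟨g, _, x, hx, rfl⟩
      exact ⟨x, hx.1, rfl⟩
  rw [hunion, measure_biUnion_finset₀ _ fun g _ => (hcu g).measurableSet.nullMeasurableSet]
  intro g _ g' _ hne
  -- Here `u` is needed: a common value of `F ξ u` outside `N₀` comes from one point, which lies in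
  -- one `W g` only.
  refine measure_mono_null ?_ hN₀
  rintro _ ⟨⟨x, hx, rfl⟩, ⟨x', hx', hxx'⟩⟩
  by_contra h0
  have : x' = x := hinj ⟨hx'.1, by rwa [hxx']⟩ ⟨hx.1, h0⟩ hxx'
  subst this
  exact hne (hx.2.symm.trans hx'.2)

/-- The number of points of `Ω_ξ` above almost every point of the torus is the volume of the image of
`F`, for a map `F` that is almost injective. -/
theorem exists_ae_encard_fibre_eq (h : IsAperiodic ξ) {α : Fin n → ℝ} {w : Fin n → A → ℤ}
    (hα : LinearIndependent ℚ (Fin.cons 1 α : Fin (n + 1) → ℝ)) (hd : IsDecomposition ξ α v w)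
    (hu : ∀ i, IsDecaying ξ (u i)) (huv : ∀ i, v i - u i ∈ nilspace ξ) {N₀ : Set (Fin n → ℝ)}
    (hN₀ : volume N₀ = 0) (hinj : Set.InjOn (F ξ u) {x ∈ Omega ξ | F ξ u x ∉ N₀}) :
    ∃ Z : ℕ, volume (F ξ u '' Omega ξ) = Z ∧
      ∀ᵐ t, {x ∈ Omega ξ | torusProj (F ξ v x) = t}.encard = Z := by
  obtain ⟨hm, hint⟩ := exists_measurable_encard_fibre h (fun i => (hd i).2) hu huv hN₀ hinj
  obtain ⟨C, hC⟩ := (ergodic_sub_torusProj hα).quasiErgodic.ae_eq_const_of_ae_eq_comp_ae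
    hm.aestronglyMeasurable (.of_forall fun t => by
      simp only [Function.comp_apply, encard_fibre_sub h hd])
  rw [lintegral_congr_ae hC] at hint
  simp only [Function.const_apply, lintegral_const, measure_univ, mul_one] at hint
  have hfin : volume (F ξ u '' Omega ξ) ≠ ⊤ :=
    ((isClosed_Omega ξ).isCompact.image_of_continuousOn (continuousOn_F h hu)).measure_lt_top.ne
  obtain ⟨t, ht⟩ := hC.exists
  simp only [Function.const_apply] at ht
  -- The almost constant value equals the volume of a compact set, so it is finite; being a
  -- cardinality, it is an integer.
  have htop : {x ∈ Omega ξ | torusProj (F ξ v x) = t}.encard ≠ ⊤ := fun h0 => by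
    rw [h0] at ht
    exact hfin (hint.symm.trans (ht.symm.trans ENat.toENNReal_top))
  obtain ⟨Z, hZ⟩ := ENat.ne_top_iff_exists.1 htop
  have hZC : C = ((Z : ℕ∞) : ENNReal) := by rw [hZ, ht]
  refine ⟨Z, by rw [← hint, hZC]; simp, hC.mono fun s hs => ?_⟩
  rw [Function.const_apply, hZC] at hs
  exact ENat.toENNReal_inj.1 hs

end Counting

end Subst

/-! ### The theorem -/

theorem Subst.HypothesesP.exists_ae_encard_fibre_eq {A : Type*} [Fintype A] [DecidableEq A]
    [TopologicalSpace A] [DiscreteTopology A] [MeasurableSpace A] [DiscreteMeasurableSpace A]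
    {ξ : A → List A} {μ : Measure (ℤ → A)} {n : ℕ} {α : Fin n → ℝ} (hP : HypothesesP ξ μ α)
    {v u : Fin n → A → ℝ} {w : Fin n → A → ℤ} (hd : IsDecomposition ξ α v w)
    (hu : IsStablePart ξ v u) :
    ∃ Z : ℕ, volume (F ξ u '' Omega ξ) = Z ∧
      ∀ᵐ t, {x ∈ Omega ξ | torusProj (F ξ v x) = t}.encard = Z := by
  have h : IsAperiodic ξ := ⟨hP.isRegular, hP.aperiodic⟩
  have := hP.nonempty
  have hud : ∀ i, IsDecaying ξ (u i) := fun i => (hu i).1.2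
  have hli := linearIndependent_of_surjective h (fun i => (hd i).2) (fun i => (hu i).2)
    (image_torusProj_F h hP.measure hP.independent hd)
  obtain ⟨N, hdet, hN⟩ := exists_matrix_of_linearIndependent (fun i => (hu i).1) hli hP.dim_stable
  obtain ⟨β, -, hβ, -, -, l, hl, hβl⟩ := exists_perron hP.primitive hP.unique_root
  obtain ⟨N₀, hN₀, hinj⟩ := exists_null_injOn h hud hN hl hβl (by rw [hdet, hP.det_stable β hβ])
  exact Subst.exists_ae_encard_fibre_eq h hP.independent hd hud (fun i => (hu i).2) hN₀ hinj

theorem mainTheorem7 {A : Type*} [Fintype A] [DecidableEq A]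
    [TopologicalSpace A] [DiscreteTopology A] [MeasurableSpace A] [DiscreteMeasurableSpace A]
    (ξ : A → List A) (μ : Measure (ℤ → A)) {n : ℕ} (α : Fin n → ℝ)
    (hP : Subst.HypothesesP ξ μ α) :
    (∃ (v : Fin n → A → ℝ) (w : Fin n → A → ℤ), Subst.IsDecomposition ξ α v w ∧
      ((fun _ : A => (1 : ℝ)) ∈ Subst.eventualRange ξ → ∀ i, v i ∈ Subst.stable ξ)) ∧
    ∀ (v : Fin n → A → ℝ) (w : Fin n → A → ℤ), Subst.IsDecomposition ξ α v w →
      (∀ x ∈ Subst.Omega ξ, ∀ i, Summable (Subst.term ξ v x i)) ∧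
      ContinuousOn (Subst.F ξ v) (Subst.Omega ξ) ∧
      (∀ x ∈ Subst.Omega ξ,
        torusProj (Subst.F ξ v (Subst.shift x)) = torusProj (Subst.F ξ v x) - torusProj α) ∧
      (fun x => torusProj (Subst.F ξ v x)) '' Subst.Omega ξ = Set.univ ∧
      ∃ Z : ℕ,
        (∀ᵐ x ∂μ, {y ∈ Subst.Omega ξ |
          torusProj (Subst.F ξ v y) = torusProj (Subst.F ξ v x)}.encard = Z) ∧
        ((∀ i, v i ∈ Subst.stable ξ) → volume (Subst.F ξ v '' Subst.Omega ξ) = Z) ∧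
        (∃! u : Fin n → A → ℝ, Subst.IsStablePart ξ v u) ∧
        ∀ u : Fin n → A → ℝ, Subst.IsStablePart ξ v u →
          (∀ x ∈ Subst.Omega ξ, ∀ i, Summable (Subst.term ξ u x i)) ∧
          volume (Subst.F ξ u '' Subst.Omega ξ) = Z := by
  have h : Subst.IsAperiodic ξ := ⟨hP.isRegular, hP.aperiodic⟩
  refine ⟨hP.exists_decomposition, fun v w hd => ?_⟩
  have hv : ∀ i, Subst.IsDecaying ξ (v i) := fun i => (hd i).2
  have hex : ∃! u : Fin n → A → ℝ, Subst.IsStablePart ξ v u := by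
    choose u hu huu using fun i => Subst.existsUnique_stable_part (hv i)
    exact ⟨u, hu, fun u' hu' => funext fun i => huu i _ (hu' i)⟩
  obtain ⟨u, hu, huu⟩ := hex
  have hud : ∀ i, Subst.IsDecaying ξ (u i) := fun i => (hu i).1.2
  have hsurj := Subst.image_torusProj_F h hP.measure hP.independent hd
  have hsum : ∀ {v : Fin n → A → ℝ}, (∀ i, Subst.IsDecaying ξ (v i)) →
      ∀ x ∈ Subst.Omega ξ, ∀ i, Summable (Subst.term ξ v x i) := fun {v} hv x hx i =>
    (Subst.summable_cocycle h hx (hv i)).congr fun j => (Subst.term_eq h hx v i j).symm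
  obtain ⟨Z, hZ, hae⟩ := hP.exists_ae_encard_fibre_eq hd hu
  refine ⟨hsum hv, Subst.continuousOn_F h hv, fun x hx => Subst.torusProj_F_shift h hd hx, hsurj,
    Z, ?_, fun hvs => ?_, ⟨u, hu, huu⟩, fun u' hu' => ?_⟩
  -- The volume of the torus is the image of μ, so a property of almost every fibre holds for the
  -- fibre through almost every `x`.
  · rw [← Subst.map_torusProj_F h hP.measure hP.independent hd] at hae
    exact ae_of_ae_map (Subst.aemeasurable_torusProj_F h hP.measure hv) hae
  · have : v = u := huu v fun i => ⟨hvs i, by rw [sub_self]; exact zero_mem _⟩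
    rw [this, hZ]
  · obtain rfl := huu u' hu'
    exact ⟨hsum hud, hZ⟩
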